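/- Let $k$ be a field and let $\Lambda$ be a basic finite-dimensional $k$-algebra with a complete set $e_1,\dots,e_n$ of primitive pairwise orthogonal idempotents (basic means that the indecomposable projective right modules $e_1\Lambda,\dots,e_n\Lambda$ are pairwise non-isomorphic). Let $J\subseteq\{1,\dots,n\}$ be non-empty and $e_J=\sum_{j\in J}e_j$. All modules are finite-dimensional right modules. For a finite-dimensional algebra $A$ we use the following notions. * A $\tau$-rigid pair is a pair $(M,P)$ of an $A$-module $M$ and a projective $A$-module $P$ with $\operatorname{Hom}_A(M,\tau M)=0$ and $\operatorname{Hom}_A(P,M)=0$, where $\tau$ is the Auslander–Reiten translation. The support $\tau$-tilting complex $s\tau\mathcal C(A)$ is the simplicial complex whose vertices are the isomorphism classes of indecomposable $\tau$-rigid pairs and whose faces are the finite sets of such pairs whose (componentwise) direct sum is a $\tau$-rigid pair. * A 2-term object is a complex $P_1\to P_0$ of projective $A$-modules, regarded as an object of the homotopy category $K^b(\operatorname{proj}A)$; it is rigid if $\operatorname{Hom}_{K^b}(X,X[1])=0$. The 2-term silting complex $\mathcal{SC}(A)$ is the simplicial complex whose vertices are the isomorphism classes of indecomposable rigid 2-term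 objects and whose faces are the finite sets of such objects whose direct sum is rigid. * The dual graph (exchange graph) of a simplicial complex has the maximal faces as vertices, two of them being joined by an edge when they differ by exactly one vertex. The $\mathbf g$-vector of a 2-term object $\bigoplus_i (e_i\Lambda)^{b_i}\to\bigoplus_i (e_i\Lambda)^{a_i}$ over $\Lambda$ is $(a_i-b_i)_{i}\in\mathbb Z^n$; the $\mathbf g$-vector of a pair $(M,P)$ is that of $(P_1^M\to P_0^M)\oplus(P\to 0)$, where $P_1^M\to P_0^M$ is a minimal projective presentation of $M$. Then: 1. $s\tau\mathcal C(e_J\Lambda e_J)$ is isomorphic to the subcomplex of $s\tau\mathcal C(\Lambda)$ induced by the vertices whose $\mathbf g$-vectors vanish outside $J$, and the dual graphs of these two complexes are isomorphic. 2. $\mathcal{SC}(e_J\Lambda e_J)$ is isomorphic to the subcomplex $\mathcal{SC}_J(\Lambda)$ of $\mathcal{SC}(\Lambda)$ induced by the vertices whose $\mathbf g$-vectors vanish outside $J$, and the dual graphs of these two complexes are isomorphic. Moreover, these vertices are exactly the ones that are isomorphic in $K^b(\operatorname{proj}\Lambda)$ to a 2-term object $P_1\to P_0$ such that $P_1$ and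 $P_0$ are direct sums of modules $e_j\Lambda$ with $j\in J$. -/

import Mathlib

open CategoryTheory Limits MulOpposite

universe u v

noncomputable section

namespace AbstractSimplicialComplex

variable {V W : Type*}

/-- Two simplicial complexes are isomorphic: a bijection of the vertices which identifies the
faces. -/
def Isomorphic (K : AbstractSimplicialComplex V) (L : AbstractSimplicialComplex W) : Prop :=
  ∃ φ : V ≃ W, ∀ s : Finset V, s ∈ K.faces ↔ s.map φ.toEmbedding ∈ L.faces

/-- The subcomplex induced by a set `S` of vertices: all faces with vertices in `S`. -/
def induced (K : AbstractSimplicialComplex V) (S : Set V) : AbstractSimplicialComplex S where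
  faces := {s | s.map (Function.Embedding.subtype (· ∈ S)) ∈ K.faces}
  isRelLowerSet_faces := by
    intro s hs
    refine ⟨by simpa using (K.isRelLowerSet_faces hs).1, fun t hts ht => ?_⟩
    exact (K.isRelLowerSet_faces hs).2 (Finset.map_subset_map.2 hts) (by simpa using ht)
  singleton_mem x := by simpa using K.singleton_mem x.1

open Classical in
/-- The dual graph: its vertices are the maximal faces, and two of them are joined by an edge
when they differ by exactly one vertex. -/
def dualGraph (K : AbstractSimplicialComplex V) :
    SimpleGraph {F : Finset V // Maximal (· ∈ K.faces) F} where
  Adj F G := (F.1 \ G.1).card = 1 ∧ (G.1 \ F.1).card = 1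
  symm := ⟨fun _ _ h => ⟨h.2, h.1⟩⟩
  loopless := ⟨fun F h => by simp at h⟩

end AbstractSimplicialComplex

namespace SiltingCorner

/-! ### Idempotents and corner algebras -/

/-- A nonzero idempotent which is not a sum of two nonzero orthogonal idempotents. -/
structure IsPrimitiveIdempotent {Λ : Type v} [Ring Λ] (e : Λ) : Prop where
  idem : IsIdempotentElem e
  ne_zero : e ≠ 0
  eq_zero_or : ∀ f g : Λ, IsIdempotentElem f → IsIdempotentElem g → f * g = 0 → g * f = 0 →
    f + g = e → f = 0 ∨ g = 0

/-- The right ideal `e Λ`. Right `Λ`-modules are modules over `Λᵐᵒᵖ`. -/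
abbrev rightIdeal {Λ : Type v} [Ring Λ] (e : Λ) : Submodule Λᵐᵒᵖ Λ :=
  Submodule.span Λᵐᵒᵖ {e}

/-- `e 0, …, e (n-1)` is a complete set of primitive pairwise orthogonal idempotents of `Λ`, and
`Λ` is basic: the indecomposable projective modules `e i Λ` are pairwise non-isomorphic. -/
structure IsBasicSystem {Λ : Type v} [Ring Λ] {n : ℕ} (e : Fin n → Λ) : Prop where
  complete : CompleteOrthogonalIdempotents e
  primitive : ∀ i, IsPrimitiveIdempotent (e i)
  basic : ∀ i j, Nonempty (rightIdeal (e i) ≃ₗ[Λᵐᵒᵖ] rightIdeal (e j)) → i = j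

section Corner

variable {k : Type u} [Field k] {Λ : Type v} [Ring Λ] [Algebra k Λ] {e : Λ}

instance cornerSMul (he : IsIdempotentElem e) : SMul k he.Corner where
  smul c x := ⟨c • x.1, by
    have hx := (Subsemigroup.mem_corner_iff he).1 x.2
    exact (Subsemigroup.mem_corner_iff he).2
      ⟨by rw [mul_smul_comm, hx.1], by rw [smul_mul_assoc, hx.2]⟩⟩

instance cornerModule (he : IsIdempotentElem e) : Module k he.Corner :=
  Function.Injective.module k
    ({ toFun := fun x => x.1, map_zero' := rfl, map_add' := fun _ _ => rfl } : he.Corner →+ Λ)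
    Subtype.val_injective (fun _ _ => rfl)

/-- The `k`-algebra structure of the corner `e Λ e`; its ring structure is Mathlib's. -/
instance cornerAlgebra (he : IsIdempotentElem e) : Algebra k he.Corner :=
  Algebra.ofModule (fun c x y => Subtype.ext (smul_mul_assoc c x.1 y.1))
    (fun c x y => Subtype.ext (mul_smul_comm c x.1 y.1))

instance cornerFinite [Module.Finite k Λ] (he : IsIdempotentElem e) :
    Module.Finite k he.Corner :=
  Module.Finite.of_injective
    ({ toFun := fun x => x.1, map_add' := fun _ _ => rfl, map_smul' := fun _ _ => rfl } :
      he.Corner →ₗ[k] Λ) Subtype.val_injective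

end Corner

/-- The corner algebra `e_J Λ e_J`, where `e_J = ∑ j ∈ J, e j`. -/
abbrev CornerAlgebra {Λ : Type v} [Ring Λ] {n : ℕ} {e : Fin n → Λ}
    (he : OrthogonalIdempotents e) (J : Finset (Fin n)) : Type v :=
  (he.isIdempotentElem_sum (s := J)).Corner

/-! ### Finite direct sums -/

section Sums

variable {R : Type*} [Ring R] {m l : ℕ}

/-- The projection of a direct sum to a part of the summands. -/
def piRes (A : Fin m → Type*) [∀ i, AddCommGroup (A i)] [∀ i, Module R (A i)]
    (σ : Fin l → Fin m) : (∀ i, A i) →ₗ[R] (∀ i, A (σ i)) :=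
  LinearMap.pi fun i => LinearMap.proj (σ i)

/-- The inclusion of a part of the summands into a direct sum. -/
def piExt (A : Fin m → Type*) [∀ i, AddCommGroup (A i)] [∀ i, Module R (A i)]
    (σ : Fin l → Fin m) : (∀ i, A (σ i)) →ₗ[R] (∀ i, A i) :=
  ∑ i, LinearMap.single R A (σ i) ∘ₗ LinearMap.proj i

lemma piRes_piExt (A : Fin m → Type*) [∀ i, AddCommGroup (A i)] [∀ i, Module R (A i)]
    {σ : Fin l → Fin m} (hσ : Function.Injective σ) :
    piRes A σ ∘ₗ piExt A σ = (LinearMap.id : (∀ i, A (σ i)) →ₗ[R] _) := by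
  refine LinearMap.ext fun x => funext fun i => ?_
  simp only [piRes, piExt, LinearMap.comp_apply, LinearMap.pi_apply, LinearMap.proj_apply,
    LinearMap.sum_apply, Finset.sum_apply, LinearMap.single_apply, LinearMap.id_apply]
  rw [Finset.sum_eq_single i]
  · simp
  · intro j _ hj
    exact Pi.single_eq_of_ne (fun h => hj (hσ h).symm) _
  · simp

lemma piExt_map {A B : Fin m → Type*} [∀ i, AddCommGroup (A i)] [∀ i, Module R (A i)]
    [∀ i, AddCommGroup (B i)] [∀ i, Module R (B i)] (d : ∀ i, A i →ₗ[R] B i)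
    (σ : Fin l → Fin m) (x : ∀ i, A (σ i)) (j : Fin m) :
    d j (piExt (R := R) A σ x j) = piExt (R := R) B σ (fun i => d (σ i) (x i)) j := by
  simp only [piExt, LinearMap.comp_apply, LinearMap.proj_apply, LinearMap.sum_apply,
    Finset.sum_apply, LinearMap.single_apply, map_sum]
  exact Finset.sum_congr rfl fun i _ =>
    (Pi.apply_single (fun j => d j) (fun j => map_zero (d j)) (σ i) (x i) j)

/-- For `G ⊆ F`, the inclusion in terms of the enumerations of `G` and `F`. -/
def subIndex {V : Type*} {F G : Finset V} (h : G ⊆ F) (i : Fin G.card) : Fin F.card :=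
  F.equivFin ⟨(G.equivFin.symm i).1, h (G.equivFin.symm i).2⟩

lemma equivFin_symm_subIndex {V : Type*} {F G : Finset V} (h : G ⊆ F) (i : Fin G.card) :
    (F.equivFin.symm (subIndex h i)).1 = (G.equivFin.symm i).1 := by
  simp [subIndex]

lemma subIndex_injective {V : Type*} {F G : Finset V} (h : G ⊆ F) :
    Function.Injective (subIndex h) := by
  intro i j hij
  have := congrArg (fun a => (F.equivFin.symm a).1) hij
  simp only [equivFin_symm_subIndex] at this
  exact G.equivFin.symm.injective (Subtype.ext this)

end Sums

/-! ### 2-term objects of `K^b(proj Λ)` -/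

section TwoTerm

variable (Λ : Type v) [Ring Λ]

/-- The property of being a finitely generated projective right `Λ`-module. -/
def isProj : ObjectProperty (ModuleCat.{v} Λᵐᵒᵖ) :=
  fun M => Module.Finite Λᵐᵒᵖ M ∧ Module.Projective Λᵐᵒᵖ M

/-- The category `proj Λ`. -/
abbrev ProjCat := (isProj Λ).FullSubcategory

instance : (isProj Λ).ContainsZero where
  exists_zero := ⟨ModuleCat.of Λᵐᵒᵖ PUnit.{v + 1}, ModuleCat.isZero_of_subsingleton _,
    inferInstanceAs (Module.Finite Λᵐᵒᵖ PUnit.{v + 1}),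
    inferInstanceAs (Module.Projective Λᵐᵒᵖ PUnit.{v + 1})⟩

instance (P : ProjCat Λ) : Module.Finite Λᵐᵒᵖ P.obj := P.property.1

instance (P : ProjCat Λ) : Module.Projective Λᵐᵒᵖ P.obj := P.property.2

/-- The homotopy category of complexes in `proj Λ`; it contains `K^b(proj Λ)` as a full
subcategory. -/
abbrev KProj := HomotopyCategory (ProjCat Λ) (ComplexShape.up ℤ)

/-- A 2-term object `P₁ ⟶ P₀`. -/
structure TwoTerm where
  P₁ : ProjCat Λ
  P₀ : ProjCat Λ
  d : P₁.obj →ₗ[Λᵐᵒᵖ] P₀.obj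

variable {Λ}

/-- The finite direct sum in `proj Λ`. -/
def ProjCat.sum {m : ℕ} (P : Fin m → ProjCat Λ) : ProjCat Λ where
  obj := ModuleCat.of Λᵐᵒᵖ (∀ i, (P i).obj)
  property := ⟨inferInstanceAs (Module.Finite Λᵐᵒᵖ (∀ i, (P i).obj)),
    Module.Projective.of_equiv (DFinsupp.linearEquivFunOnFintype (R := Λᵐᵒᵖ)
      (M := fun i => (P i).obj))⟩

namespace TwoTerm

lemma rel : (ComplexShape.up ℤ).Rel (-1) 0 := by simp

/-- The cochain complex `⋯ ⟶ 0 ⟶ P₁ ⟶ P₀ ⟶ 0 ⟶ ⋯` with `P₀` in degree `0` and `P₁` in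
(cohomological) degree `-1`. -/
abbrev complex (X : TwoTerm Λ) : HomologicalComplex (ProjCat Λ) (ComplexShape.up ℤ) :=
  HomologicalComplex.double
    (ObjectProperty.homMk (ModuleCat.ofHom X.d) : X.P₁ ⟶ X.P₀) rel

/-- The 2-term object in the homotopy category. -/
abbrev toK (X : TwoTerm Λ) : KProj Λ :=
  (HomotopyCategory.quotient (ProjCat Λ) (ComplexShape.up ℤ)).obj X.complex

/-- Isomorphism of 2-term objects, in the homotopy category. -/
def IsIsomorphic (X Y : TwoTerm Λ) : Prop := Nonempty (X.toK ≅ Y.toK)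

/-- `X` is rigid: `Hom(X, X[1]) = 0` in the homotopy category. -/
def IsRigid (X : TwoTerm Λ) : Prop := ∀ f : X.toK ⟶ X.toK⟦(1 : ℤ)⟧, f = 0

/-- The direct sum of finitely many 2-term objects. -/
def sum {m : ℕ} (X : Fin m → TwoTerm Λ) : TwoTerm Λ where
  P₁ := ProjCat.sum fun i => (X i).P₁
  P₀ := ProjCat.sum fun i => (X i).P₀
  d := LinearMap.pi fun i => (X i).d ∘ₗ LinearMap.proj i

/-- `X` is indecomposable as an object of the category of 2-term objects. -/
def IsIndecomposable (X : TwoTerm Λ) : Prop :=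
  ¬ IsZero X.toK ∧ ∀ Y Z : TwoTerm Λ, X.IsIsomorphic (sum ![Y, Z]) →
    IsZero Y.toK ∨ IsZero Z.toK

/-- The map of complexes given by a commutative square. -/
def complexMap {X Y : TwoTerm Λ} (a₁ : X.P₁.obj →ₗ[Λᵐᵒᵖ] Y.P₁.obj)
    (a₀ : X.P₀.obj →ₗ[Λᵐᵒᵖ] Y.P₀.obj) (h : Y.d ∘ₗ a₁ = a₀ ∘ₗ X.d) : X.complex ⟶ Y.complex :=
  HomologicalComplex.mkHomFromDouble rel (by simp)
    ((ObjectProperty.homMk (ModuleCat.ofHom a₁) : X.P₁ ⟶ Y.P₁) ≫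
      (HomologicalComplex.doubleXIso₀ _ rel).inv)
    ((ObjectProperty.homMk (ModuleCat.ofHom a₀) : X.P₀ ⟶ Y.P₀) ≫
      (HomologicalComplex.doubleXIso₁ _ rel (by simp)).inv)
    (by
      have h' : (ObjectProperty.homMk (ModuleCat.ofHom a₁) : X.P₁ ⟶ Y.P₁) ≫
          (ObjectProperty.homMk (ModuleCat.ofHom Y.d) : Y.P₁ ⟶ Y.P₀) =
          (ObjectProperty.homMk (ModuleCat.ofHom X.d) : X.P₁ ⟶ X.P₀) ≫
          (ObjectProperty.homMk (ModuleCat.ofHom a₀) : X.P₀ ⟶ Y.P₀) := by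
        ext x
        exact LinearMap.congr_fun h x
      simp only [HomologicalComplex.double_d _ rel (show (-1 : ℤ) ≠ 0 by simp),
        Category.assoc, Iso.inv_hom_id_assoc]
      rw [← Category.assoc, h', Category.assoc])
    (fun j _ => by
      rw [HomologicalComplex.double_d_eq_zero₀ _ _ _ _ (by simp), comp_zero])

lemma complexMap_comp {X Y : TwoTerm Λ} {a₁ : X.P₁.obj →ₗ[Λᵐᵒᵖ] Y.P₁.obj}
    {a₀ : X.P₀.obj →ₗ[Λᵐᵒᵖ] Y.P₀.obj} (h : Y.d ∘ₗ a₁ = a₀ ∘ₗ X.d)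
    {b₁ : Y.P₁.obj →ₗ[Λᵐᵒᵖ] X.P₁.obj} {b₀ : Y.P₀.obj →ₗ[Λᵐᵒᵖ] X.P₀.obj}
    (h' : X.d ∘ₗ b₁ = b₀ ∘ₗ Y.d) (h₁ : b₁ ∘ₗ a₁ = LinearMap.id)
    (h₀ : b₀ ∘ₗ a₀ = LinearMap.id) :
    complexMap a₁ a₀ h ≫ complexMap b₁ b₀ h' = 𝟙 _ := by
  have e₁ : (ObjectProperty.homMk (ModuleCat.ofHom a₁) : X.P₁ ⟶ Y.P₁) ≫
      (ObjectProperty.homMk (ModuleCat.ofHom b₁) : Y.P₁ ⟶ X.P₁) = 𝟙 _ := by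
    ext x
    exact LinearMap.congr_fun h₁ x
  have e₀ : (ObjectProperty.homMk (ModuleCat.ofHom a₀) : X.P₀ ⟶ Y.P₀) ≫
      (ObjectProperty.homMk (ModuleCat.ofHom b₀) : Y.P₀ ⟶ X.P₀) = 𝟙 _ := by
    ext x
    exact LinearMap.congr_fun h₀ x
  apply HomologicalComplex.from_double_hom_ext
  · simp [complexMap, reassoc_of% e₁]
  · simp [complexMap, reassoc_of% e₀]

lemma IsRigid.of_retract {X Y : TwoTerm Λ} (hY : Y.IsRigid)
    (a₁ : X.P₁.obj →ₗ[Λᵐᵒᵖ] Y.P₁.obj) (a₀ : X.P₀.obj →ₗ[Λᵐᵒᵖ] Y.P₀.obj)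
    (h : Y.d ∘ₗ a₁ = a₀ ∘ₗ X.d)
    (b₁ : Y.P₁.obj →ₗ[Λᵐᵒᵖ] X.P₁.obj) (b₀ : Y.P₀.obj →ₗ[Λᵐᵒᵖ] X.P₀.obj)
    (h' : X.d ∘ₗ b₁ = b₀ ∘ₗ Y.d) (h₁ : b₁ ∘ₗ a₁ = LinearMap.id)
    (h₀ : b₀ ∘ₗ a₀ = LinearMap.id) : X.IsRigid := by
  intro f
  let i : X.toK ⟶ Y.toK := (HomotopyCategory.quotient _ _).map (complexMap a₁ a₀ h)
  let r : Y.toK ⟶ X.toK := (HomotopyCategory.quotient _ _).map (complexMap b₁ b₀ h')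
  have hir : i ≫ r = 𝟙 _ := by
    simp only [i, r]
    rw [← Functor.map_comp, complexMap_comp h h' h₁ h₀, CategoryTheory.Functor.map_id]
  have key := hY (r ≫ f ≫ i⟦(1 : ℤ)⟧')
  calc f = (i ≫ r) ≫ f ≫ (i ≫ r)⟦(1 : ℤ)⟧' := by simp [hir]
    _ = i ≫ (r ≫ f ≫ i⟦(1 : ℤ)⟧') ≫ r⟦(1 : ℤ)⟧' := by simp
    _ = 0 := by rw [key]; simp

lemma IsRigid.sum_comp {m l : ℕ} (X : Fin m → TwoTerm Λ) (hX : (sum X).IsRigid)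
    (σ : Fin l → Fin m) (hσ : Function.Injective σ) : (sum fun i => X (σ i)).IsRigid := by
  refine hX.of_retract (piExt (fun i => (X i).P₁.obj) σ) (piExt (fun i => (X i).P₀.obj) σ) ?_
    (piRes (fun i => (X i).P₁.obj) σ) (piRes (fun i => (X i).P₀.obj) σ) rfl
    (piRes_piExt (fun i => (X i).P₁.obj) hσ) (piRes_piExt (fun i => (X i).P₀.obj) hσ)
  refine LinearMap.ext fun x => funext fun j => ?_
  exact (piExt_map (fun i => (X i).d) σ x j)

end TwoTerm

variable (Λ) in
/-- Isomorphism of indecomposable rigid 2-term objects. -/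
def rigidSetoid : Setoid {X : TwoTerm Λ // X.IsIndecomposable ∧ X.IsRigid} where
  r X Y := X.1.IsIsomorphic Y.1
  iseqv := ⟨fun _ => ⟨Iso.refl _⟩, fun ⟨f⟩ => ⟨f.symm⟩, fun ⟨f⟩ ⟨g⟩ => ⟨f ≪≫ g⟩⟩

variable (Λ) in
/-- The isomorphism classes of indecomposable rigid 2-term objects. -/
def SiltingVertex := Quotient (rigidSetoid Λ)

/-- A representative of an isomorphism class. -/
def SiltingVertex.rep (x : SiltingVertex Λ) : TwoTerm Λ :=
  (Quotient.out (s := rigidSetoid Λ) x).1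

variable (Λ) in
/-- The 2-term silting complex of `Λ`: its vertices are the isomorphism classes of indecomposable
rigid 2-term objects and its faces are the sets of such objects whose direct sum is rigid. -/
def siltingComplex : AbstractSimplicialComplex (SiltingVertex Λ) where
  faces := {F | F.Nonempty ∧
    (TwoTerm.sum fun i : Fin F.card => (F.equivFin.symm i).1.rep).IsRigid}
  isRelLowerSet_faces := by
    rintro F ⟨hF, hr⟩
    refine ⟨hF, fun G hGF hG => ⟨hG, ?_⟩⟩
    have := TwoTerm.IsRigid.sum_comp _ hr (subIndex hGF) (subIndex_injective hGF)
    simpa only [equivFin_symm_subIndex] using this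
  singleton_mem x := by
    refine ⟨Finset.singleton_nonempty x, ?_⟩
    have h := (Quotient.out (s := rigidSetoid Λ) x).2.2
    have hx : ∀ i, (({x} : Finset (SiltingVertex Λ)).equivFin.symm i).1 = x := fun i =>
      Finset.mem_singleton.1 (({x} : Finset (SiltingVertex Λ)).equivFin.symm i).2
    simp only [hx]
    let i₀ : Fin (Finset.card {x}) := ⟨0, by simp⟩
    have hi : ∀ i : Fin (Finset.card {x}), i = i₀ := fun i => by
      have := i.2
      simp only [Finset.card_singleton] at this
      exact Fin.ext (by simp [i₀]; omega)
    refine TwoTerm.IsRigid.of_retract (Y := x.rep) h (LinearMap.proj i₀) (LinearMap.proj i₀) rfl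
      (LinearMap.pi fun _ => LinearMap.id) (LinearMap.pi fun _ => LinearMap.id) rfl ?_ ?_
    · exact LinearMap.ext fun y => funext fun i => by rw [hi i]; rfl
    · exact LinearMap.ext fun y => funext fun i => by rw [hi i]; rfl

end TwoTerm

/-! ### `τ`-rigid pairs -/

section Tau

variable {Λ : Type v} [Ring Λ]

/-- `N` is a superfluous submodule. -/
def IsSuperfluous {R M : Type*} [Ring R] [AddCommGroup M] [Module R M] (N : Submodule R M) :
    Prop :=
  ∀ L : Submodule R M, N ⊔ L = ⊤ → L = ⊤

/-- `P₁ ⟶ P₀ ⟶ M ⟶ 0` is a minimal projective presentation of `M`: it is exact, and both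
`P₀ ⟶ M` and `P₁ ⟶ ker π` are projective covers. -/
structure IsMinimalPresentation (X : TwoTerm Λ) {M : Type*} [AddCommGroup M] [Module Λᵐᵒᵖ M]
    (π : X.P₀.obj →ₗ[Λᵐᵒᵖ] M) : Prop where
  surjective : Function.Surjective π
  exact : LinearMap.range X.d = LinearMap.ker π
  superfluous₀ : IsSuperfluous (LinearMap.ker π)
  superfluous₁ : IsSuperfluous (LinearMap.ker X.d)

/-- The map of left `Λ`-modules `Hom(P₀, Λ) ⟶ Hom(P₁, Λ)` induced by `P₁ ⟶ P₀`. -/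
def TwoTerm.dStar (X : TwoTerm Λ) :
    (X.P₀.obj →ₗ[Λᵐᵒᵖ] Λ) →ₗ[Λ] (X.P₁.obj →ₗ[Λᵐᵒᵖ] Λ) where
  toFun g := g ∘ₗ X.d
  map_add' _ _ := rfl
  map_smul' _ _ := rfl

/-- The left `Λ`-module `coker (Hom(P₀, Λ) ⟶ Hom(P₁, Λ))`. If `P₁ ⟶ P₀` is a minimal
projective presentation of `M` then this is the transpose of `M`. -/
abbrev TwoTerm.Tr (X : TwoTerm Λ) := (X.P₁.obj →ₗ[Λᵐᵒᵖ] Λ) ⧸ LinearMap.range X.dStar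

variable (k : Type u) [Field k] [Algebra k Λ]

/-- The `k`-dual of the transpose. If `P₁ ⟶ P₀` is a minimal projective presentation of `M` then
this is the Auslander–Reiten translate of `M`. -/
def TwoTerm.Tau (X : TwoTerm Λ) := X.Tr →ₗ[k] k

instance (X : TwoTerm Λ) : AddCommGroup (X.Tau k) :=
  inferInstanceAs (AddCommGroup (X.Tr →ₗ[k] k))

/-- The right `Λ`-module structure `(φ a)(x) = φ (a x)` on the `k`-dual of a left module. -/
instance (X : TwoTerm Λ) : Module Λᵐᵒᵖ (X.Tau k) where
  smul a φ := (show X.Tr →ₗ[k] k from φ) ∘ₗ Algebra.lsmul k k X.Tr a.unop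
  one_smul φ := LinearMap.ext fun x => congrArg (show X.Tr →ₗ[k] k from φ) (one_smul Λ x)
  mul_smul a b φ := LinearMap.ext fun x =>
    congrArg (show X.Tr →ₗ[k] k from φ) (mul_smul b.unop a.unop x)
  smul_zero _ := rfl
  smul_add _ _ _ := rfl
  add_smul a b φ := LinearMap.ext fun x =>
    (congrArg (show X.Tr →ₗ[k] k from φ) (add_smul a.unop b.unop x)).trans (map_add _ _ _)
  zero_smul φ := LinearMap.ext fun x =>
    (congrArg (show X.Tr →ₗ[k] k from φ) (zero_smul Λ x)).trans (map_zero _)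

/-- `M` is `τ`-rigid: `Hom(M, τ M) = 0`. -/
def IsTauRigid (M : Type v) [AddCommGroup M] [Module Λᵐᵒᵖ M] : Prop :=
  ∃ (X : TwoTerm Λ) (π : X.P₀.obj →ₗ[Λᵐᵒᵖ] M), IsMinimalPresentation X π ∧
    ∀ f : M →ₗ[Λᵐᵒᵖ] X.Tau k, f = 0

lemma isArtinianRing_op [Module.Finite k Λ] : IsArtinianRing Λᵐᵒᵖ :=
  have : Module.Finite k Λᵐᵒᵖ := Module.Finite.equiv (MulOpposite.opLinearEquiv k : Λ ≃ₗ[k] Λᵐᵒᵖ)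
  IsArtinianRing.of_finite k Λᵐᵒᵖ

lemma exists_cover [IsArtinianRing Λᵐᵒᵖ] {M : Type v} [AddCommGroup M] [Module Λᵐᵒᵖ M]
    [Module.Finite Λᵐᵒᵖ M] :
    ∃ (Q : ProjCat Λ) (ρ : Q.obj →ₗ[Λᵐᵒᵖ] M), Function.Surjective ρ ∧
      IsSuperfluous (LinearMap.ker ρ) := by
  obtain ⟨n, π, hπ⟩ := Module.Finite.exists_fin' Λᵐᵒᵖ M
  obtain ⟨L, hL⟩ := (wellFounded_lt (α := Submodule Λᵐᵒᵖ (Fin n → Λᵐᵒᵖ))).has_min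
    {L | L.map π = ⊤} ⟨⊤, show Submodule.map π ⊤ = ⊤ by
      rw [Submodule.map_top, LinearMap.range_eq_top.2 hπ]⟩
  obtain ⟨hL1, hL2⟩ := hL
  have hmin : ∀ N : Submodule Λᵐᵒᵖ (Fin n → Λᵐᵒᵖ), N ≤ L → N.map π = ⊤ → N = L :=
    fun N hN hN' => by
      by_contra hne
      exact hL2 N hN' (lt_of_le_of_ne hN hne)
  have hs : Function.Surjective (π ∘ₗ L.subtype) := by
    rw [← LinearMap.range_eq_top, LinearMap.range_comp, Submodule.range_subtype, hL1]
  have hsub : ∀ K : Submodule Λᵐᵒᵖ L, K.map (π ∘ₗ L.subtype) = ⊤ → K = ⊤ := by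
    intro K hK
    rw [Submodule.map_comp] at hK
    have h := hmin _ (Submodule.map_subtype_le L K) hK
    apply Submodule.map_injective_of_injective L.injective_subtype
    rw [h, Submodule.map_top, Submodule.range_subtype]
  obtain ⟨g, hg⟩ := Module.projective_lifting_property (π ∘ₗ L.subtype) π hs
  have hgs : Function.Surjective (g ∘ₗ L.subtype) := by
    rw [← LinearMap.range_eq_top]
    apply hsub
    rw [← LinearMap.range_comp, ← LinearMap.comp_assoc, hg, LinearMap.range_eq_top]
    exact hs
  have hb : Function.Bijective (g ∘ₗ L.subtype) :=
    ⟨IsNoetherian.injective_of_surjective_endomorphism _ hgs, hgs⟩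
  let E := LinearEquiv.ofBijective _ hb
  have hproj : Module.Projective Λᵐᵒᵖ L := by
    refine Module.Projective.of_split L.subtype (E.symm.toLinearMap ∘ₗ g) ?_
    exact LinearMap.ext fun x => E.symm_apply_apply x
  refine ⟨⟨ModuleCat.of Λᵐᵒᵖ L, inferInstanceAs (Module.Finite Λᵐᵒᵖ L), hproj⟩,
    π ∘ₗ L.subtype, hs, fun K hK => hsub K ?_⟩
  have := congrArg (Submodule.map (π ∘ₗ L.subtype)) hK
  rw [Submodule.map_sup, Submodule.map_top, LinearMap.range_eq_top.2 hs] at this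
  rw [← this, eq_comm]
  refine sup_eq_right.2 ?_
  rintro _ ⟨x, hx, rfl⟩
  rw [SetLike.mem_coe, LinearMap.mem_ker] at hx
  rw [hx]
  exact zero_mem _

/-- Finitely generated modules have minimal projective presentations. -/
lemma exists_isMinimalPresentation [IsArtinianRing Λᵐᵒᵖ] (M : Type v) [AddCommGroup M]
    [Module Λᵐᵒᵖ M] [Module.Finite Λᵐᵒᵖ M] :
    ∃ (X : TwoTerm Λ) (π : X.P₀.obj →ₗ[Λᵐᵒᵖ] M), IsMinimalPresentation X π := by
  obtain ⟨Q, ρ, hρ, hρ'⟩ := exists_cover (Λ := Λ) (M := M)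
  obtain ⟨Q', ρ', hs, hs'⟩ := exists_cover (Λ := Λ) (M := LinearMap.ker ρ)
  refine ⟨⟨Q', Q, (LinearMap.ker ρ).subtype ∘ₗ ρ'⟩, ρ, hρ, ?_, hρ', ?_⟩
  · rw [LinearMap.range_comp, LinearMap.range_eq_top.2 hs, Submodule.map_top,
      Submodule.range_subtype]
  · rwa [LinearMap.ker_comp, Submodule.ker_subtype, Submodule.comap_bot]

lemma IsMinimalPresentation.exists_lift {M N : Type v} [AddCommGroup M] [Module Λᵐᵒᵖ M]
    [AddCommGroup N] [Module Λᵐᵒᵖ N] {X Y : TwoTerm Λ} {π : X.P₀.obj →ₗ[Λᵐᵒᵖ] M}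
    {ρ : Y.P₀.obj →ₗ[Λᵐᵒᵖ] N} (hX : IsMinimalPresentation X π) (hY : IsMinimalPresentation Y ρ)
    (f : M →ₗ[Λᵐᵒᵖ] N) :
    ∃ (a₀ : X.P₀.obj →ₗ[Λᵐᵒᵖ] Y.P₀.obj) (a₁ : X.P₁.obj →ₗ[Λᵐᵒᵖ] Y.P₁.obj),
      ρ ∘ₗ a₀ = f ∘ₗ π ∧ Y.d ∘ₗ a₁ = a₀ ∘ₗ X.d := by
  obtain ⟨a₀, h₀⟩ := Module.projective_lifting_property ρ (f ∘ₗ π) hY.surjective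
  have hr : ∀ x, a₀ (X.d x) ∈ LinearMap.range Y.d := fun x => by
    have hx : X.d x ∈ LinearMap.ker π := hX.exact ▸ LinearMap.mem_range_self _ _
    rw [hY.exact, LinearMap.mem_ker, ← LinearMap.comp_apply, h₀, LinearMap.comp_apply,
      LinearMap.mem_ker.1 hx, map_zero]
  obtain ⟨a₁, h₁⟩ := Module.projective_lifting_property Y.d.rangeRestrict
    ((a₀ ∘ₗ X.d).codRestrict _ hr) Y.d.surjective_rangeRestrict
  exact ⟨a₀, a₁, h₀, LinearMap.ext fun x => congrArg Subtype.val (LinearMap.congr_fun h₁ x)⟩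

/-- An endomorphism of a minimal presentation over the identity is bijective in degree `1`. -/
lemma IsMinimalPresentation.bijective [IsArtinianRing Λᵐᵒᵖ] {M : Type v} [AddCommGroup M]
    [Module Λᵐᵒᵖ M] {X : TwoTerm Λ} {π : X.P₀.obj →ₗ[Λᵐᵒᵖ] M} (hX : IsMinimalPresentation X π)
    (c₀ : X.P₀.obj →ₗ[Λᵐᵒᵖ] X.P₀.obj) (c₁ : X.P₁.obj →ₗ[Λᵐᵒᵖ] X.P₁.obj)
    (h₀ : π ∘ₗ c₀ = π) (h₁ : X.d ∘ₗ c₁ = c₀ ∘ₗ X.d) : Function.Bijective c₁ := by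
  have h₀' : ∀ x, π (c₀ x) = π x := LinearMap.congr_fun h₀
  have h₁' : ∀ x, X.d (c₁ x) = c₀ (X.d x) := LinearMap.congr_fun h₁
  have hc₀ : Function.Surjective c₀ := by
    rw [← LinearMap.range_eq_top]
    apply hX.superfluous₀
    rw [eq_top_iff]
    intro x _
    have : x = (x - c₀ x) + c₀ x := by abel
    rw [this]
    exact Submodule.add_mem_sup (by simp [h₀']) (LinearMap.mem_range_self _ _)
  have hc₁ : Function.Surjective c₁ := by
    rw [← LinearMap.range_eq_top]
    apply hX.superfluous₁
    rw [eq_top_iff]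
    intro x _
    obtain ⟨y, hy⟩ := hc₀ (X.d x)
    have hy' : y ∈ LinearMap.range X.d := by
      rw [hX.exact, LinearMap.mem_ker, ← h₀', hy, ← LinearMap.mem_ker, ← hX.exact]
      exact LinearMap.mem_range_self _ _
    obtain ⟨z, rfl⟩ := hy'
    have : x = (x - c₁ z) + c₁ z := by abel
    rw [this]
    exact Submodule.add_mem_sup (by simp [h₁', hy]) (LinearMap.mem_range_self _ _)
  exact ⟨IsNoetherian.injective_of_surjective_endomorphism _ hc₁, hc₁⟩

/-- The map of transposes induced by a commutative square. -/
def TwoTerm.trMap {X Y : TwoTerm Λ} (a₁ : X.P₁.obj →ₗ[Λᵐᵒᵖ] Y.P₁.obj)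
    (a₀ : X.P₀.obj →ₗ[Λᵐᵒᵖ] Y.P₀.obj) (h : Y.d ∘ₗ a₁ = a₀ ∘ₗ X.d) : Y.Tr →ₗ[Λ] X.Tr :=
  Submodule.mapQ _ _
    ({ toFun := fun g => g ∘ₗ a₁, map_add' := fun _ _ => rfl, map_smul' := fun _ _ => rfl } :
      (Y.P₁.obj →ₗ[Λᵐᵒᵖ] Λ) →ₗ[Λ] (X.P₁.obj →ₗ[Λᵐᵒᵖ] Λ))
    (by
      rintro _ ⟨g, rfl⟩
      refine ⟨g ∘ₗ a₀, ?_⟩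
      simp only [TwoTerm.dStar, LinearMap.coe_mk, AddHom.coe_mk, LinearMap.comp_assoc, h])

/-- The map of translates induced by a commutative square. -/
def TwoTerm.tauMap {X Y : TwoTerm Λ} (a₁ : X.P₁.obj →ₗ[Λᵐᵒᵖ] Y.P₁.obj)
    (a₀ : X.P₀.obj →ₗ[Λᵐᵒᵖ] Y.P₀.obj) (h : Y.d ∘ₗ a₁ = a₀ ∘ₗ X.d) :
    X.Tau k →ₗ[Λᵐᵒᵖ] Y.Tau k where
  toFun φ := (show X.Tr →ₗ[k] k from φ) ∘ₗ (TwoTerm.trMap a₁ a₀ h).restrictScalars k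
  map_add' _ _ := rfl
  map_smul' a φ := LinearMap.ext fun x => congrArg (show X.Tr →ₗ[k] k from φ)
    ((TwoTerm.trMap a₁ a₀ h).map_smul a.unop x).symm

/-- A direct summand of a `τ`-rigid module is `τ`-rigid. -/
lemma IsTauRigid.of_retract [Module.Finite k Λ] {M N : Type v} [AddCommGroup M]
    [Module Λᵐᵒᵖ M] [Module.Finite Λᵐᵒᵖ M] [AddCommGroup N] [Module Λᵐᵒᵖ N]
    (hN : IsTauRigid (Λ := Λ) k N) (i : M →ₗ[Λᵐᵒᵖ] N) (r : N →ₗ[Λᵐᵒᵖ] M)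
    (hir : r ∘ₗ i = LinearMap.id) : IsTauRigid (Λ := Λ) k M := by
  have := isArtinianRing_op (Λ := Λ) k
  obtain ⟨Y, ρ, hY, hτ⟩ := hN
  obtain ⟨X, π, hX⟩ := exists_isMinimalPresentation (Λ := Λ) M
  refine ⟨X, π, hX, fun f => ?_⟩
  obtain ⟨a₀, a₁, ha₀, ha₁⟩ := hX.exists_lift hY i
  obtain ⟨b₀, b₁, hb₀, hb₁⟩ := hY.exists_lift hX r
  have hbij : Function.Bijective (b₁ ∘ₗ a₁) := by
    refine hX.bijective (b₀ ∘ₗ a₀) (b₁ ∘ₗ a₁) ?_ ?_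
    · rw [← LinearMap.comp_assoc, hb₀, LinearMap.comp_assoc, ha₀, ← LinearMap.comp_assoc, hir,
        LinearMap.id_comp]
    · rw [← LinearMap.comp_assoc, hb₁, LinearMap.comp_assoc, ha₁, LinearMap.comp_assoc]
  let E := LinearEquiv.ofBijective _ hbij
  have hsurj : Function.Surjective (TwoTerm.trMap a₁ a₀ ha₁) := by
    intro x
    obtain ⟨g, rfl⟩ := Submodule.Quotient.mk_surjective _ x
    refine ⟨Submodule.Quotient.mk (g ∘ₗ E.symm.toLinearMap ∘ₗ b₁), ?_⟩
    refine congrArg Submodule.Quotient.mk ?_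
    exact LinearMap.ext fun y => congrArg g (E.symm_apply_apply y)
  have h0 := hτ (TwoTerm.tauMap k a₁ a₀ ha₁ ∘ₗ f ∘ₗ r)
  refine LinearMap.ext fun m => LinearMap.ext fun x => ?_
  obtain ⟨y, rfl⟩ := hsurj x
  have h1 : TwoTerm.tauMap k a₁ a₀ ha₁ (f (r (i m))) = 0 := LinearMap.congr_fun h0 (i m)
  have h2 : r (i m) = m := LinearMap.congr_fun hir m
  rw [h2] at h1
  exact LinearMap.congr_fun (f := (TwoTerm.tauMap k a₁ a₀ ha₁ (f m) : Y.Tr →ₗ[k] k)) h1 y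

variable (Λ) in
/-- A pair of a finite-dimensional right module `M` and a finite-dimensional projective right
module `P` (over a finite-dimensional algebra, finite-dimensional means finitely generated). -/
structure TauPair where
  M : ModuleCat.{v} Λᵐᵒᵖ
  finite : Module.Finite Λᵐᵒᵖ M
  P : ProjCat Λ

namespace TauPair

instance (X : TauPair Λ) : Module.Finite Λᵐᵒᵖ X.M := X.finite

/-- `(M, P)` is a `τ`-rigid pair: `M` is `τ`-rigid and `Hom(P, M) = 0`. -/
def IsRigid (X : TauPair Λ) : Prop :=
  IsTauRigid (Λ := Λ) k X.M ∧ ∀ f : X.P.obj →ₗ[Λᵐᵒᵖ] X.M, f = 0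

/-- Isomorphism of pairs. -/
def IsIsomorphic (X Y : TauPair Λ) : Prop :=
  Nonempty (X.M ≃ₗ[Λᵐᵒᵖ] Y.M) ∧ Nonempty (X.P.obj ≃ₗ[Λᵐᵒᵖ] Y.P.obj)

/-- The componentwise direct sum of finitely many pairs. -/
def sum {m : ℕ} (X : Fin m → TauPair Λ) : TauPair Λ where
  M := ModuleCat.of Λᵐᵒᵖ (∀ i, (X i).M)
  finite := inferInstanceAs (Module.Finite Λᵐᵒᵖ (∀ i, (X i).M))
  P := ProjCat.sum fun i => (X i).P

/-- The pair `(0, 0)`. -/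
def IsZero (X : TauPair Λ) : Prop := Subsingleton X.M ∧ Subsingleton X.P.obj

/-- The pair is nonzero and not a direct sum of two nonzero pairs. -/
def IsIndecomposable (X : TauPair Λ) : Prop :=
  ¬ X.IsZero ∧ ∀ Y Z : TauPair Λ, X.IsIsomorphic (sum ![Y, Z]) → Y.IsZero ∨ Z.IsZero

variable {k}

lemma IsRigid.of_retract [Module.Finite k Λ] {X Y : TauPair Λ} (hY : Y.IsRigid k)
    (i : X.M →ₗ[Λᵐᵒᵖ] Y.M) (r : Y.M →ₗ[Λᵐᵒᵖ] X.M) (hir : r ∘ₗ i = LinearMap.id)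
    (i' : X.P.obj →ₗ[Λᵐᵒᵖ] Y.P.obj) (r' : Y.P.obj →ₗ[Λᵐᵒᵖ] X.P.obj)
    (hir' : r' ∘ₗ i' = LinearMap.id) : X.IsRigid k := by
  refine ⟨hY.1.of_retract k i r hir, fun f => ?_⟩
  have h := hY.2 (i ∘ₗ f ∘ₗ r')
  calc f = (r ∘ₗ i) ∘ₗ f ∘ₗ (r' ∘ₗ i') := by rw [hir, hir']; rfl
    _ = r ∘ₗ (i ∘ₗ f ∘ₗ r') ∘ₗ i' := rfl
    _ = 0 := by rw [h, LinearMap.zero_comp, LinearMap.comp_zero]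

lemma IsRigid.sum_comp [Module.Finite k Λ] {m l : ℕ} (X : Fin m → TauPair Λ)
    (hX : (sum X).IsRigid k) (σ : Fin l → Fin m) (hσ : Function.Injective σ) :
    (sum fun i => X (σ i)).IsRigid k :=
  hX.of_retract (piExt (fun i => (X i).M) σ) (piRes (fun i => (X i).M) σ)
    (piRes_piExt (fun i => (X i).M) hσ) (piExt (fun i => (X i).P.obj) σ)
    (piRes (fun i => (X i).P.obj) σ) (piRes_piExt (fun i => (X i).P.obj) hσ)

end TauPair

variable (Λ) in
/-- Isomorphism of indecomposable `τ`-rigid pairs. -/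
def tauSetoid : Setoid {X : TauPair Λ // X.IsIndecomposable ∧ X.IsRigid k} where
  r X Y := X.1.IsIsomorphic Y.1
  iseqv := ⟨fun _ => ⟨⟨LinearEquiv.refl _ _⟩, ⟨LinearEquiv.refl _ _⟩⟩,
    fun ⟨⟨f⟩, ⟨g⟩⟩ => ⟨⟨f.symm⟩, ⟨g.symm⟩⟩,
    fun ⟨⟨f⟩, ⟨g⟩⟩ ⟨⟨f'⟩, ⟨g'⟩⟩ => ⟨⟨f.trans f'⟩, ⟨g.trans g'⟩⟩⟩

variable (Λ) in
/-- The isomorphism classes of indecomposable `τ`-rigid pairs. -/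
def TauVertex := Quotient (tauSetoid Λ k)

variable {k} in
/-- A representative of an isomorphism class. -/
def TauVertex.rep (x : TauVertex Λ k) : TauPair Λ :=
  (Quotient.out (s := tauSetoid Λ k) x).1

variable (Λ) in
/-- The support `τ`-tilting complex of `Λ`: its vertices are the isomorphism classes of
indecomposable `τ`-rigid pairs and its faces are the sets of such pairs whose direct sum is a
`τ`-rigid pair. -/
def tauTiltingComplex [Module.Finite k Λ] : AbstractSimplicialComplex (TauVertex Λ k) where
  faces := {F | F.Nonempty ∧
    (TauPair.sum fun i : Fin F.card => (F.equivFin.symm i).1.rep).IsRigid k}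
  isRelLowerSet_faces := by
    rintro F ⟨hF, hr⟩
    refine ⟨hF, fun G hGF hG => ⟨hG, ?_⟩⟩
    have := TauPair.IsRigid.sum_comp _ hr (subIndex hGF) (subIndex_injective hGF)
    simpa only [equivFin_symm_subIndex] using this
  singleton_mem x := by
    refine ⟨Finset.singleton_nonempty x, ?_⟩
    have h := (Quotient.out (s := tauSetoid Λ k) x).2.2
    have hx : ∀ i, (({x} : Finset (TauVertex Λ k)).equivFin.symm i).1 = x := fun i =>
      Finset.mem_singleton.1 (({x} : Finset (TauVertex Λ k)).equivFin.symm i).2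
    simp only [hx]
    let i₀ : Fin (Finset.card {x}) := ⟨0, by simp⟩
    have hi : ∀ i : Fin (Finset.card {x}), i = i₀ := fun i => by
      have := i.2
      simp only [Finset.card_singleton] at this
      exact Fin.ext (by simp [i₀]; omega)
    refine TauPair.IsRigid.of_retract (Y := x.rep) h (LinearMap.proj i₀)
      (LinearMap.pi fun _ => LinearMap.id) ?_ (LinearMap.proj i₀)
      (LinearMap.pi fun _ => LinearMap.id) ?_
    · exact LinearMap.ext fun y => funext fun i => by rw [hi i]; rfl
    · exact LinearMap.ext fun y => funext fun i => by rw [hi i]; rfl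

end Tau

/-! ### `g`-vectors -/

section GVector

variable {Λ : Type v} [Ring Λ] {n : ℕ} (e : Fin n → Λ)

/-- `P` is isomorphic to the direct sum over `i` of `a i` copies of `e i Λ`. -/
def HasMultiplicities (P : ProjCat Λ) (a : Fin n → ℕ) : Prop :=
  Nonempty (P.obj ≃ₗ[Λᵐᵒᵖ] (∀ i, Fin (a i) → rightIdeal (e i)))

/-- `g` is the `g`-vector of the 2-term object `P₁ ⟶ P₀`: the class `[P₀] - [P₁]`, in the basis
of the classes of the `e i Λ`. -/
def TwoTerm.HasGVector (X : TwoTerm Λ) (g : Fin n → ℤ) : Prop :=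
  ∃ a b : Fin n → ℕ, HasMultiplicities e X.P₀ a ∧ HasMultiplicities e X.P₁ b ∧
    ∀ i, g i = (a i : ℤ) - (b i : ℤ)

/-- `g` is the `g`-vector of the pair `(M, P)`: the `g`-vector `[P₀] - [P₁] - [P]` of the
corresponding 2-term object `(P₁ ⟶ P₀) ⊕ (P ⟶ 0)`, where `P₁ ⟶ P₀` is a minimal projective
presentation of `M`. -/
def TauPair.HasGVector (X : TauPair Λ) (g : Fin n → ℤ) : Prop :=
  ∃ (Y : TwoTerm Λ) (π : Y.P₀.obj →ₗ[Λᵐᵒᵖ] X.M), IsMinimalPresentation Y π ∧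
    ∃ a b c : Fin n → ℕ, HasMultiplicities e Y.P₀ a ∧ HasMultiplicities e Y.P₁ b ∧
      HasMultiplicities e X.P c ∧ ∀ i, g i = (a i : ℤ) - (b i : ℤ) - (c i : ℤ)

variable (J : Finset (Fin n))

/-- The vertices of the support `τ`-tilting complex whose `g`-vectors vanish outside `J`. -/
def tauVerticesOn (k : Type u) [Field k] [Algebra k Λ] : Set (TauVertex Λ k) :=
  {x | ∃ g : Fin n → ℤ, x.rep.HasGVector e g ∧ ∀ i, i ∉ J → g i = 0}

/-- The vertices of the 2-term silting complex whose `g`-vectors vanish outside `J`. -/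
def siltingVerticesOn : Set (SiltingVertex Λ) :=
  {x | ∃ g : Fin n → ℤ, x.rep.HasGVector e g ∧ ∀ i, i ∉ J → g i = 0}

/-- The 2-term objects `P₁ ⟶ P₀` such that `P₁` and `P₀` are direct sums of copies of the
`e j Λ` with `j ∈ J`. -/
def TwoTerm.IsSupportedOn (X : TwoTerm Λ) : Prop :=
  (∃ a : Fin n → ℕ, HasMultiplicities e X.P₀ a ∧ ∀ i, i ∉ J → a i = 0) ∧
    ∃ b : Fin n → ℕ, HasMultiplicities e X.P₁ b ∧ ∀ i, i ∉ J → b i = 0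

/-- The vertices of the 2-term silting complex which are isomorphic to a 2-term object involving
only the `e j Λ` with `j ∈ J`. -/
def siltingVerticesSupportedOn : Set (SiltingVertex Λ) :=
  {x | ∃ Y : TwoTerm Λ, Y.IsSupportedOn e J ∧ x.rep.IsIsomorphic Y}

end GVector

end SiltingCorner

end

/-!
Morphisms between 2-term objects in `K^b(proj Λ)` are commutative squares modulo homotopy, so
`d : P₁ ⟶ P₀` is rigid when every linear map `P₁ ⟶ P₀` has the form `d ∘ h₁ + h₀ ∘ d`.
Consequently a direct sum is rigid if and only if its summands are pairwise compatible, and both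
simplicial complexes are flag complexes of such a relation.

A pair `(M, P)` corresponds to the 2-term object `(P₁^M ⟶ P₀^M) ⊕ (P ⟶ 0)`. Every map from `M` to
the translate of `N` vanishes if and only if every map `P₁^N ⟶ M` extends along `P₁^N ⟶ P₀^N`, so
the correspondence preserves rigidity and identifies the support `τ`-tilting complex with the
2-term silting complex.

For an idempotent `ε`, the functor `M ↦ M ε` is an equivalence from the projective modules in
`add (ε Λ)` to the projective modules over `ε Λ ε`. It identifies the 2-term silting complex of
`ε Λ ε` with the part of that of `Λ` formed by the objects with terms in `add (ε Λ)` up to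
homotopy. These are the objects for which `Hom(P₀, S) ⟶ Hom(P₁, S)` is bijective for every simple
`S` with `S ε = 0`. If `P₁ ⟶ P₀` is rigid, this map is always injective or surjective: a nonzero
`P₀ ⟶ S` that kills `P₁` lets one lift any `P₁ ⟶ S` to `P₁ ⟶ P₀` and apply rigidity. So it is
bijective as soon as the two dimensions agree, which for all such `S` together says that the
`g`-vector vanishes outside the support of `ε`.
-/

namespace SiltingCorner

/-! ### Simplicial complexes -/

section SimplicialComplex

variable {V W U : Type*} {K : AbstractSimplicialComplex V} {L : AbstractSimplicialComplex W}
  {N : AbstractSimplicialComplex U}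

theorem isomorphic_symm (h : K.Isomorphic L) : L.Isomorphic K := by
  obtain ⟨φ, hφ⟩ := h
  refine ⟨φ.symm, fun s => ?_⟩
  have hs : (s.map φ.symm.toEmbedding).map φ.toEmbedding = s :=
    φ.finsetCongr.apply_symm_apply s
  rw [hφ, hs]

theorem isomorphic_trans (h : K.Isomorphic L) (h' : L.Isomorphic N) : K.Isomorphic N := by
  obtain ⟨φ, hφ⟩ := h
  obtain ⟨ψ, hψ⟩ := h'
  refine ⟨φ.trans ψ, fun s => ?_⟩
  rw [hφ, hψ, Finset.map_map]
  rfl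

theorem isomorphic_induced (φ : V ≃ W)
    (hφ : ∀ s : Finset V, s ∈ K.faces ↔ s.map φ.toEmbedding ∈ L.faces)
    {S : Set V} {T : Set W} (hST : ∀ x, x ∈ S ↔ φ x ∈ T) :
    (K.induced S).Isomorphic (L.induced T) := by
  refine ⟨φ.subtypeEquiv hST, fun s => ?_⟩
  change s.map _ ∈ K.faces ↔ Finset.map _ (s.map _) ∈ L.faces
  rw [hφ, Finset.map_map, Finset.map_map]
  rfl

theorem maximal_face_iff_map (φ : V ≃ W)
    (hφ : ∀ s : Finset V, s ∈ K.faces ↔ s.map φ.toEmbedding ∈ L.faces) (F : Finset V) :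
    Maximal (· ∈ K.faces) F ↔ Maximal (· ∈ L.faces) (φ.finsetCongr F) := by
  simp only [Maximal, hφ, φ.finsetCongr.surjective.forall, Equiv.finsetCongr_apply,
    Finset.map_subset_map]

theorem nonempty_dualGraph_iso (h : K.Isomorphic L) :
    Nonempty (K.dualGraph ≃g L.dualGraph) := by
  classical
  obtain ⟨φ, hφ⟩ := h
  refine ⟨⟨φ.finsetCongr.subtypeEquiv (maximal_face_iff_map φ hφ), ?_⟩⟩
  rintro ⟨F, hF⟩ ⟨G, hG⟩
  change ((F.map φ.toEmbedding \ G.map φ.toEmbedding).card = 1 ∧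
    (G.map φ.toEmbedding \ F.map φ.toEmbedding).card = 1) ↔ _
  rw [← Finset.map_sdiff, ← Finset.map_sdiff, Finset.card_map, Finset.card_map]
  rfl

/-- `K` is the flag (clique) complex of the relation `c`: its faces are the nonempty finite sets
of pairwise compatible vertices. The relation is also required between a vertex and itself. -/
def IsFlagComplexOf (K : AbstractSimplicialComplex V) (c : V → V → Prop) : Prop :=
  ∀ F : Finset V, F ∈ K.faces ↔ F.Nonempty ∧ ∀ x ∈ F, ∀ y ∈ F, c x y

namespace IsFlagComplexOf

variable {c : V → V → Prop} {c' : W → W → Prop}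

theorem mem_faces_iff_map_mem_faces (hK : IsFlagComplexOf K c) (hL : IsFlagComplexOf L c')
    (φ : V ≃ W) (hφ : ∀ x y, c x y ↔ c' (φ x) (φ y)) (s : Finset V) :
    s ∈ K.faces ↔ s.map φ.toEmbedding ∈ L.faces := by
  rw [hK, hL, Finset.map_nonempty]
  simp only [Finset.forall_mem_map, hφ, Equiv.coe_toEmbedding]

theorem induced (hK : IsFlagComplexOf K c) (S : Set V) :
    IsFlagComplexOf (K.induced S) fun x y => c x.1 y.1 := by
  intro F
  change F.map _ ∈ K.faces ↔ _
  rw [hK, Finset.map_nonempty]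
  simp only [Finset.forall_mem_map, Function.Embedding.subtype_apply]

end IsFlagComplexOf

end SimplicialComplex

section HomotopyOfDouble

open HomologicalComplex

variable {C : Type*} [Category* C] [Preadditive C] [HasZeroObject C] {P₁ P₀ : C} {f : P₁ ⟶ P₀}
  {K : HomologicalComplex C (ComplexShape.up ℤ)}

/-- The null-homotopy of a map from the two-term complex `P₁ ⟶ P₀` (in degrees `-1` and `0`) given
by its two components `s` and `t`. -/
noncomputable def homotopyZeroOfDouble (φ : double f TwoTerm.rel ⟶ K) (s : P₀ ⟶ K.X (-1))
    (t : P₁ ⟶ K.X (-2))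
    (h₁ : (doubleXIso₀ f TwoTerm.rel).inv ≫ φ.f (-1) = f ≫ s + t ≫ K.d (-2) (-1))
    (h₀ : (doubleXIso₁ f TwoTerm.rel (by simp)).inv ≫ φ.f 0 = s ≫ K.d (-1) 0) :
    Homotopy φ 0 where
  hom i j :=
    if h : i = 0 ∧ j = -1 then
      eqToHom (by rw [h.1]) ≫ (doubleXIso₁ f TwoTerm.rel (by simp)).hom ≫ s ≫
        eqToHom (by rw [h.2])
    else if h : i = -1 ∧ j = -2 then
      eqToHom (by rw [h.1]) ≫ (doubleXIso₀ f TwoTerm.rel).hom ≫ t ≫ eqToHom (by rw [h.2])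
    else 0
  zero i j hij := by
    have hij' : j + 1 ≠ i := hij
    rw [dif_neg (by omega), dif_neg (by omega)]
  comm i := by
    rw [Iso.inv_comp_eq] at h₁ h₀
    by_cases hi₁ : i = -1
    · subst hi₁
      have rel₂ : (ComplexShape.up ℤ).Rel (-2) (-1) := by simp
      rw [dNext_eq _ TwoTerm.rel, prevD_eq _ rel₂, double_d _ _ (by simp), h₁]
      simp
    by_cases hi₀ : i = 0
    · subst hi₀
      have rel₁ : (ComplexShape.up ℤ).Rel 0 1 := by simp
      rw [dNext_eq _ rel₁, prevD_eq _ TwoTerm.rel, double_d_eq_zero₀ _ _ _ _ (by simp), h₀]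
      simp
    exact (isZero_double_X f TwoTerm.rel i hi₁ hi₀).eq_of_src _ _

theorem nonempty_homotopy_zero_double_iff (φ : double f TwoTerm.rel ⟶ K) :
    Nonempty (Homotopy φ 0) ↔ ∃ (s : P₀ ⟶ K.X (-1)) (t : P₁ ⟶ K.X (-2)),
      (doubleXIso₀ f TwoTerm.rel).inv ≫ φ.f (-1) = f ≫ s + t ≫ K.d (-2) (-1) ∧
      (doubleXIso₁ f TwoTerm.rel (by simp)).inv ≫ φ.f 0 = s ≫ K.d (-1) 0 := by
  refine ⟨fun ⟨h⟩ => ⟨(doubleXIso₁ f TwoTerm.rel (by simp)).inv ≫ h.hom 0 (-1),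
    (doubleXIso₀ f TwoTerm.rel).inv ≫ h.hom (-1) (-2), ?_, ?_⟩,
    fun ⟨s, t, h₁, h₀⟩ => ⟨homotopyZeroOfDouble φ s t h₁ h₀⟩⟩
  · have rel₂ : (ComplexShape.up ℤ).Rel (-2) (-1) := by simp
    rw [h.comm, dNext_eq _ TwoTerm.rel, prevD_eq _ rel₂, double_d _ _ (by simp)]
    simp
  · have rel₁ : (ComplexShape.up ℤ).Rel 0 1 := by simp
    rw [h.comm, dNext_eq _ rel₁, prevD_eq _ TwoTerm.rel, double_d_eq_zero₀ _ _ _ _ (by simp)]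
    simp

end HomotopyOfDouble

/-! ### The homotopy category of 2-term objects -/

namespace ProjCat

variable {Λ : Type v} [Ring Λ] {P Q R : ProjCat Λ}

/-- The morphism of `proj Λ` given by a linear map; an abbreviation, so that the simp lemmas about
`ObjectProperty.homMk` and `ModuleCat.ofHom` apply to it. -/
abbrev ofHom (f : P.obj →ₗ[Λᵐᵒᵖ] Q.obj) : P ⟶ Q :=
  ObjectProperty.homMk (ModuleCat.ofHom f)

theorem ofHom_surjective : Function.Surjective (ofHom (P := P) (Q := Q)) :=
  fun f => ⟨f.hom.hom, rfl⟩

theorem ofHom_injective : Function.Injective (ofHom (P := P) (Q := Q)) :=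
  fun _ _ h => congrArg (fun u : P ⟶ Q => u.hom.hom) h

theorem ofHom_id : ofHom (LinearMap.id : P.obj →ₗ[Λᵐᵒᵖ] P.obj) = 𝟙 P := rfl

theorem ofHom_comp (g : Q.obj →ₗ[Λᵐᵒᵖ] R.obj) (f : P.obj →ₗ[Λᵐᵒᵖ] Q.obj) :
    ofHom (g ∘ₗ f) = ofHom f ≫ ofHom g := rfl

theorem ofHom_add (f g : P.obj →ₗ[Λᵐᵒᵖ] Q.obj) : ofHom (f + g) = ofHom f + ofHom g := rfl

theorem ofHom_sub (f g : P.obj →ₗ[Λᵐᵒᵖ] Q.obj) : ofHom (f - g) = ofHom f - ofHom g := rfl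

end ProjCat

namespace TwoTerm

open HomologicalComplex ProjCat

variable {Λ : Type v} [Ring Λ] {X Y Z : TwoTerm Λ}

/-- A map of 2-term objects before passing to the homotopy category: a commutative square. -/
structure Map (X Y : TwoTerm Λ) where
  f₁ : X.P₁.obj →ₗ[Λᵐᵒᵖ] Y.P₁.obj
  f₀ : X.P₀.obj →ₗ[Λᵐᵒᵖ] Y.P₀.obj
  comm : Y.d ∘ₗ f₁ = f₀ ∘ₗ X.d

namespace Map

/-- The identity square. -/
@[simps]
def id (X : TwoTerm Λ) : Map X X := ⟨LinearMap.id, LinearMap.id, rfl⟩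

/-- The composition of squares, in the order of the composition of functions. -/
@[simps]
def comp (b : Map Y Z) (a : Map X Y) : Map X Z :=
  ⟨b.f₁ ∘ₗ a.f₁, b.f₀ ∘ₗ a.f₀, by
    rw [← LinearMap.comp_assoc, b.comm, LinearMap.comp_assoc, a.comm, LinearMap.comp_assoc]⟩

/-- The difference of two squares; it reduces the equality of two morphisms in the homotopy
category to the vanishing of one. -/
@[simps]
def sub (a b : Map X Y) : Map X Y :=
  ⟨a.f₁ - b.f₁, a.f₀ - b.f₀, by
    rw [LinearMap.comp_sub, a.comm, b.comm, LinearMap.sub_comp]⟩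

/-- The map of complexes given by a square. -/
noncomputable abbrev toComplex (a : Map X Y) : X.complex ⟶ Y.complex :=
  complexMap a.f₁ a.f₀ a.comm

/-- The morphism of the homotopy category given by a square. -/
noncomputable abbrev toK (a : Map X Y) : X.toK ⟶ Y.toK :=
  (HomotopyCategory.quotient _ _).map a.toComplex

/-- Homotopy of squares, in terms of linear maps. -/
def Homotopic (a b : Map X Y) : Prop :=
  ∃ h : X.P₀.obj →ₗ[Λᵐᵒᵖ] Y.P₁.obj, a.f₁ = b.f₁ + h ∘ₗ X.d ∧ a.f₀ = b.f₀ + Y.d ∘ₗ h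

theorem Homotopic.of_eq {a b : Map X Y} (h₁ : a.f₁ = b.f₁) (h₀ : a.f₀ = b.f₀) : a.Homotopic b :=
  ⟨0, by simp [h₁], by simp [h₀]⟩

theorem toComplex_f₁ (a : Map X Y) :
    a.toComplex.f (-1) =
      (doubleXIso₀ (ofHom X.d) rel).hom ≫ ofHom a.f₁ ≫ (doubleXIso₀ (ofHom Y.d) rel).inv := by
  simp [complexMap]

theorem toComplex_f₀ (a : Map X Y) :
    a.toComplex.f 0 =
      (doubleXIso₁ (ofHom X.d) rel (by simp)).hom ≫ ofHom a.f₀ ≫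
        (doubleXIso₁ (ofHom Y.d) rel (by simp)).inv := by
  simp [complexMap]

theorem toComplex_surjective : Function.Surjective (toComplex (X := X) (Y := Y)) := by
  intro f
  obtain ⟨f₁, h₁⟩ := ofHom_surjective
    ((doubleXIso₀ (ofHom X.d) rel).inv ≫ f.f (-1) ≫ (doubleXIso₀ (ofHom Y.d) rel).hom)
  obtain ⟨f₀, h₀⟩ := ofHom_surjective
    ((doubleXIso₁ (ofHom X.d) rel (by simp)).inv ≫ f.f 0 ≫
      (doubleXIso₁ (ofHom Y.d) rel (by simp)).hom)
  refine ⟨⟨f₁, f₀, ofHom_injective ?_⟩, ?_⟩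
  · have hcomm := f.comm (-1) 0
    rw [double_d _ _ (by simp), double_d _ _ (by simp)] at hcomm
    rw [ofHom_comp, ofHom_comp, h₁, h₀]
    simpa using congrArg (fun u => (doubleXIso₀ _ rel).inv ≫ u ≫
      (doubleXIso₁ _ rel (by simp)).hom) hcomm
  · apply from_double_hom_ext
    · rw [toComplex_f₁, h₁]; simp
    · rw [toComplex_f₀, h₀]; simp

theorem toK_surjective : Function.Surjective (toK (X := X) (Y := Y)) :=
  (Functor.map_surjective _).comp toComplex_surjective

theorem toComplex_id (X : TwoTerm Λ) : (id X).toComplex = 𝟙 _ := by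
  apply from_double_hom_ext
  · rw [toComplex_f₁, id_f₁, ofHom_id]; simp
  · rw [toComplex_f₀, id_f₀, ofHom_id]; simp

theorem toComplex_comp (b : Map Y Z) (a : Map X Y) :
    (b.comp a).toComplex = a.toComplex ≫ b.toComplex := by
  apply from_double_hom_ext
  · rw [comp_f, toComplex_f₁, toComplex_f₁, toComplex_f₁, comp_f₁, ofHom_comp]; simp
  · rw [comp_f, toComplex_f₀, toComplex_f₀, toComplex_f₀, comp_f₀, ofHom_comp]; simp

theorem toComplex_sub (a b : Map X Y) :
    (a.sub b).toComplex = a.toComplex - b.toComplex := by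
  apply from_double_hom_ext
  · rw [sub_f_apply, toComplex_f₁, toComplex_f₁, toComplex_f₁, sub_f₁, ofHom_sub]; simp
  · rw [sub_f_apply, toComplex_f₀, toComplex_f₀, toComplex_f₀, sub_f₀, ofHom_sub]; simp

theorem toK_id (X : TwoTerm Λ) : (id X).toK = 𝟙 _ := by
  rw [toK, toComplex_id, CategoryTheory.Functor.map_id]

theorem toK_comp (b : Map Y Z) (a : Map X Y) : (b.comp a).toK = a.toK ≫ b.toK := by
  rw [toK, toComplex_comp, Functor.map_comp]

theorem toK_eq_zero_iff {a : Map X Y} :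
    a.toK = 0 ↔ ∃ h : X.P₀.obj →ₗ[Λᵐᵒᵖ] Y.P₁.obj, a.f₁ = h ∘ₗ X.d ∧ a.f₀ = Y.d ∘ₗ h := by
  rw [HomotopyCategory.quotient_map_eq_zero_iff, nonempty_homotopy_zero_double_iff, toComplex_f₁,
    toComplex_f₀, double_d _ _ (by simp), double_d_eq_zero₀ _ _ _ _ (by simp)]
  simp only [Iso.inv_hom_id_assoc, comp_zero, add_zero, exists_const,
    ← ofHom_injective.eq_iff, ofHom_comp]
  constructor
  · rintro ⟨s, h₁, h₀⟩
    obtain ⟨h, hh⟩ := ofHom_surjective (s ≫ (doubleXIso₀ _ rel).hom)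
    refine ⟨h, ?_, ?_⟩
    · rw [hh, ← Category.assoc, ← h₁]; simp
    · simpa [hh] using congrArg (· ≫ (doubleXIso₁ _ rel (by simp)).hom) h₀
  · rintro ⟨h, h₁, h₀⟩
    exact ⟨ofHom h ≫ (doubleXIso₀ _ rel).inv, by simp [h₁], by simp [h₀]⟩

theorem toK_eq_iff {a b : Map X Y} : a.toK = b.toK ↔ a.Homotopic b := by
  rw [← sub_eq_zero, ← Functor.map_sub, ← toComplex_sub, toK_eq_zero_iff]
  simp only [sub_f₁, sub_f₀, sub_eq_iff_eq_add', Homotopic]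

end Map

theorem isIsomorphic_iff : X.IsIsomorphic Y ↔
    ∃ (a : Map X Y) (b : Map Y X), (b.comp a).Homotopic (Map.id X) ∧
      (a.comp b).Homotopic (Map.id Y) := by
  simp only [← Map.toK_eq_iff, Map.toK_comp, Map.toK_id]
  constructor
  · rintro ⟨i⟩
    obtain ⟨a, ha⟩ := Map.toK_surjective i.hom
    obtain ⟨b, hb⟩ := Map.toK_surjective i.inv
    exact ⟨a, b, by simp [ha, hb], by simp [ha, hb]⟩
  · rintro ⟨a, b, h₁, h₂⟩
    exact ⟨⟨a.toK, b.toK, h₁, h₂⟩⟩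

theorem isZero_toK_iff : IsZero X.toK ↔ Function.Bijective X.d := by
  rw [IsZero.iff_id_eq_zero, ← Map.toK_id, Map.toK_eq_zero_iff]
  constructor
  · rintro ⟨h, h₁, h₀⟩
    exact Function.bijective_iff_has_inverse.2
      ⟨h, fun x => (LinearMap.congr_fun h₁ x).symm, fun x => (LinearMap.congr_fun h₀ x).symm⟩
  · intro h
    let E := LinearEquiv.ofBijective _ h
    exact ⟨E.symm.toLinearMap, LinearMap.ext fun x => (E.symm_apply_apply x).symm,
      LinearMap.ext fun x => (E.apply_symm_apply x).symm⟩

/-- `Hom(X, Y[1]) = 0` in the homotopy category, in terms of linear maps: every `P₁ ⟶ P₀'` is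
null-homotopic. -/
def ExtVanishes (X Y : TwoTerm Λ) : Prop :=
  ∀ f : X.P₁.obj →ₗ[Λᵐᵒᵖ] Y.P₀.obj, ∃ (h₁ : X.P₁.obj →ₗ[Λᵐᵒᵖ] Y.P₁.obj)
    (h₀ : X.P₀.obj →ₗ[Λᵐᵒᵖ] Y.P₀.obj), f = Y.d ∘ₗ h₁ + h₀ ∘ₗ X.d

theorem forall_homotopy_zero_iff_extVanishes
    {K : HomologicalComplex (ProjCat Λ) (ComplexShape.up ℤ)} (e₀ : K.X (-1) ≅ Y.P₀)
    (e₁ : K.X (-2) ≅ Y.P₁) (hd : K.d (-2) (-1) = -(e₁.hom ≫ ofHom Y.d ≫ e₀.inv))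
    (hK : IsZero (K.X 0)) :
    (∀ g : X.complex ⟶ K, Nonempty (Homotopy g 0)) ↔ ExtVanishes X Y := by
  simp only [nonempty_homotopy_zero_double_iff, ExtVanishes, ← ofHom_injective.eq_iff, ofHom_add,
    ofHom_comp, hd]
  constructor
  · intro hnull f
    let g : X.complex ⟶ K := mkHomFromDouble rel (by simp)
      (ofHom f ≫ e₀.inv) 0 (hK.eq_of_tgt _ _) (by simp)
    obtain ⟨s, t, h, -⟩ := hnull g
    obtain ⟨h₀, hh₀⟩ := ofHom_surjective (s ≫ e₀.hom)
    obtain ⟨h₁, hh₁⟩ := ofHom_surjective (-(t ≫ e₁.hom))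
    refine ⟨h₁, h₀, ?_⟩
    have hf : ofHom f = ofHom X.d ≫ s ≫ e₀.hom - t ≫ e₁.hom ≫ ofHom Y.d := by
      simpa [g, ← sub_eq_add_neg] using congrArg (· ≫ e₀.hom) h
    rw [hh₁, hh₀, hf, Preadditive.neg_comp, Category.assoc, neg_add_eq_sub]
  · intro hext g
    obtain ⟨f, hf⟩ := ofHom_surjective ((doubleXIso₀ _ rel).inv ≫ g.f (-1) ≫ e₀.hom)
    obtain ⟨h₁, h₀, h⟩ := hext f
    refine ⟨ofHom h₀ ≫ e₀.inv, -ofHom h₁ ≫ e₁.inv, ?_, hK.eq_of_tgt _ _⟩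
    rw [← cancel_mono e₀.hom, Category.assoc, ← hf, h]
    simp [add_comm]

theorem forall_hom_shift_eq_zero_iff_forall_homotopy_zero {C : Type*} [Category* C]
    [Preadditive C] (K L : CochainComplex C ℤ) :
    (∀ f : (HomotopyCategory.quotient C (ComplexShape.up ℤ)).obj K ⟶
        ((HomotopyCategory.quotient C (ComplexShape.up ℤ)).obj L)⟦(1 : ℤ)⟧, f = 0) ↔
      ∀ g : K ⟶ L⟦(1 : ℤ)⟧, Nonempty (Homotopy g 0) := by
  let i := ((HomotopyCategory.quotient C (ComplexShape.up ℤ)).commShiftIso (1 : ℤ)).app L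
  simp only [← HomotopyCategory.quotient_map_eq_zero_iff]
  constructor
  · intro h g
    have hg := h ((HomotopyCategory.quotient C (ComplexShape.up ℤ)).map g ≫ i.hom)
    rwa [Preadditive.IsIso.comp_right_eq_zero] at hg
  · intro h f
    obtain ⟨g, hg⟩ := (HomotopyCategory.quotient _ _).map_surjective (f ≫ i.inv)
    rw [← Preadditive.IsIso.comp_right_eq_zero f i.inv, ← hg, h]

theorem forall_hom_shift_eq_zero_iff_extVanishes :
    (∀ f : X.toK ⟶ Y.toK⟦(1 : ℤ)⟧, f = 0) ↔ ExtVanishes X Y := by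
  rw [forall_hom_shift_eq_zero_iff_forall_homotopy_zero]
  let K : CochainComplex (ProjCat Λ) ℤ := Y.complex
  have hd : K.d (-1) 0 = (doubleXIso₀ (ofHom Y.d) rel).hom ≫ ofHom Y.d ≫
      (doubleXIso₁ (ofHom Y.d) rel (by simp)).inv := double_d (ofHom Y.d) rel (by simp)
  refine forall_homotopy_zero_iff_extVanishes
    (K.shiftFunctorObjXIso 1 (-1) 0 (by simp) ≪≫ doubleXIso₁ (ofHom Y.d) rel (by simp))
    (K.shiftFunctorObjXIso 1 (-2) (-1) (by simp) ≪≫ doubleXIso₀ (ofHom Y.d) rel) ?_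
    (isZero_double_X (ofHom Y.d) rel 1 (by simp) (by simp))
  simp only [Iso.trans_hom, Iso.trans_inv, Category.assoc]
  rw [← reassoc_of% hd, CochainComplex.shiftFunctor_obj_d']
  simp only [Int.reduceNeg, CochainComplex.shiftFunctor_obj_X', Int.reduceAdd,
    Int.negOnePow_one, Units.neg_smul, one_smul, CochainComplex.shiftFunctorObjXIso,
    XIsoOfEq_rfl, Iso.refl_hom, Iso.refl_inv, Category.comp_id]
  exact congrArg Neg.neg (Category.id_comp _).symm

theorem isRigid_iff_extVanishes : X.IsRigid ↔ ExtVanishes X X :=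
  forall_hom_shift_eq_zero_iff_extVanishes

end TwoTerm

namespace TwoTerm

variable {Λ : Type v} [Ring Λ] {X X' Y Y' Z : TwoTerm Λ}

theorem IsIsomorphic.refl (X : TwoTerm Λ) : X.IsIsomorphic X := ⟨Iso.refl _⟩

theorem IsIsomorphic.symm (h : X.IsIsomorphic Y) : Y.IsIsomorphic X :=
  h.map Iso.symm

theorem IsIsomorphic.trans (h : X.IsIsomorphic Y) (h' : Y.IsIsomorphic Z) : X.IsIsomorphic Z :=
  h.elim fun i => h'.elim fun j => ⟨i ≪≫ j⟩

theorem IsIsomorphic.isZero_iff (h : X.IsIsomorphic Y) : IsZero X.toK ↔ IsZero Y.toK :=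
  h.elim fun i => i.isZero_iff

theorem IsIsomorphic.of_equiv (a₁ : X.P₁.obj ≃ₗ[Λᵐᵒᵖ] Y.P₁.obj)
    (a₀ : X.P₀.obj ≃ₗ[Λᵐᵒᵖ] Y.P₀.obj) (h : ∀ x, Y.d (a₁ x) = a₀ (X.d x)) :
    X.IsIsomorphic Y := by
  have h' (y : Y.P₁.obj) : X.d (a₁.symm y) = a₀.symm (Y.d y) := by
    rw [LinearEquiv.eq_symm_apply, ← h, LinearEquiv.apply_symm_apply]
  exact isIsomorphic_iff.2 ⟨⟨a₁, a₀, LinearMap.ext h⟩, ⟨a₁.symm, a₀.symm, LinearMap.ext h'⟩,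
    .of_eq (LinearMap.ext a₁.symm_apply_apply) (LinearMap.ext a₀.symm_apply_apply),
    .of_eq (LinearMap.ext a₁.apply_symm_apply) (LinearMap.ext a₀.apply_symm_apply)⟩

/-- `X` is a retract of `Y` in the homotopy category, in terms of squares. -/
def IsRetract (X Y : TwoTerm Λ) : Prop :=
  ∃ (a : Map X Y) (b : Map Y X), (b.comp a).Homotopic (Map.id X)

theorem IsIsomorphic.isRetract (h : X.IsIsomorphic Y) : X.IsRetract Y := by
  obtain ⟨a, b, h, -⟩ := isIsomorphic_iff.1 h
  exact ⟨a, b, h⟩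

theorem ExtVanishes.of_isRetract (h : ExtVanishes X Y) (hX : X'.IsRetract X)
    (hY : Y'.IsRetract Y) : ExtVanishes X' Y' := by
  rw [← forall_hom_shift_eq_zero_iff_extVanishes] at h ⊢
  obtain ⟨a, b, hab⟩ := hX
  obtain ⟨c, d, hcd⟩ := hY
  rw [← Map.toK_eq_iff, Map.toK_comp, Map.toK_id] at hab hcd
  intro f
  calc f = (a.toK ≫ b.toK) ≫ f ≫ (c.toK ≫ d.toK)⟦(1 : ℤ)⟧' := by simp [hab, hcd]
    _ = a.toK ≫ (b.toK ≫ f ≫ c.toK⟦(1 : ℤ)⟧') ≫ d.toK⟦(1 : ℤ)⟧' := by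
      rw [Functor.map_comp]; simp only [Category.assoc]
    _ = 0 := by rw [h (b.toK ≫ f ≫ c.toK⟦(1 : ℤ)⟧')]; simp

theorem extVanishes_congr (hX : X.IsIsomorphic X') (hY : Y.IsIsomorphic Y') :
    ExtVanishes X Y ↔ ExtVanishes X' Y' :=
  ⟨fun h => h.of_isRetract hX.symm.isRetract hY.symm.isRetract,
    fun h => h.of_isRetract hX.isRetract hY.isRetract⟩

theorem IsIsomorphic.isRigid_iff (h : X.IsIsomorphic Y) : X.IsRigid ↔ Y.IsRigid := by
  rw [isRigid_iff_extVanishes, isRigid_iff_extVanishes, extVanishes_congr h h]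

section Sum

variable {m l : ℕ}

theorem isRetract_sum (X : Fin m → TwoTerm Λ) (i : Fin m) : (X i).IsRetract (sum X) := by
  let incl : Map (X i) (sum X) :=
    { f₁ := LinearMap.single Λᵐᵒᵖ (fun i => (X i).P₁.obj) i
      f₀ := LinearMap.single Λᵐᵒᵖ (fun i => (X i).P₀.obj) i
      comm := LinearMap.ext fun x => funext fun j =>
        Pi.apply_single (fun i => (X i).d) (fun i => map_zero (X i).d) i x j }
  let proj : Map (sum X) (X i) :=
    { f₁ := LinearMap.proj (R := Λᵐᵒᵖ) (φ := fun i => (X i).P₁.obj) i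
      f₀ := LinearMap.proj (R := Λᵐᵒᵖ) (φ := fun i => (X i).P₀.obj) i
      comm := rfl }
  exact ⟨incl, proj, .of_eq
    (LinearMap.ext fun x => Pi.single_eq_same (M := fun i => (X i).P₁.obj) i x)
    (LinearMap.ext fun x => Pi.single_eq_same (M := fun i => (X i).P₀.obj) i x)⟩

/-- The direct sum of squares. -/
def Map.sum {X Y : Fin m → TwoTerm Λ} (a : ∀ i, Map (X i) (Y i)) :
    Map (TwoTerm.sum X) (TwoTerm.sum Y) where
  f₁ := LinearMap.piMap fun i => (a i).f₁
  f₀ := LinearMap.piMap fun i => (a i).f₀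
  comm := LinearMap.ext fun x => funext fun i => LinearMap.congr_fun (a i).comm (x i)

theorem IsIsomorphic.sum {X Y : Fin m → TwoTerm Λ} (h : ∀ i, (X i).IsIsomorphic (Y i)) :
    (TwoTerm.sum X).IsIsomorphic (TwoTerm.sum Y) := by
  simp only [isIsomorphic_iff] at h ⊢
  choose a b hba hab using h
  choose s hs₁ hs₀ using hba
  choose t ht₁ ht₀ using hab
  exact ⟨Map.sum a, Map.sum b,
    ⟨LinearMap.piMap s, LinearMap.ext fun x => funext fun i => LinearMap.congr_fun (hs₁ i) (x i),
      LinearMap.ext fun x => funext fun i => LinearMap.congr_fun (hs₀ i) (x i)⟩,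
    ⟨LinearMap.piMap t, LinearMap.ext fun x => funext fun i => LinearMap.congr_fun (ht₁ i) (x i),
      LinearMap.ext fun x => funext fun i => LinearMap.congr_fun (ht₀ i) (x i)⟩⟩

theorem extVanishes_sum_left_iff (X : Fin m → TwoTerm Λ) (Y : TwoTerm Λ) :
    ExtVanishes (sum X) Y ↔ ∀ i, ExtVanishes (X i) Y := by
  refine ⟨fun h i => h.of_isRetract (isRetract_sum X i) (IsIsomorphic.refl Y).isRetract,
    fun h f => ?_⟩
  choose h₁ h₀ hf using fun i =>
    h i (f ∘ₗ LinearMap.single Λᵐᵒᵖ (fun i => (X i).P₁.obj) i)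
  refine ⟨LinearMap.lsum Λᵐᵒᵖ (fun i => (X i).P₁.obj) ℕ h₁,
    LinearMap.lsum Λᵐᵒᵖ (fun i => (X i).P₀.obj) ℕ h₀, LinearMap.pi_ext fun i x => ?_⟩
  have hd : (sum X).d (Pi.single i x) = Pi.single i ((X i).d x) :=
    funext fun j => Pi.apply_single (fun i => (X i).d) (fun i => map_zero (X i).d) i x j
  change f (Pi.single i x) = Y.d (LinearMap.lsum _ _ ℕ h₁ (Pi.single i x)) +
    LinearMap.lsum _ _ ℕ h₀ ((sum X).d (Pi.single i x))
  rw [hd, LinearMap.lsum_piSingle, LinearMap.lsum_piSingle]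
  exact LinearMap.congr_fun (hf i) x

theorem extVanishes_sum_right_iff (X : TwoTerm Λ) (Y : Fin l → TwoTerm Λ) :
    ExtVanishes X (sum Y) ↔ ∀ j, ExtVanishes X (Y j) := by
  refine ⟨fun h j => h.of_isRetract (IsIsomorphic.refl X).isRetract (isRetract_sum Y j),
    fun h f => ?_⟩
  choose h₁ h₀ hf using fun j =>
    h j (LinearMap.proj (R := Λᵐᵒᵖ) (φ := fun j => (Y j).P₀.obj) j ∘ₗ f)
  exact ⟨LinearMap.pi h₁, LinearMap.pi h₀,
    LinearMap.ext fun x => funext fun j => LinearMap.congr_fun (hf j) x⟩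

theorem isRigid_sum_iff (X : Fin m → TwoTerm Λ) :
    (sum X).IsRigid ↔ ∀ i j, ExtVanishes (X i) (X j) := by
  rw [isRigid_iff_extVanishes, extVanishes_sum_left_iff]
  simp only [extVanishes_sum_right_iff]

end Sum

end TwoTerm

namespace SiltingVertex

variable {Λ : Type v} [Ring Λ]

/-- The class of an indecomposable rigid 2-term object. -/
def mk (X : TwoTerm Λ) (h : X.IsIndecomposable) (h' : X.IsRigid) : SiltingVertex Λ :=
  Quotient.mk (rigidSetoid Λ) ⟨X, h, h'⟩

theorem rep_mk {X : TwoTerm Λ} (h : X.IsIndecomposable) (h' : X.IsRigid) :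
    (mk X h h').rep.IsIsomorphic X :=
  Quotient.mk_out (s := rigidSetoid Λ) ⟨X, h, h'⟩

theorem isIndecomposable_rep (x : SiltingVertex Λ) : x.rep.IsIndecomposable :=
  (Quotient.out (s := rigidSetoid Λ) x).2.1

theorem isRigid_rep (x : SiltingVertex Λ) : x.rep.IsRigid :=
  (Quotient.out (s := rigidSetoid Λ) x).2.2

theorem ext {x y : SiltingVertex Λ} (h : x.rep.IsIsomorphic y.rep) : x = y :=
  Quotient.out_equiv_out.1 h

/-- The relation of which the 2-term silting complex is the flag complex:
`Hom(x, y[1]) = 0`. -/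
def Compatible (x y : SiltingVertex Λ) : Prop :=
  TwoTerm.ExtVanishes x.rep y.rep

end SiltingVertex

theorem forall_equivFin_symm {V : Type*} (F : Finset V) (p : V → V → Prop) :
    (∀ i j, p (F.equivFin.symm i).1 (F.equivFin.symm j).1) ↔ ∀ x ∈ F, ∀ y ∈ F, p x y := by
  simp only [F.equivFin.symm.forall_congr_left, F.equivFin.symm_symm, Equiv.symm_apply_apply,
    Subtype.forall]

theorem isFlagComplexOf_siltingComplex (Λ : Type v) [Ring Λ] :
    IsFlagComplexOf (siltingComplex Λ) SiltingVertex.Compatible := by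
  intro F
  change F.Nonempty ∧ TwoTerm.IsRigid _ ↔ _
  rw [TwoTerm.isRigid_sum_iff, ← forall_equivFin_symm]
  rfl

/-! ### Minimal projective presentations -/

section Superfluous

variable {R : Type*} [Ring R] {A B : Type*} [AddCommGroup A] [Module R A] [AddCommGroup B]
  [Module R B]

namespace IsSuperfluous

variable {N N' : Submodule R A}

theorem mono (hN : IsSuperfluous N) (h : N' ≤ N) : IsSuperfluous N' := fun L hL =>
  hN L (eq_top_iff.2 (hL ▸ sup_le_sup_right h L))

theorem surjective_of_forall_sub_mem (hN : IsSuperfluous N) {f : B →ₗ[R] A}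
    (h : ∀ x, ∃ y, x - f y ∈ N) : Function.Surjective f := by
  refine LinearMap.range_eq_top.1 (hN _ (eq_top_iff.2 fun x _ => ?_))
  obtain ⟨y, hy⟩ := h x
  exact Submodule.mem_sup.2 ⟨_, hy, f y, ⟨y, rfl⟩, sub_add_cancel x (f y)⟩

theorem bijective_of_forall_sub_mem [IsNoetherian R A] (hN : IsSuperfluous N) {f : A →ₗ[R] A}
    (h : ∀ x, x - f x ∈ N) : Function.Bijective f :=
  have hf := hN.surjective_of_forall_sub_mem fun x => ⟨x, h x⟩
  ⟨IsNoetherian.injective_of_surjective_endomorphism _ hf, hf⟩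

theorem map (hN : IsSuperfluous N) (f : A →ₗ[R] B) : IsSuperfluous (N.map f) := by
  intro L hL
  have hcomap : L.comap f = ⊤ := by
    refine hN _ (eq_top_iff.2 fun x _ => ?_)
    obtain ⟨_, ⟨n, hn, rfl⟩, l, hl, hx⟩ := Submodule.mem_sup.1
      (hL ▸ Submodule.mem_top : f x ∈ N.map f ⊔ L)
    refine Submodule.mem_sup.2 ⟨n, hn, x - n, ?_, add_sub_cancel n x⟩
    rwa [Submodule.mem_comap, map_sub, ← hx, add_sub_cancel_left]
  have hle : N.map f ≤ L := Submodule.map_le_iff_le_comap.2 (hcomap ▸ le_top)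
  rwa [sup_eq_right.2 hle] at hL

theorem finset_sup {ι : Type*} (s : Finset ι) {N : ι → Submodule R A}
    (hN : ∀ i, IsSuperfluous (N i)) : IsSuperfluous (s.sup N) := by
  classical
  induction s using Finset.induction_on with
  | empty => intro L hL; rwa [Finset.sup_empty, bot_sup_eq] at hL
  | insert i s _ ih =>
    intro L hL
    rw [Finset.sup_insert, sup_assoc] at hL
    exact ih L (hN i _ hL)

theorem pi {ι : Type*} [Finite ι] {A : ι → Type*} [∀ i, AddCommGroup (A i)]
    [∀ i, Module R (A i)] {N : ∀ i, Submodule R (A i)} (hN : ∀ i, IsSuperfluous (N i)) :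
    IsSuperfluous (Submodule.pi Set.univ N) := by
  classical
  have := Fintype.ofFinite ι
  refine (finset_sup Finset.univ fun i => (hN i).map (LinearMap.single R A i)).mono
    fun x hx => ?_
  rw [← show ∑ i, Pi.single i (x i) = x from LinearMap.sum_single_apply _ x]
  refine Submodule.sum_mem _ fun i hi => ?_
  exact (Finset.le_sup (f := fun i => (N i).map (LinearMap.single R A i)) hi)
    ⟨x i, hx i trivial, rfl⟩

theorem subsingleton (hN : IsSuperfluous N) (h : N = ⊤) : Subsingleton A :=
  (Submodule.subsingleton_iff R).1 (subsingleton_of_bot_eq_top (hN ⊥ (by rw [h, top_sup_eq])))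

end IsSuperfluous

theorem bijective_of_bijective_comp {f : A →ₗ[R] B} {g : B →ₗ[R] A}
    (h : Function.Bijective (g ∘ₗ f)) (h' : Function.Bijective (f ∘ₗ g)) : Function.Bijective f :=
  ⟨Function.Injective.of_comp h.1, Function.Surjective.of_comp h'.2⟩

theorem exists_comp_eq_of_range_le {P : Type*} [AddCommGroup P] [Module R P]
    [Module.Projective R P] (d : A →ₗ[R] B) (f : P →ₗ[R] B)
    (h : LinearMap.range f ≤ LinearMap.range d) : ∃ g : P →ₗ[R] A, d ∘ₗ g = f := by
  obtain ⟨g, hg⟩ := Module.projective_lifting_property d.rangeRestrict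
    (f.codRestrict (LinearMap.range d) fun x => h ⟨x, rfl⟩) d.surjective_rangeRestrict
  exact ⟨g, LinearMap.ext fun x => congrArg Subtype.val (LinearMap.congr_fun hg x)⟩

theorem bijective_snd_comp_of_isSuperfluous {P Q : Type*} [AddCommGroup P] [Module R P]
    [AddCommGroup Q] [Module R Q] [IsNoetherian R P] {N : Submodule R B} (hN : IsSuperfluous N)
    (a : A × P →ₗ[R] B × Q) (b : B × Q →ₗ[R] A × P) (ha : ∀ x, (a (0, x)).1 ∈ N)
    (hba : ∀ x, b (a (0, x)) = (0, x)) :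
    Function.Bijective ((LinearMap.snd R A P ∘ₗ b ∘ₗ LinearMap.inr R B Q) ∘ₗ
      (LinearMap.snd R B Q ∘ₗ a ∘ₗ LinearMap.inr R A P)) := by
  refine (hN.map (LinearMap.snd R A P ∘ₗ b ∘ₗ LinearMap.inl R B Q)).bijective_of_forall_sub_mem
    fun x => ⟨(a (0, x)).1, ha x, ?_⟩
  have h : b ((a (0, x)).1, 0) + b (0, (a (0, x)).2) = (0, x) := by
    rw [← map_add, Prod.mk_add_mk, add_zero, zero_add, hba]
  exact eq_sub_of_add_eq (congrArg Prod.snd h)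

end Superfluous

section MinimalPresentation

variable {Λ : Type v} [Ring Λ] {X Y : TwoTerm Λ} {M N : Type v} [AddCommGroup M]
  [Module Λᵐᵒᵖ M] [AddCommGroup N] [Module Λᵐᵒᵖ N] {π : X.P₀.obj →ₗ[Λᵐᵒᵖ] M}
  {ρ : Y.P₀.obj →ₗ[Λᵐᵒᵖ] N}

theorem TwoTerm.exists_map_lift (hπ : LinearMap.range X.d ≤ LinearMap.ker π)
    (hρ : Function.Surjective ρ) (hY : LinearMap.range Y.d = LinearMap.ker ρ)
    (f : M →ₗ[Λᵐᵒᵖ] N) : ∃ a : Map X Y, ρ ∘ₗ a.f₀ = f ∘ₗ π := by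
  obtain ⟨a₀, h₀⟩ := Module.projective_lifting_property ρ (f ∘ₗ π) hρ
  have hrange : LinearMap.range (a₀ ∘ₗ X.d) ≤ LinearMap.range Y.d := by
    rintro _ ⟨x, rfl⟩
    have hx : π (X.d x) = 0 := hπ ⟨x, rfl⟩
    rw [hY, LinearMap.mem_ker, ← LinearMap.comp_apply, ← LinearMap.comp_assoc, h₀,
      LinearMap.comp_apply, LinearMap.comp_apply, hx, map_zero]
  obtain ⟨a₁, h₁⟩ := exists_comp_eq_of_range_le Y.d (a₀ ∘ₗ X.d) hrange
  exact ⟨⟨a₁, a₀, h₁⟩, h₀⟩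

namespace IsMinimalPresentation

theorem apply_d (hX : IsMinimalPresentation X π) (x : X.P₁.obj) : π (X.d x) = 0 := by
  rw [← LinearMap.mem_ker, ← hX.exact]
  exact ⟨x, rfl⟩

theorem bijective_map [IsArtinianRing Λᵐᵒᵖ] (hX : IsMinimalPresentation X π)
    (c : TwoTerm.Map X X) (hc : π ∘ₗ c.f₀ = π) :
    Function.Bijective c.f₁ ∧ Function.Bijective c.f₀ := by
  refine ⟨hX.bijective c.f₀ c.f₁ hc c.comm, hX.superfluous₀.bijective_of_forall_sub_mem
    fun x => ?_⟩
  rw [LinearMap.mem_ker, map_sub, sub_eq_zero]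
  exact (LinearMap.congr_fun hc x).symm

theorem exists_equiv [IsArtinianRing Λᵐᵒᵖ] (hX : IsMinimalPresentation X π)
    (hY : IsMinimalPresentation Y ρ) (f : M ≃ₗ[Λᵐᵒᵖ] N) :
    ∃ (a₁ : X.P₁.obj ≃ₗ[Λᵐᵒᵖ] Y.P₁.obj) (a₀ : X.P₀.obj ≃ₗ[Λᵐᵒᵖ] Y.P₀.obj),
      ∀ x, Y.d (a₁ x) = a₀ (X.d x) := by
  obtain ⟨a, ha⟩ := TwoTerm.exists_map_lift hX.exact.le hY.surjective hY.exact f.toLinearMap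
  obtain ⟨b, hb⟩ := TwoTerm.exists_map_lift hY.exact.le hX.surjective hX.exact f.symm.toLinearMap
  have ha' : ∀ x, ρ (a.f₀ x) = f (π x) := LinearMap.congr_fun ha
  have hb' : ∀ x, π (b.f₀ x) = f.symm (ρ x) := LinearMap.congr_fun hb
  have hba := hX.bijective_map (b.comp a) (LinearMap.ext fun x => by simp [ha', hb'])
  have hab := hY.bijective_map (a.comp b) (LinearMap.ext fun x => by simp [ha', hb'])
  exact ⟨.ofBijective _ (bijective_of_bijective_comp hba.1 hab.1),
    .ofBijective _ (bijective_of_bijective_comp hba.2 hab.2), LinearMap.congr_fun a.comm⟩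

theorem exists_retraction [IsArtinianRing Λᵐᵒᵖ] {ρ : Y.P₀.obj →ₗ[Λᵐᵒᵖ] M}
    (hX : IsMinimalPresentation X π) (hρ : Function.Surjective ρ)
    (hY : LinearMap.range Y.d = LinearMap.ker ρ) :
    ∃ (a : TwoTerm.Map X Y) (b : TwoTerm.Map Y X), b.f₁ ∘ₗ a.f₁ = LinearMap.id ∧
      b.f₀ ∘ₗ a.f₀ = LinearMap.id ∧ π ∘ₗ b.f₀ = ρ := by
  obtain ⟨a, ha⟩ := TwoTerm.exists_map_lift hX.exact.le hρ hY LinearMap.id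
  obtain ⟨b, hb⟩ := TwoTerm.exists_map_lift hY.le hX.surjective hX.exact LinearMap.id
  have hπ : π ∘ₗ (b.comp a).f₀ = π := by
    rw [TwoTerm.Map.comp_f₀, ← LinearMap.comp_assoc, hb, LinearMap.id_comp, ha,
      LinearMap.id_comp]
  obtain ⟨h₁, h₀⟩ := hX.bijective_map (b.comp a) hπ
  let E₁ := LinearEquiv.ofBijective _ h₁
  let E₀ := LinearEquiv.ofBijective _ h₀
  have hE (x : X.P₁.obj) : X.d (E₁ x) = E₀ (X.d x) := LinearMap.congr_fun (b.comp a).comm x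
  have hE' (x : X.P₁.obj) : X.d (E₁.symm x) = E₀.symm (X.d x) := by
    rw [LinearEquiv.eq_symm_apply, ← hE, LinearEquiv.apply_symm_apply]
  let r : TwoTerm.Map X X := ⟨E₁.symm.toLinearMap, E₀.symm.toLinearMap, LinearMap.ext hE'⟩
  refine ⟨a, r.comp b, LinearMap.ext E₁.symm_apply_apply, LinearMap.ext E₀.symm_apply_apply,
    LinearMap.ext fun y => ?_⟩
  calc π (E₀.symm (b.f₀ y)) = π (E₀ (E₀.symm (b.f₀ y))) := (LinearMap.congr_fun hπ _).symm
    _ = π (b.f₀ y) := by rw [E₀.apply_symm_apply]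
    _ = ρ y := LinearMap.congr_fun hb y

end IsMinimalPresentation

end MinimalPresentation

theorem IsMinimalPresentation.sum {Λ : Type v} [Ring Λ] {m : ℕ} {X : Fin m → TwoTerm Λ}
    {M : Fin m → Type*} [∀ i, AddCommGroup (M i)] [∀ i, Module Λᵐᵒᵖ (M i)]
    {π : ∀ i, (X i).P₀.obj →ₗ[Λᵐᵒᵖ] M i} (hX : ∀ i, IsMinimalPresentation (X i) (π i)) :
    IsMinimalPresentation (TwoTerm.sum X)
      (LinearMap.pi fun i => π i ∘ₗ LinearMap.proj (φ := fun i => (X i).P₀.obj) i) where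
  surjective y := by
    choose x hx using fun i => (hX i).surjective (y i)
    exact ⟨x, funext hx⟩
  exact := by
    have hmem (i : Fin m) (x : (X i).P₀.obj) : (∃ y, (X i).d y = x) ↔ π i x = 0 :=
      SetLike.ext_iff.1 (hX i).exact x
    refine Submodule.ext fun x => ⟨?_, fun hx => ?_⟩
    · rintro ⟨y, rfl⟩
      exact funext fun i => (hmem i _).1 ⟨y i, rfl⟩
    · choose y hy using fun i => (hmem i (x i)).2 (congrFun hx i)
      exact ⟨y, funext hy⟩
  superfluous₀ := (IsSuperfluous.pi fun i => (hX i).superfluous₀).mono fun x hx i _ =>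
    congrFun (f := fun i => π i (x i)) hx i
  superfluous₁ := (IsSuperfluous.pi fun i => (hX i).superfluous₁).mono fun x hx i _ =>
    congrFun (f := fun i => (X i).d (x i)) hx i

/-! ### Pairs and 2-term objects -/

/-- A product of direct sums is the direct sum of the products. -/
def piProdEquiv (R : Type*) [Semiring R] {ι : Type*} (A B : ι → Type*) [∀ i, AddCommMonoid (A i)]
    [∀ i, AddCommMonoid (B i)] [∀ i, Module R (A i)] [∀ i, Module R (B i)] :
    (∀ i, A i × B i) ≃ₗ[R] (∀ i, A i) × ∀ i, B i where
  toFun x := (fun i => (x i).1, fun i => (x i).2)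
  invFun x i := (x.1 i, x.2 i)
  map_add' _ _ := rfl
  map_smul' _ _ := rfl
  left_inv _ := rfl
  right_inv _ := rfl

section Correspondence

variable {Λ : Type v} [Ring Λ]

/-- The direct sum of two finitely generated projective modules. -/
abbrev ProjCat.prod (P Q : ProjCat Λ) : ProjCat Λ where
  obj := ModuleCat.of Λᵐᵒᵖ (P.obj × Q.obj)
  property := ⟨inferInstanceAs (Module.Finite Λᵐᵒᵖ (P.obj × Q.obj)),
    inferInstanceAs (Module.Projective Λᵐᵒᵖ (P.obj × Q.obj))⟩

namespace TwoTerm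

variable {X Y : TwoTerm Λ}

/-- The 2-term object `(P₁ ⟶ P₀) ⊕ (P ⟶ 0)`; the summand `0` of `P₀ ⊕ 0` is left out. -/
abbrev addShift (Y : TwoTerm Λ) (P : ProjCat Λ) : TwoTerm Λ where
  P₁ := Y.P₁.prod P
  P₀ := Y.P₀
  d := Y.d ∘ₗ LinearMap.fst Λᵐᵒᵖ Y.P₁.obj P.obj

theorem range_addShift_d (Y : TwoTerm Λ) (P : ProjCat Λ) :
    LinearMap.range (Y.addShift P).d = LinearMap.range Y.d :=
  LinearMap.range_comp_of_range_eq_top _ Submodule.range_fst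

theorem Map.range_d_le_comap (a : Map X Y) :
    LinearMap.range X.d ≤ (LinearMap.range Y.d).comap a.f₀ := by
  rintro _ ⟨x, rfl⟩
  exact ⟨a.f₁ x, LinearMap.congr_fun a.comm x⟩

theorem Map.mapQ_comp_mapQ_eq_id {a : Map X Y} {b : Map Y X}
    (h : (b.comp a).Homotopic (Map.id X)) :
    (LinearMap.range Y.d).mapQ (LinearMap.range X.d) b.f₀ b.range_d_le_comap ∘ₗ
      (LinearMap.range X.d).mapQ (LinearMap.range Y.d) a.f₀ a.range_d_le_comap =
        LinearMap.id := by
  obtain ⟨s, -, hs⟩ := h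
  refine Submodule.linearMap_qext _ (LinearMap.ext fun x => ?_)
  refine (Submodule.Quotient.eq _).2 ⟨s x, ?_⟩
  have hx : b.f₀ (a.f₀ x) = x + X.d (s x) := LinearMap.congr_fun hs x
  exact eq_sub_of_add_eq' hx.symm

theorem IsIsomorphic.nonempty_cokernel_equiv (h : X.IsIsomorphic Y) :
    Nonempty ((X.P₀.obj ⧸ LinearMap.range X.d) ≃ₗ[Λᵐᵒᵖ] (Y.P₀.obj ⧸ LinearMap.range Y.d)) := by
  obtain ⟨a, b, hba, hab⟩ := isIsomorphic_iff.1 h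
  exact ⟨LinearEquiv.ofLinearMap _ _ (Map.mapQ_comp_mapQ_eq_id hab)
    (Map.mapQ_comp_mapQ_eq_id hba)⟩

theorem exists_contraction {a : Map Y X} {b : Map X Y} (h₁ : b.f₁ ∘ₗ a.f₁ = LinearMap.id)
    (h₀ : b.f₀ ∘ₗ a.f₀ = LinearMap.id) (hb : LinearMap.ker b.f₀ ≤ LinearMap.range X.d) :
    ∃ σ : X.P₀.obj →ₗ[Λᵐᵒᵖ] X.P₁.obj, b.f₁ ∘ₗ σ = 0 ∧ σ ∘ₗ a.f₀ = 0 ∧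
      X.d ∘ₗ σ = LinearMap.id - a.f₀ ∘ₗ b.f₀ := by
  replace h₁ : ∀ y, b.f₁ (a.f₁ y) = y := LinearMap.congr_fun h₁
  replace h₀ : ∀ y, b.f₀ (a.f₀ y) = y := LinearMap.congr_fun h₀
  have ha : ∀ y, X.d (a.f₁ y) = a.f₀ (Y.d y) := LinearMap.congr_fun a.comm
  have hbd : ∀ x, Y.d (b.f₁ x) = b.f₀ (X.d x) := LinearMap.congr_fun b.comm
  have hp (p : X.P₀.obj) : b.f₀ (p - a.f₀ (b.f₀ p)) = 0 := by rw [map_sub, h₀, sub_self]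
  have hrange : LinearMap.range (LinearMap.id - a.f₀ ∘ₗ b.f₀) ≤
      LinearMap.range (X.d ∘ₗ (LinearMap.ker b.f₁).subtype) := by
    rintro _ ⟨p, rfl⟩
    obtain ⟨x, hx⟩ := hb (hp p)
    refine ⟨⟨x - a.f₁ (b.f₁ x), by rw [LinearMap.mem_ker, map_sub, h₁, sub_self]⟩, ?_⟩
    change X.d (x - a.f₁ (b.f₁ x)) = p - a.f₀ (b.f₀ p)
    rw [map_sub, ha, hbd, hx, hp, map_zero, sub_zero]
  obtain ⟨τ, hτ⟩ := exists_comp_eq_of_range_le _ _ hrange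
  refine ⟨(LinearMap.ker b.f₁).subtype ∘ₗ τ ∘ₗ (LinearMap.id - a.f₀ ∘ₗ b.f₀),
    LinearMap.ext fun p => (τ _).2, LinearMap.ext fun y => ?_, LinearMap.ext fun p => ?_⟩
  · simp [h₀]
  · have hd := LinearMap.congr_fun hτ (p - a.f₀ (b.f₀ p))
    simpa [h₀] using hd

theorem isIsomorphic_addShift_of_splitting {P : ProjCat Λ} {a : Map Y X} {b : Map X Y}
    {σ : X.P₀.obj →ₗ[Λᵐᵒᵖ] X.P₁.obj} {ι : P.obj →ₗ[Λᵐᵒᵖ] X.P₁.obj}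
    {q : X.P₁.obj →ₗ[Λᵐᵒᵖ] P.obj} (h₁ : b.f₁ ∘ₗ a.f₁ = LinearMap.id)
    (h₀ : b.f₀ ∘ₗ a.f₀ = LinearMap.id) (hσ : X.d ∘ₗ σ = LinearMap.id - a.f₀ ∘ₗ b.f₀)
    (hdι : X.d ∘ₗ ι = 0) (hbι : b.f₁ ∘ₗ ι = 0) (hqa : q ∘ₗ a.f₁ = 0)
    (hqι : q ∘ₗ ι = LinearMap.id)
    (hιq : ι ∘ₗ q = LinearMap.id - a.f₁ ∘ₗ b.f₁ - σ ∘ₗ X.d) :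
    X.IsIsomorphic (Y.addShift P) := by
  have hincl : X.d ∘ₗ a.f₁.coprod ι = a.f₀ ∘ₗ (Y.addShift P).d :=
    LinearMap.ext fun y => by
      change X.d (a.f₁ y.1 + ι y.2) = a.f₀ (Y.d y.1)
      exact (map_add X.d _ _).trans <| (congrArg₂ (· + ·) (LinearMap.congr_fun a.comm y.1)
        (LinearMap.congr_fun hdι y.2)).trans (add_zero _)
  refine isIsomorphic_iff.2 ⟨⟨b.f₁.prod q, b.f₀, b.comm⟩, ⟨a.f₁.coprod ι, a.f₀, hincl⟩,
    ⟨-σ, LinearMap.ext fun x => ?_, LinearMap.ext fun p => ?_⟩,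
    .of_eq (LinearMap.ext fun y => Prod.ext ?_ ?_) h₀⟩
  · have hx : ι (q x) = x - a.f₁ (b.f₁ x) - σ (X.d x) := LinearMap.congr_fun hιq x
    change a.f₁ (b.f₁ x) + ι (q x) = x + -σ (X.d x)
    rw [hx]
    abel
  · have hp : X.d (σ p) = p - a.f₀ (b.f₀ p) := LinearMap.congr_fun hσ p
    change a.f₀ (b.f₀ p) = p + X.d (-σ p)
    rw [map_neg, hp]
    abel
  · change b.f₁ (a.f₁ y.1 + ι y.2) = y.1
    exact (map_add b.f₁ _ _).trans <| (congrArg₂ (· + ·) (LinearMap.congr_fun h₁ y.1)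
      (LinearMap.congr_fun hbι y.2)).trans (add_zero _)
  · change q (a.f₁ y.1 + ι y.2) = y.2
    exact (map_add q _ _).trans <| (congrArg₂ (· + ·) (LinearMap.congr_fun hqa y.1)
      (LinearMap.congr_fun hqι y.2)).trans (zero_add _)

theorem exists_isIsomorphic_addShift [IsNoetherianRing Λᵐᵒᵖ] {a : Map Y X} {b : Map X Y}
    (h₁ : b.f₁ ∘ₗ a.f₁ = LinearMap.id) (h₀ : b.f₀ ∘ₗ a.f₀ = LinearMap.id)
    (hb : LinearMap.ker b.f₀ ≤ LinearMap.range X.d) :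
    ∃ P : ProjCat Λ, X.IsIsomorphic (Y.addShift P) := by
  obtain ⟨σ, hbσ, hσa, hσ⟩ := exists_contraction h₁ h₀ hb
  have hba : ∀ y, b.f₁ (a.f₁ y) = y := LinearMap.congr_fun h₁
  have hbσ' : ∀ p, b.f₁ (σ p) = 0 := LinearMap.congr_fun hbσ
  have hσa' : ∀ y, σ (a.f₀ y) = 0 := LinearMap.congr_fun hσa
  have hdσ : ∀ p, X.d (σ p) = p - a.f₀ (b.f₀ p) := LinearMap.congr_fun hσ
  have had : ∀ y, X.d (a.f₁ y) = a.f₀ (Y.d y) := LinearMap.congr_fun a.comm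
  have hbd : ∀ x, Y.d (b.f₁ x) = b.f₀ (X.d x) := LinearMap.congr_fun b.comm
  let K : Submodule Λᵐᵒᵖ X.P₁.obj := LinearMap.ker b.f₁ ⊓ LinearMap.ker X.d
  let q : X.P₁.obj →ₗ[Λᵐᵒᵖ] K := LinearMap.codRestrict K
    (LinearMap.id - a.f₁ ∘ₗ b.f₁ - σ ∘ₗ X.d) fun x => by
      constructor <;> simp [hba, hbσ', hdσ, had, hbd]
  have hq (x : X.P₁.obj) : (q x : X.P₁.obj) = x - a.f₁ (b.f₁ x) - σ (X.d x) := rfl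
  have hqK : q ∘ₗ K.subtype = LinearMap.id := LinearMap.ext fun x => Subtype.ext <| by
    have hx₁ : b.f₁ x.1 = 0 := x.2.1
    have hx₀ : X.d x.1 = 0 := x.2.2
    change (q x.1 : X.P₁.obj) = x.1
    rw [hq, hx₁, hx₀, map_zero, map_zero, sub_zero, sub_zero]
  have hqa : q ∘ₗ a.f₁ = 0 := LinearMap.ext fun y => Subtype.ext <| by
    change (q (a.f₁ y) : X.P₁.obj) = 0
    rw [hq, hba, had, hσa', sub_self, sub_zero]
  let P : ProjCat Λ := ⟨ModuleCat.of Λᵐᵒᵖ K, inferInstanceAs (Module.Finite Λᵐᵒᵖ K),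
    Module.Projective.of_split K.subtype q hqK⟩
  exact ⟨P, isIsomorphic_addShift_of_splitting (P := P) (ι := K.subtype) h₁ h₀ hσ
    (LinearMap.ext fun x => x.2.2) (LinearMap.ext fun x => x.2.1) hqa hqK rfl⟩

theorem nonempty_equiv_of_addShift_isIsomorphic [IsNoetherianRing Λᵐᵒᵖ] {P Q : ProjCat Λ}
    (hX : IsSuperfluous (LinearMap.ker X.d)) (hY : IsSuperfluous (LinearMap.ker Y.d))
    (h : (X.addShift P).IsIsomorphic (Y.addShift Q)) : Nonempty (P.obj ≃ₗ[Λᵐᵒᵖ] Q.obj) := by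
  obtain ⟨a, b, ⟨s, hs, -⟩, ⟨t, ht, -⟩⟩ := isIsomorphic_iff.1 h
  let a₁ : X.P₁.obj × P.obj →ₗ[Λᵐᵒᵖ] Y.P₁.obj × Q.obj := a.f₁
  let b₁ : Y.P₁.obj × Q.obj →ₗ[Λᵐᵒᵖ] X.P₁.obj × P.obj := b.f₁
  have ha (x : P.obj) : Y.d (a₁ (0, x)).1 = 0 :=
    (LinearMap.congr_fun a.comm ((0 : X.P₁.obj), x)).trans (by simp)
  have hb (y : Q.obj) : X.d (b₁ (0, y)).1 = 0 :=
    (LinearMap.congr_fun b.comm ((0 : Y.P₁.obj), y)).trans (by simp)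
  have hba (x : P.obj) : b₁ (a₁ (0, x)) = (0, x) :=
    (LinearMap.congr_fun hs ((0 : X.P₁.obj), x)).trans (by simp)
  have hab (y : Q.obj) : a₁ (b₁ (0, y)) = (0, y) :=
    (LinearMap.congr_fun ht ((0 : Y.P₁.obj), y)).trans (by simp)
  exact ⟨.ofBijective _ (bijective_of_bijective_comp
    (bijective_snd_comp_of_isSuperfluous hY a₁ b₁ ha hba)
    (bijective_snd_comp_of_isSuperfluous hX b₁ a₁ hb hab))⟩

end TwoTerm

namespace TauPair

variable {V V' : TauPair Λ} {X X' : TwoTerm Λ}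

/-- The 2-term object `X` corresponds to the pair `V = (M, P)`: it is isomorphic to
`(P₁ ⟶ P₀) ⊕ (P ⟶ 0)` with `P₁ ⟶ P₀` a minimal projective presentation of `M`. -/
def Corresponds (V : TauPair Λ) (X : TwoTerm Λ) : Prop :=
  ∃ (Y : TwoTerm Λ) (π : Y.P₀.obj →ₗ[Λᵐᵒᵖ] V.M), IsMinimalPresentation Y π ∧
    X.IsIsomorphic (Y.addShift V.P)

theorem exists_corresponds [IsArtinianRing Λᵐᵒᵖ] (V : TauPair Λ) : ∃ X, V.Corresponds X := by
  obtain ⟨Y, π, h⟩ := exists_isMinimalPresentation (Λ := Λ) V.M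
  exact ⟨_, Y, π, h, .refl _⟩

theorem exists_corresponds_of_twoTerm [IsArtinianRing Λᵐᵒᵖ] (X : TwoTerm Λ) :
    ∃ V : TauPair Λ, V.Corresponds X := by
  let N := LinearMap.range X.d
  have hN : N = LinearMap.ker N.mkQ := N.ker_mkQ.symm
  obtain ⟨Y, π, hY⟩ := exists_isMinimalPresentation (Λ := Λ) (X.P₀.obj ⧸ N)
  obtain ⟨a, b, h₁, h₀, hb⟩ := hY.exists_retraction N.mkQ_surjective hN
  have hker : LinearMap.ker b.f₀ ≤ LinearMap.range X.d :=
    (LinearMap.ker_le_ker_comp b.f₀ π).trans (by rw [hb, N.ker_mkQ])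
  obtain ⟨P, hP⟩ := TwoTerm.exists_isIsomorphic_addShift h₁ h₀ hker
  exact ⟨⟨ModuleCat.of Λᵐᵒᵖ (X.P₀.obj ⧸ N), inferInstanceAs (Module.Finite Λᵐᵒᵖ (_ ⧸ N)), P⟩,
    Y, π, hY, hP⟩

namespace Corresponds

theorem of_isIsomorphic (h : V.Corresponds X) (h' : X.IsIsomorphic X') : V.Corresponds X' := by
  obtain ⟨Y, π, hY, hX⟩ := h
  exact ⟨Y, π, hY, h'.symm.trans hX⟩

theorem nonempty_cokernel_equiv (h : V.Corresponds X) :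
    Nonempty ((X.P₀.obj ⧸ LinearMap.range X.d) ≃ₗ[Λᵐᵒᵖ] V.M) := by
  obtain ⟨Y, π, hY, hX⟩ := h
  obtain ⟨E⟩ := hX.nonempty_cokernel_equiv
  exact ⟨E ≪≫ₗ Submodule.quotEquivOfEq _ _ ((Y.range_addShift_d V.P).trans hY.exact) ≪≫ₗ
    π.quotKerEquivOfSurjective hY.surjective⟩

theorem twoTerm_isIsomorphic [IsArtinianRing Λᵐᵒᵖ] (h : V.Corresponds X)
    (h' : V'.Corresponds X') (hV : V.IsIsomorphic V') : X.IsIsomorphic X' := by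
  obtain ⟨Y, π, hY, hX⟩ := h
  obtain ⟨Y', π', hY', hX'⟩ := h'
  obtain ⟨⟨f⟩, ⟨g⟩⟩ := hV
  obtain ⟨a₁, a₀, ha⟩ := hY.exists_equiv hY' f
  have hYY' : (Y.addShift V.P).IsIsomorphic (Y'.addShift V'.P) :=
    .of_equiv (a₁.prodCongr g) a₀ fun x => ha x.1
  exact (hX.trans hYY').trans hX'.symm

theorem tauPair_isIsomorphic [IsArtinianRing Λᵐᵒᵖ] (h : V.Corresponds X)
    (h' : V'.Corresponds X') (hX : X.IsIsomorphic X') : V.IsIsomorphic V' := by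
  obtain ⟨f⟩ := h.nonempty_cokernel_equiv
  obtain ⟨f'⟩ := h'.nonempty_cokernel_equiv
  obtain ⟨E⟩ := hX.nonempty_cokernel_equiv
  obtain ⟨Y, π, hY, hXY⟩ := h
  obtain ⟨Y', π', hY', hXY'⟩ := h'
  exact ⟨⟨f.symm ≪≫ₗ E ≪≫ₗ f'⟩, TwoTerm.nonempty_equiv_of_addShift_isIsomorphic
    hY.superfluous₁ hY'.superfluous₁ ((hXY.symm.trans hX).trans hXY')⟩

theorem isZero_iff (h : V.Corresponds X) : V.IsZero ↔ Limits.IsZero X.toK := by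
  obtain ⟨Y, π, hY, hX⟩ := h
  rw [hX.isZero_iff, TwoTerm.isZero_toK_iff]
  constructor
  · rintro ⟨hM, hP⟩
    have h₀ : Subsingleton Y.P₀.obj :=
      hY.superfluous₀.subsingleton (eq_top_iff.2 fun x _ => Subsingleton.elim _ _)
    have h₁ : Subsingleton Y.P₁.obj :=
      hY.superfluous₁.subsingleton (eq_top_iff.2 fun x _ => Subsingleton.elim _ _)
    exact ⟨fun x y _ => Prod.ext (h₁.elim _ _) (hP.elim _ _), fun x => ⟨0, h₀.elim _ _⟩⟩
  · rintro ⟨hinj, hsurj⟩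
    have hM (x : V.M) : x = 0 := by
      obtain ⟨x, rfl⟩ := hY.surjective x
      obtain ⟨y, rfl⟩ := hsurj x
      exact hY.apply_d y.1
    exact ⟨⟨fun x y => (hM x).trans (hM y).symm⟩,
      ⟨fun x y => congrArg Prod.snd (@hinj ((0 : Y.P₁.obj), x) ((0 : Y.P₁.obj), y) rfl)⟩⟩

theorem sum {m : ℕ} {V : Fin m → TauPair Λ} {X : Fin m → TwoTerm Λ}
    (h : ∀ i, (V i).Corresponds (X i)) : (TauPair.sum V).Corresponds (TwoTerm.sum X) := by
  choose Y π hY hX using h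
  exact ⟨TwoTerm.sum Y, _, IsMinimalPresentation.sum hY, (TwoTerm.IsIsomorphic.sum hX).trans
    (.of_equiv (piProdEquiv _ _ _) (LinearEquiv.refl _ _) fun x => rfl)⟩

theorem sum_pair (h : V.Corresponds X) (h' : V'.Corresponds X') :
    (TauPair.sum ![V, V']).Corresponds (TwoTerm.sum ![X, X']) :=
  Corresponds.sum (Fin.forall_fin_two.2 ⟨h, h'⟩)

theorem isIndecomposable_iff [IsArtinianRing Λᵐᵒᵖ] (h : V.Corresponds X) :
    V.IsIndecomposable ↔ X.IsIndecomposable := by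
  unfold IsIndecomposable TwoTerm.IsIndecomposable
  rw [h.isZero_iff]
  refine and_congr_right fun _ => ⟨fun hV Y Z hYZ => ?_, fun hX V₁ V₂ hV => ?_⟩
  · obtain ⟨V₁, h₁⟩ := exists_corresponds_of_twoTerm Y
    obtain ⟨V₂, h₂⟩ := exists_corresponds_of_twoTerm Z
    rw [← h₁.isZero_iff, ← h₂.isZero_iff]
    exact hV _ _ (h.tauPair_isIsomorphic (h₁.sum_pair h₂) hYZ)
  · obtain ⟨Y, h₁⟩ := V₁.exists_corresponds
    obtain ⟨Z, h₂⟩ := V₂.exists_corresponds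
    rw [h₁.isZero_iff, h₂.isZero_iff]
    exact hX _ _ (h.twoTerm_isIsomorphic (h₁.sum_pair h₂) hV)

end Corresponds

end TauPair

end Correspondence

/-! ### The Auslander–Reiten formula for rigidity -/

section DualBasis

variable {Λ : Type v} [Ring Λ] {P M : Type*} [AddCommGroup P] [Module Λᵐᵒᵖ P] [AddCommGroup M]
  [Module Λᵐᵒᵖ M] {ι : Type*} [Fintype ι]

/-- The finite families `x` in the right module `P` and `φ` in its dual form a dual basis of `P`
in the sense of the dual basis lemma for projective modules. -/
def IsDualBasis (x : ι → P) (φ : ι → P →ₗ[Λᵐᵒᵖ] Λ) : Prop :=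
  ∀ p, ∑ i, op (φ i p) • x i = p

/-- The linear map `p ↦ m · φ(p)` attached to `m : M` and a linear form `φ` on `P`. -/
def rankOne (m : M) (φ : P →ₗ[Λᵐᵒᵖ] Λ) : P →ₗ[Λᵐᵒᵖ] M where
  toFun p := op (φ p) • m
  map_add' p q := by rw [map_add, MulOpposite.op_add, add_smul]
  map_smul' a p := by rw [map_smul, RingHom.id_apply, ← mul_smul]; rfl

theorem IsDualBasis.sum_rankOne {x : ι → P} {φ : ι → P →ₗ[Λᵐᵒᵖ] Λ} (h : IsDualBasis x φ)
    (g : P →ₗ[Λᵐᵒᵖ] M) : ∑ i, rankOne (g (x i)) (φ i) = g := by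
  refine LinearMap.ext fun p => ?_
  conv_rhs => rw [← h p, map_sum]
  rw [LinearMap.sum_apply]
  exact Finset.sum_congr rfl fun i _ => (map_smul g _ _).symm

variable (P) in
theorem exists_isDualBasis [Module.Finite Λᵐᵒᵖ P] [Module.Projective Λᵐᵒᵖ P] :
    ∃ (m : ℕ) (x : Fin m → P) (φ : Fin m → P →ₗ[Λᵐᵒᵖ] Λ), IsDualBasis x φ := by
  obtain ⟨m, π, hπ⟩ := Module.Finite.exists_fin' Λᵐᵒᵖ P
  obtain ⟨s, hs⟩ := Module.projective_lifting_property π LinearMap.id hπ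
  refine ⟨m, fun i => π (Pi.single i 1), fun i =>
    { toFun := fun p => unop (s p i)
      map_add' := fun p q => by rw [map_add]; rfl
      map_smul' := fun a p => by rw [map_smul]; rfl }, fun p => ?_⟩
  have h : π (s p) = p := LinearMap.congr_fun hs p
  conv_rhs => rw [← h, pi_eq_sum_univ' (s p), map_sum]
  exact Finset.sum_congr rfl fun i _ => (map_smul π _ _).symm

end DualBasis

namespace TwoTerm

variable {Λ : Type v} [Ring Λ] {k : Type u} [Field k] [Algebra k Λ] {X : TwoTerm Λ}

/-- The pairing of `τ` with the dual of `P₁`: an element of `X.Tau k` is a linear form on the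
quotient `X.Tr` of that dual. -/
def tauEval : X.Tau k →+ (X.P₁.obj →ₗ[Λᵐᵒᵖ] Λ) →+ k where
  toFun φ := ((show X.Tr →ₗ[k] k from φ) : X.Tr →+ k).comp
    (Submodule.mkQ (LinearMap.range X.dStar)).toAddMonoidHom
  map_zero' := rfl
  map_add' _ _ := rfl

theorem tauEval_op_smul (a : Λ) (φ : X.Tau k) (χ : X.P₁.obj →ₗ[Λᵐᵒᵖ] Λ) :
    tauEval (op a • φ) χ = tauEval φ (a • χ) :=
  rfl

theorem tauEval_comp_d (φ : X.Tau k) (χ : X.P₀.obj →ₗ[Λᵐᵒᵖ] Λ) : tauEval φ (χ ∘ₗ X.d) = 0 :=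
  (congrArg (show X.Tr →ₗ[k] k from φ) ((Submodule.Quotient.mk_eq_zero _).2 ⟨χ, rfl⟩)).trans
    (map_zero _)

theorem tau_ext {φ ψ : X.Tau k} (h : ∀ χ, tauEval φ χ = tauEval ψ χ) : φ = ψ :=
  LinearMap.ext fun t => (Submodule.Quotient.mk_surjective _ t).elim fun χ hχ => hχ ▸ h χ

section ToTau

variable {M : Type*} [AddCommGroup M] [Module Λᵐᵒᵖ M]

theorem tauEval_apply_eq_sum {ι : Type*} [Fintype ι] {y : ι → X.P₁.obj}
    {ψ : ι → X.P₁.obj →ₗ[Λᵐᵒᵖ] Λ} (hψ : IsDualBasis y ψ) (f : M →ₗ[Λᵐᵒᵖ] X.Tau k) (m : M)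
    (χ : X.P₁.obj →ₗ[Λᵐᵒᵖ] Λ) :
    tauEval (f m) χ = ∑ j, tauEval (f (rankOne m χ (y j))) (ψ j) := by
  conv_lhs => rw [← hψ.sum_rankOne χ, map_sum]
  refine Finset.sum_congr rfl fun j _ => ?_
  change tauEval (f m) (χ (y j) • ψ j) = tauEval (f (op (χ (y j)) • m)) (ψ j)
  rw [f.map_smul, tauEval_op_smul]

theorem eq_zero_of_forall_exists_comp_d_eq
    (H : ∀ g : X.P₁.obj →ₗ[Λᵐᵒᵖ] M, ∃ h : X.P₀.obj →ₗ[Λᵐᵒᵖ] M, h ∘ₗ X.d = g)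
    (f : M →ₗ[Λᵐᵒᵖ] X.Tau k) : f = 0 := by
  obtain ⟨_, y, ψ, hψ⟩ := exists_isDualBasis (Λ := Λ) X.P₁.obj
  obtain ⟨_, x, φ, hφ⟩ := exists_isDualBasis (Λ := Λ) X.P₀.obj
  refine LinearMap.ext fun m => tau_ext fun χ => ?_
  obtain ⟨h, hh⟩ := H (rankOne m χ)
  have hrank (p : X.P₁.obj) : rankOne m χ p = ∑ i, rankOne (h (x i)) (φ i ∘ₗ X.d) p := by
    rw [← hh, LinearMap.comp_apply, ← LinearMap.congr_fun (hφ.sum_rankOne h) (X.d p),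
      LinearMap.sum_apply]
    rfl
  calc tauEval (f m) χ
      = ∑ j, ∑ i, tauEval (f (rankOne (h (x i)) (φ i ∘ₗ X.d) (y j))) (ψ j) := by
        rw [tauEval_apply_eq_sum hψ]
        simp only [hrank, map_sum, AddMonoidHom.finsetSum_apply]
    _ = ∑ i, tauEval (f (h (x i))) (φ i ∘ₗ X.d) := by
        simp only [Finset.sum_comm (γ := Fin _), ← tauEval_apply_eq_sum hψ]
    _ = 0 := Finset.sum_eq_zero fun i _ => tauEval_comp_d _ _

variable [Module k M] [IsScalarTower k Λᵐᵒᵖ M]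

/-- The linear map `M ⟶ τ` attached to a linear form `θ` on `Hom(P₁, M)` that vanishes on the maps
factoring through `P₁ ⟶ P₀`, under the isomorphism `Hom(P₁, M) ≅ M ⊗ Hom(P₁, Λ)`. -/
def toTau (θ : (X.P₁.obj →ₗ[Λᵐᵒᵖ] M) →ₗ[k] k)
    (hθ : ∀ h : X.P₀.obj →ₗ[Λᵐᵒᵖ] M, θ (h ∘ₗ X.d) = 0) : M →ₗ[Λᵐᵒᵖ] X.Tau k where
  toFun m := Submodule.liftQ ((LinearMap.range X.dStar).restrictScalars k)
      { toFun := fun φ => θ (rankOne m φ)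
        map_add' := fun φ φ' => (congrArg θ (LinearMap.ext fun p =>
          add_smul (op (φ p)) (op (φ' p)) m)).trans (map_add θ _ _)
        map_smul' := fun c φ => (congrArg θ (LinearMap.ext fun p =>
          smul_assoc c (op (φ p)) m)).trans (map_smul θ c _) }
      (by rintro _ ⟨φ, rfl⟩; exact hθ (rankOne m φ)) ∘ₗ
    (Submodule.Quotient.restrictScalarsEquiv k (LinearMap.range X.dStar)).symm.toLinearMap
  map_add' m m' := tau_ext fun φ => (congrArg θ (LinearMap.ext fun p =>
    smul_add (op (φ p)) m m')).trans (map_add θ (rankOne m φ) (rankOne m' φ))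
  map_smul' a m := tau_ext fun φ => congrArg θ (LinearMap.ext fun p =>
    (mul_smul (op (φ p)) a m).symm)

theorem tauEval_toTau (θ : (X.P₁.obj →ₗ[Λᵐᵒᵖ] M) →ₗ[k] k)
    (hθ : ∀ h : X.P₀.obj →ₗ[Λᵐᵒᵖ] M, θ (h ∘ₗ X.d) = 0) (m : M) (φ : X.P₁.obj →ₗ[Λᵐᵒᵖ] Λ) :
    tauEval (toTau θ hθ m) φ = θ (rankOne m φ) :=
  rfl

end ToTau

theorem exists_comp_d_eq_of_forall_hom_tau_eq_zero {M : Type*} [AddCommGroup M] [Module Λᵐᵒᵖ M]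
    (H : ∀ f : M →ₗ[Λᵐᵒᵖ] X.Tau k, f = 0) (g : X.P₁.obj →ₗ[Λᵐᵒᵖ] M) :
    ∃ h : X.P₀.obj →ₗ[Λᵐᵒᵖ] M, h ∘ₗ X.d = g := by
  let _ : Module k M := Module.compHom M (algebraMap k Λᵐᵒᵖ)
  have : IsScalarTower k Λᵐᵒᵖ M := IsScalarTower.of_algebraMap_smul fun _ _ => rfl
  let precompD : (X.P₀.obj →ₗ[Λᵐᵒᵖ] M) →ₗ[k] (X.P₁.obj →ₗ[Λᵐᵒᵖ] M) :=
    { toFun := fun h => h ∘ₗ X.d, map_add' := fun _ _ => rfl, map_smul' := fun _ _ => rfl }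
  by_contra hg
  have hgd : g ∉ LinearMap.range precompD := hg
  obtain ⟨θ, hθg, hθd⟩ := Submodule.exists_le_ker_of_notMem hgd
  obtain ⟨_, y, ψ, hψ⟩ := exists_isDualBasis (Λ := Λ) X.P₁.obj
  have hθ (m : M) (φ : X.P₁.obj →ₗ[Λᵐᵒᵖ] Λ) : θ (rankOne m φ) = 0 := by
    have hF := H (toTau θ fun h => hθd ⟨h, rfl⟩)
    rw [← tauEval_toTau θ fun h => hθd ⟨h, rfl⟩, hF, LinearMap.zero_apply, map_zero]
    rfl
  refine hθg ?_
  rw [← hψ.sum_rankOne g, map_sum]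
  exact Finset.sum_eq_zero fun j _ => hθ _ _

variable (k) in
theorem forall_hom_tau_eq_zero_iff (X : TwoTerm Λ) (M : Type*) [AddCommGroup M]
    [Module Λᵐᵒᵖ M] : (∀ f : M →ₗ[Λᵐᵒᵖ] X.Tau k, f = 0) ↔
      ∀ g : X.P₁.obj →ₗ[Λᵐᵒᵖ] M, ∃ h : X.P₀.obj →ₗ[Λᵐᵒᵖ] M, h ∘ₗ X.d = g :=
  ⟨exists_comp_d_eq_of_forall_hom_tau_eq_zero, eq_zero_of_forall_exists_comp_d_eq⟩

end TwoTerm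

namespace TwoTerm

variable {Λ : Type v} [Ring Λ] {Y : TwoTerm Λ} {M : Type*} [AddCommGroup M] [Module Λᵐᵒᵖ M]
  {π : Y.P₀.obj →ₗ[Λᵐᵒᵖ] M}

theorem extVanishes_iff_forall_exists_comp_d_eq (hπ : Function.Surjective π)
    (hY : LinearMap.range Y.d = LinearMap.ker π) (X : TwoTerm Λ) : X.ExtVanishes Y ↔
      ∀ g : X.P₁.obj →ₗ[Λᵐᵒᵖ] M, ∃ h : X.P₀.obj →ₗ[Λᵐᵒᵖ] M, h ∘ₗ X.d = g := by
  have hπd (x : Y.P₁.obj) : π (Y.d x) = 0 := hY.le ⟨x, rfl⟩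
  constructor
  · intro H g
    obtain ⟨f, rfl⟩ := Module.projective_lifting_property π g hπ
    obtain ⟨h₁, h₀, rfl⟩ := H f
    refine ⟨π ∘ₗ h₀, LinearMap.ext fun x => ?_⟩
    change π (h₀ (X.d x)) = π (Y.d (h₁ x) + h₀ (X.d x))
    rw [map_add, hπd, zero_add]
  · intro H f
    obtain ⟨u, hu⟩ := H (π ∘ₗ f)
    obtain ⟨h₀, rfl⟩ := Module.projective_lifting_property π u hπ
    have hrange : LinearMap.range (f - h₀ ∘ₗ X.d) ≤ LinearMap.range Y.d := by
      rintro _ ⟨x, rfl⟩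
      rw [hY, LinearMap.mem_ker, LinearMap.sub_apply, map_sub, sub_eq_zero]
      exact (LinearMap.congr_fun hu x).symm
    obtain ⟨h₁, hh₁⟩ := exists_comp_eq_of_range_le Y.d (f - h₀ ∘ₗ X.d) hrange
    exact ⟨h₁, h₀, by rw [hh₁, sub_add_cancel]⟩

theorem forall_exists_comp_addShift_d_eq_iff (P : ProjCat Λ) :
    (∀ g : (Y.addShift P).P₁.obj →ₗ[Λᵐᵒᵖ] M,
        ∃ h : Y.P₀.obj →ₗ[Λᵐᵒᵖ] M, h ∘ₗ (Y.addShift P).d = g) ↔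
      (∀ g : Y.P₁.obj →ₗ[Λᵐᵒᵖ] M, ∃ h : Y.P₀.obj →ₗ[Λᵐᵒᵖ] M, h ∘ₗ Y.d = g) ∧
      ∀ f : P.obj →ₗ[Λᵐᵒᵖ] M, f = 0 := by
  constructor
  · refine fun H => ⟨fun g => ?_, fun f => LinearMap.ext fun x => ?_⟩
    · obtain ⟨h, hh⟩ := H (g ∘ₗ LinearMap.fst Λᵐᵒᵖ Y.P₁.obj P.obj)
      exact ⟨h, LinearMap.ext fun x => LinearMap.congr_fun hh (x, (0 : P.obj))⟩
    · obtain ⟨h, hh⟩ := H (f ∘ₗ LinearMap.snd Λᵐᵒᵖ Y.P₁.obj P.obj)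
      have hx : h (Y.d 0) = f x := LinearMap.congr_fun hh ((0 : Y.P₁.obj), x)
      rw [← hx, map_zero, map_zero, LinearMap.zero_apply]
  · rintro ⟨H₁, H₂⟩ (g : Y.P₁.obj × P.obj →ₗ[Λᵐᵒᵖ] M)
    obtain ⟨h, hh⟩ := H₁ (g ∘ₗ LinearMap.inl Λᵐᵒᵖ Y.P₁.obj P.obj)
    refine ⟨h, (LinearMap.prod_ext (f := (h ∘ₗ Y.d) ∘ₗ LinearMap.fst Λᵐᵒᵖ Y.P₁.obj P.obj)
      (g := g) hh ?_)⟩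
    rw [H₂ (g ∘ₗ LinearMap.inr Λᵐᵒᵖ Y.P₁.obj P.obj), LinearMap.comp_assoc, LinearMap.fst_comp_inr,
      LinearMap.comp_zero]

theorem isRigid_addShift_iff (hπ : Function.Surjective π)
    (hY : LinearMap.range Y.d = LinearMap.ker π) (P : ProjCat Λ) : (Y.addShift P).IsRigid ↔
      (∀ g : Y.P₁.obj →ₗ[Λᵐᵒᵖ] M, ∃ h : Y.P₀.obj →ₗ[Λᵐᵒᵖ] M, h ∘ₗ Y.d = g) ∧
      ∀ f : P.obj →ₗ[Λᵐᵒᵖ] M, f = 0 := by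
  rw [isRigid_iff_extVanishes, extVanishes_iff_forall_exists_comp_d_eq (Y := Y.addShift P) hπ
    ((range_addShift_d Y P).trans hY), ← forall_exists_comp_addShift_d_eq_iff]

end TwoTerm

theorem TauPair.Corresponds.isRigid_iff {Λ : Type v} [Ring Λ] (k : Type u) [Field k] [Algebra k Λ]
    [IsArtinianRing Λᵐᵒᵖ] {V : TauPair Λ} {X : TwoTerm Λ} (h : V.Corresponds X) :
    V.IsRigid k ↔ X.IsRigid := by
  have isRigid_addShift {Y : TwoTerm Λ} {π : Y.P₀.obj →ₗ[Λᵐᵒᵖ] V.M}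
      (hY : IsMinimalPresentation Y π) : (Y.addShift V.P).IsRigid ↔
        (∀ f : V.M →ₗ[Λᵐᵒᵖ] Y.Tau k, f = 0) ∧ ∀ f : V.P.obj →ₗ[Λᵐᵒᵖ] V.M, f = 0 := by
    rw [TwoTerm.isRigid_addShift_iff hY.surjective hY.exact, TwoTerm.forall_hom_tau_eq_zero_iff]
  constructor
  · rintro ⟨⟨Y, π, hY, hτ⟩, hP⟩
    have h' : V.Corresponds (Y.addShift V.P) := ⟨Y, π, hY, .refl _⟩
    rw [(h.twoTerm_isIsomorphic h' ⟨⟨.refl _ _⟩, ⟨.refl _ _⟩⟩).isRigid_iff, isRigid_addShift hY]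
    exact ⟨hτ, hP⟩
  · intro hX
    obtain ⟨Y, π, hY, hXY⟩ := h
    rw [hXY.isRigid_iff, isRigid_addShift hY] at hX
    exact ⟨⟨Y, π, hY, hX.1⟩, hX.2⟩

theorem exists_equiv_of_biUnique_of_biTotal {V W : Type*} {R : V → W → Prop}
    (huniq : Relator.BiUnique R) (htot : Relator.BiTotal R) :
    ∃ φ : V ≃ W, ∀ x, R x (φ x) := by
  choose f hf using htot.1
  refine ⟨.ofBijective f ⟨fun x x' h => huniq.1 (hf x) (h ▸ hf x'), fun y => ?_⟩, hf⟩
  obtain ⟨x, hx⟩ := htot.2 y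
  exact ⟨x, huniq.2 (hf x) hx⟩

section TauTilting

variable {Λ : Type v} [Ring Λ] {k : Type u} [Field k] [Algebra k Λ]

namespace TauVertex

/-- The class of an indecomposable `τ`-rigid pair. -/
def mk (V : TauPair Λ) (h : V.IsIndecomposable) (h' : V.IsRigid k) : TauVertex Λ k :=
  Quotient.mk (tauSetoid Λ k) ⟨V, h, h'⟩

theorem rep_mk {V : TauPair Λ} (h : V.IsIndecomposable) (h' : V.IsRigid k) :
    (mk V h h').rep.IsIsomorphic V :=
  Quotient.mk_out (s := tauSetoid Λ k) ⟨V, h, h'⟩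

theorem isIndecomposable_rep (x : TauVertex Λ k) : x.rep.IsIndecomposable :=
  (Quotient.out (s := tauSetoid Λ k) x).2.1

theorem isRigid_rep (x : TauVertex Λ k) : x.rep.IsRigid k :=
  (Quotient.out (s := tauSetoid Λ k) x).2.2

theorem ext {x y : TauVertex Λ k} (h : x.rep.IsIsomorphic y.rep) : x = y :=
  Quotient.out_equiv_out.1 h

end TauVertex

variable (Λ k) in
theorem exists_tauVertex_equiv_siltingVertex [IsArtinianRing Λᵐᵒᵖ] :
    ∃ φ : TauVertex Λ k ≃ SiltingVertex Λ, ∀ x : TauVertex Λ k, x.rep.Corresponds (φ x).rep := by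
  refine exists_equiv_of_biUnique_of_biTotal
    (R := fun (x : TauVertex Λ k) (y : SiltingVertex Λ) => x.rep.Corresponds y.rep)
    ⟨fun x x' y hx hx' => TauVertex.ext (hx.tauPair_isIsomorphic hx' (.refl _)),
      fun x y y' hy hy' => SiltingVertex.ext
        (hy.twoTerm_isIsomorphic hy' ⟨⟨.refl _ _⟩, ⟨.refl _ _⟩⟩)⟩
    ⟨fun x => ?_, fun y => ?_⟩
  · obtain ⟨X, hX⟩ := x.rep.exists_corresponds
    exact ⟨.mk X (hX.isIndecomposable_iff.1 x.isIndecomposable_rep)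
      ((hX.isRigid_iff k).1 x.isRigid_rep), hX.of_isIsomorphic (SiltingVertex.rep_mk _ _).symm⟩
  · obtain ⟨V, hV⟩ := TauPair.exists_corresponds_of_twoTerm y.rep
    let x : TauVertex Λ k := .mk V (hV.isIndecomposable_iff.2 y.isIndecomposable_rep)
      ((hV.isRigid_iff k).2 y.isRigid_rep)
    obtain ⟨X, hX⟩ := x.rep.exists_corresponds
    exact ⟨x, hX.of_isIsomorphic (hX.twoTerm_isIsomorphic hV (TauVertex.rep_mk _ _))⟩

theorem isFlagComplexOf_tauTiltingComplex [Module.Finite k Λ]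
    {f : TauVertex Λ k → SiltingVertex Λ} (hf : ∀ x : TauVertex Λ k, x.rep.Corresponds (f x).rep) :
    IsFlagComplexOf (tauTiltingComplex Λ k) fun x y => (f x).Compatible (f y) := by
  have := isArtinianRing_op (Λ := Λ) k
  intro F
  change F.Nonempty ∧ TauPair.IsRigid k _ ↔ _
  rw [(TauPair.Corresponds.sum fun i => hf (F.equivFin.symm i).1).isRigid_iff k,
    TwoTerm.isRigid_sum_iff, ← forall_equivFin_symm]
  rfl

variable (Λ k) in
theorem exists_tauVertex_equiv_mem_faces_iff [Module.Finite k Λ] :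
    ∃ φ : TauVertex Λ k ≃ SiltingVertex Λ, (∀ x : TauVertex Λ k, x.rep.Corresponds (φ x).rep) ∧
      ∀ F, F ∈ (tauTiltingComplex Λ k).faces ↔ F.map φ.toEmbedding ∈ (siltingComplex Λ).faces := by
  have := isArtinianRing_op (Λ := Λ) k
  obtain ⟨φ, hφ⟩ := exists_tauVertex_equiv_siltingVertex Λ k
  exact ⟨φ, hφ, (isFlagComplexOf_tauTiltingComplex hφ).mem_faces_iff_map_mem_faces
    (isFlagComplexOf_siltingComplex Λ) φ fun _ _ => Iff.rfl⟩

end TauTilting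

/-! ### The corner of a module -/

section CornerPart

variable {Λ : Type v} [Ring Λ] {ε : Λ}

/-- The part `M ε` of a right module `M`, for an idempotent `ε`, encoded as the set of elements
fixed by `ε`. -/
def cornerPart (ε : Λ) (M : Type*) [AddCommGroup M] [Module Λᵐᵒᵖ M] : AddSubgroup M where
  carrier := {m | op ε • m = m}
  zero_mem' := smul_zero _
  add_mem' {a b} ha hb := (smul_add _ a b).trans (congrArg₂ (· + ·) ha hb)
  neg_mem' {a} ha := (smul_neg _ a).trans (congrArg (- ·) ha)

variable {M N L : Type*} [AddCommGroup M] [Module Λᵐᵒᵖ M] [AddCommGroup N] [Module Λᵐᵒᵖ N]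
  [AddCommGroup L] [Module Λᵐᵒᵖ L]

theorem mem_cornerPart {m : M} : m ∈ cornerPart ε M ↔ op ε • m = m :=
  Iff.rfl

theorem op_smul_cornerPart (m : cornerPart ε M) : op ε • m.1 = m.1 :=
  m.2

theorem map_mem_cornerPart (f : M →ₗ[Λᵐᵒᵖ] N) {m : M} (hm : m ∈ cornerPart ε M) :
    f m ∈ cornerPart ε N := by
  rw [mem_cornerPart, ← map_smul, mem_cornerPart.1 hm]

theorem op_smul_mem_cornerPart (hε : IsIdempotentElem ε) (m : M) :
    op ε • m ∈ cornerPart ε M := by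
  rw [mem_cornerPart, ← mul_smul, ← op_mul, hε]

section Module

variable (hε : IsIdempotentElem ε)

theorem mul_corner (b : hε.Corner) : ε * b.1 = b.1 :=
  ((Subsemigroup.mem_corner_iff hε).1 b.2).1

theorem corner_mul (b : hε.Corner) : b.1 * ε = b.1 :=
  ((Subsemigroup.mem_corner_iff hε).1 b.2).2

/-- An element `a` with `ε a = a = a ε`, as an element of the corner ring `ε Λ ε`. -/
def cornerMk (a : Λ) (hleft : ε * a = a) (hright : a * ε = a) : hε.Corner :=
  ⟨a, (Subsemigroup.mem_corner_iff hε).2 ⟨hleft, hright⟩⟩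

/-- The inclusion of the corner ring `ε Λ ε` in `Λ`. It is not unital. -/
def cornerVal : hε.Corner →+ Λ where
  toFun b := b.1
  map_zero' := rfl
  map_add' _ _ := rfl

/-- The right module structure of `M ε` over `ε Λ ε`. -/
instance cornerPartModule : Module hε.Cornerᵐᵒᵖ (cornerPart ε M) where
  smul b m := ⟨op b.unop.1 • m.1, by
    rw [mem_cornerPart, ← mul_smul, ← op_mul, corner_mul]⟩
  one_smul m := Subtype.ext m.2
  mul_smul a b m := Subtype.ext (mul_smul (op a.unop.1) (op b.unop.1) m.1)
  smul_zero b := Subtype.ext (smul_zero (op b.unop.1))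
  smul_add b m n := Subtype.ext (smul_add (op b.unop.1) m.1 n.1)
  add_smul a b m := Subtype.ext (add_smul (op a.unop.1) (op b.unop.1) m.1)
  zero_smul m := Subtype.ext (zero_smul Λᵐᵒᵖ m.1)

/-- The restriction `M ε ⟶ N ε` of a linear map `M ⟶ N`. -/
def cornerHom (f : M →ₗ[Λᵐᵒᵖ] N) : cornerPart ε M →ₗ[hε.Cornerᵐᵒᵖ] cornerPart ε N where
  toFun m := ⟨f m.1, map_mem_cornerPart f m.2⟩
  map_add' m n := Subtype.ext (map_add f m.1 n.1)
  map_smul' b m := Subtype.ext (map_smul f (op b.unop.1) m.1)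

theorem coe_cornerHom (f : M →ₗ[Λᵐᵒᵖ] N) (m : cornerPart ε M) :
    (cornerHom hε f m : N) = f m.1 :=
  rfl

theorem cornerHom_comp (g : N →ₗ[Λᵐᵒᵖ] L) (f : M →ₗ[Λᵐᵒᵖ] N) :
    cornerHom hε (g ∘ₗ f) = cornerHom hε g ∘ₗ cornerHom hε f :=
  rfl

/-- The restriction `M ε ⟶ ε Λ ε` of a linear form `φ` on `M` with values in `ε Λ`. -/
def cornerForm (φ : M →ₗ[Λᵐᵒᵖ] Λ) (hφ : ∀ m, ε * φ m = φ m) :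
    cornerPart ε M →ₗ[hε.Cornerᵐᵒᵖ] hε.Corner where
  toFun m := cornerMk hε (φ m.1) (hφ m.1) <|
    (map_smul φ (op ε) m.1).symm.trans (congrArg φ m.2)
  map_add' m n := Subtype.ext (map_add φ m.1 n.1)
  map_smul' b m := Subtype.ext (map_smul φ (op b.unop.1) m.1)

theorem isDualBasis_cornerForm {ι : Type*} [Fintype ι] {x : ι → cornerPart ε M}
    {φ : ι → M →ₗ[Λᵐᵒᵖ] Λ} (hφ : ∀ i m, ε * φ i m = φ i m)
    (hx : IsDualBasis (fun i => (x i : M)) φ) :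
    IsDualBasis x fun i => cornerForm hε (φ i) (hφ i) := fun p => by
  refine Subtype.ext ?_
  rw [AddSubgroup.val_finsetSum]
  exact hx p.1

end Module

end CornerPart

/-- The right module `M` is generated by its part `M ε`; for projective modules over a
finite-dimensional algebra this says that `M` is a direct sum of summands of `ε Λ`. -/
def IsGeneratedBy {Λ : Type v} [Ring Λ] (ε : Λ) (M : Type*) [AddCommGroup M] [Module Λᵐᵒᵖ M] :
    Prop :=
  Submodule.span Λᵐᵒᵖ (cornerPart ε M : Set M) = ⊤

namespace IsGeneratedBy

variable {Λ : Type v} [Ring Λ] {ε : Λ} {M N : Type*} [AddCommGroup M] [Module Λᵐᵒᵖ M]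
  [AddCommGroup N] [Module Λᵐᵒᵖ N]

theorem range_le_span_cornerPart (h : IsGeneratedBy ε M) (f : M →ₗ[Λᵐᵒᵖ] N) :
    LinearMap.range f ≤ Submodule.span Λᵐᵒᵖ (cornerPart ε N : Set N) := by
  rw [LinearMap.range_eq_map, ← h, Submodule.map_span]
  refine Submodule.span_mono ?_
  rintro _ ⟨m, hm, rfl⟩
  exact map_mem_cornerPart f hm

theorem map (h : IsGeneratedBy ε M) {f : M →ₗ[Λᵐᵒᵖ] N} (hf : Function.Surjective f) :
    IsGeneratedBy ε N :=
  eq_top_iff.2 ((LinearMap.range_eq_top.2 hf).ge.trans (h.range_le_span_cornerPart f))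

theorem pi {ι : Type*} [Finite ι] {A : ι → Type*} [∀ i, AddCommGroup (A i)]
    [∀ i, Module Λᵐᵒᵖ (A i)] (h : ∀ i, IsGeneratedBy ε (A i)) : IsGeneratedBy ε (∀ i, A i) := by
  classical
  have := Fintype.ofFinite ι
  refine eq_top_iff.2 fun x _ => ?_
  rw [← LinearMap.sum_single_apply A x]
  exact Submodule.sum_mem _ fun i _ =>
    (h i).range_le_span_cornerPart (LinearMap.single Λᵐᵒᵖ A i) ⟨x i, rfl⟩

theorem hom_ext (hε : IsIdempotentElem ε) (h : IsGeneratedBy ε M) {f g : M →ₗ[Λᵐᵒᵖ] N}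
    (hfg : cornerHom hε f = cornerHom hε g) : f = g :=
  LinearMap.ext_on h fun m hm => congrArg Subtype.val (LinearMap.congr_fun hfg ⟨m, hm⟩)

variable {P : Type*} [AddCommGroup P] [Module Λᵐᵒᵖ P] [Module.Finite Λᵐᵒᵖ P]
  [Module.Projective Λᵐᵒᵖ P]

theorem exists_isDualBasis (h : IsGeneratedBy ε P) (hε : IsIdempotentElem ε) :
    ∃ (S : Finset P) (x : S → cornerPart ε P) (φ : S → P →ₗ[Λᵐᵒᵖ] Λ),
      (∀ i p, ε * φ i p = φ i p) ∧ IsDualBasis (fun i => (x i : P)) φ := by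
  have hfg : (Submodule.span Λᵐᵒᵖ (cornerPart ε P : Set P)).FG := by
    rw [show Submodule.span Λᵐᵒᵖ (cornerPart ε P : Set P) = ⊤ from h]
    exact Module.Finite.fg_top
  obtain ⟨S, hS, hspan⟩ := (Submodule.fg_span_iff_fg_span_finset_subset _).1 hfg
  have hsurj : Function.Surjective (Fintype.linearCombination Λᵐᵒᵖ (fun s : S => (s : P))) := by
    rw [← LinearMap.range_eq_top, Fintype.range_linearCombination, Subtype.range_coe_subtype]
    exact hspan.symm.trans h
  obtain ⟨s, hs⟩ := Module.projective_lifting_property _ LinearMap.id hsurj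
  refine ⟨S, fun i => ⟨i.1, hS i.2⟩, fun i =>
    { toFun := fun p => ε * unop (s p i)
      map_add' := fun p q => by rw [map_add, Pi.add_apply, MulOpposite.unop_add, mul_add]
      map_smul' := fun a p => by
        rw [map_smul, Pi.smul_apply, smul_eq_mul, unop_mul, ← mul_assoc]
        rfl }, fun i p => ?_, fun p => ?_⟩
  · exact (mul_assoc _ _ _).symm.trans (congrArg (· * _) hε)
  · have hp : Fintype.linearCombination Λᵐᵒᵖ (fun s : S => (s : P)) (s p) = p :=
      LinearMap.congr_fun hs p
    conv_rhs => rw [← hp, Fintype.linearCombination_apply]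
    refine Finset.sum_congr rfl fun i _ => ?_
    change op (ε * unop (s p i)) • i.1 = s p i • i.1
    rw [op_mul, op_unop, mul_smul, mem_cornerPart.1 (hS i.2)]

theorem cornerHom_bijective (hε : IsIdempotentElem ε) (h : IsGeneratedBy ε P) :
    Function.Bijective (cornerHom hε : (P →ₗ[Λᵐᵒᵖ] N) → _) := by
  refine ⟨fun f g hfg => h.hom_ext hε hfg, fun u => ?_⟩
  obtain ⟨S, x, φ, hφ, hx⟩ := h.exists_isDualBasis hε
  refine ⟨∑ i, rankOne (u (x i) : N) (φ i), LinearMap.ext fun p => Subtype.ext ?_⟩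
  conv_rhs => rw [← (isDualBasis_cornerForm hε hφ hx).sum_rankOne u]
  rw [coe_cornerHom, LinearMap.sum_apply, LinearMap.sum_apply, AddSubgroup.val_finsetSum]
  rfl

end IsGeneratedBy

namespace IsDualBasis

variable {Λ : Type v} [Ring Λ] {Q : Type*} [AddCommGroup Q] [Module Λᵐᵒᵖ Q] {ι : Type*}
  [Fintype ι] {x : ι → Q} {φ : ι → Q →ₗ[Λᵐᵒᵖ] Λ}

theorem finite (h : IsDualBasis x φ) : Module.Finite Λᵐᵒᵖ Q :=
  .of_surjective (Fintype.linearCombination Λᵐᵒᵖ x) fun q => ⟨fun i => op (φ i q), h q⟩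

theorem projective (h : IsDualBasis x φ) : Module.Projective Λᵐᵒᵖ Q :=
  .of_split
    { toFun := fun q i => op (φ i q)
      map_add' := fun p q => funext fun i => by rw [map_add]; rfl
      map_smul' := fun a q => funext fun i => by rw [map_smul]; rfl }
    (Fintype.linearCombination Λᵐᵒᵖ x) (LinearMap.ext h)

end IsDualBasis

section FixedVectors

variable {Λ : Type v} [Ring Λ] {ι : Type*} [Fintype ι]

/-- The right module of column vectors fixed by a square matrix. For an idempotent matrix this is
its image, a finitely generated projective module. -/
def fixedVectors (A : Matrix ι ι Λ) : Submodule Λᵐᵒᵖ (ι → Λ) where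
  carrier := {x | A.mulVec x = x}
  zero_mem' := A.mulVec_zero
  add_mem' {x y} hx hy := (A.mulVec_add x y).trans (congrArg₂ (· + ·) hx hy)
  smul_mem' c x hx := (A.mulVec_smul c x).trans (congrArg (c • ·) hx)

variable {A : Matrix ι ι Λ}

/-- The columns of an idempotent matrix. -/
def fixedVectorsCol (hA : IsIdempotentElem A) (j : ι) : fixedVectors A :=
  ⟨A.col j, funext fun i => congrFun (congrFun hA i) j⟩

theorem isDualBasis_fixedVectorsCol (hA : IsIdempotentElem A) :
    IsDualBasis (fixedVectorsCol hA) fun j =>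
      LinearMap.proj (φ := fun _ : ι => Λ) j ∘ₗ (fixedVectors A).subtype := fun x => by
  refine Subtype.ext (funext fun i => ?_)
  rw [Submodule.coe_sum, Finset.sum_apply]
  exact congrFun x.2 i

theorem isGeneratedBy_fixedVectors (hA : IsIdempotentElem A) {ε : Λ}
    (hε : ∀ i j, A i j * ε = A i j) :
    IsGeneratedBy ε (fixedVectors A) := by
  refine eq_top_iff.2 fun x _ => ?_
  rw [← isDualBasis_fixedVectorsCol hA x]
  refine Submodule.sum_mem _ fun j _ => Submodule.smul_mem _ _ (Submodule.subset_span ?_)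
  exact Subtype.ext (funext fun i => hε i j)

end FixedVectors

section CornerProjective

variable {Λ : Type v} [Ring Λ] {ε : Λ} (hε : IsIdempotentElem ε)

theorem IsGeneratedBy.finite_projective {P : Type*} [AddCommGroup P] [Module Λᵐᵒᵖ P]
    [Module.Finite Λᵐᵒᵖ P] [Module.Projective Λᵐᵒᵖ P] (h : IsGeneratedBy ε P) :
    Module.Finite hε.Cornerᵐᵒᵖ (cornerPart ε P) ∧
      Module.Projective hε.Cornerᵐᵒᵖ (cornerPart ε P) := by
  obtain ⟨S, x, φ, hφ, hx⟩ := h.exists_isDualBasis hε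
  have hbasis := isDualBasis_cornerForm hε hφ hx
  exact ⟨hbasis.finite, hbasis.projective⟩

variable {Q : Type*} [AddCommGroup Q] [Module hε.Cornerᵐᵒᵖ Q] {ι : Type*} [Fintype ι]

/-- The matrix over `Λ` of the projection attached to a dual basis of a module over `ε Λ ε`. -/
def gramMatrix (y : ι → Q) (ψ : ι → Q →ₗ[hε.Cornerᵐᵒᵖ] hε.Corner) : Matrix ι ι Λ :=
  .of fun i j => (ψ i (y j)).1

variable {y : ι → Q} {ψ : ι → Q →ₗ[hε.Cornerᵐᵒᵖ] hε.Corner}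

theorem gramMatrix_mulVec (h : IsDualBasis y ψ) (q : Q) :
    (gramMatrix hε y ψ).mulVec (fun j => (ψ j q).1) = fun i => (ψ i q).1 := funext fun i => by
  have hq : ∑ j, ψ i (y j) * ψ j q = ψ i q := by
    conv_rhs => rw [← h q, map_sum]
    exact Finset.sum_congr rfl fun j _ => (map_smul (ψ i) _ _).symm
  exact ((congrArg (cornerVal hε) hq).symm.trans (map_sum (cornerVal hε) _ _)).symm

theorem isIdempotentElem_gramMatrix (h : IsDualBasis y ψ) :
    IsIdempotentElem (gramMatrix hε y ψ) :=
  Matrix.ext fun i j => congrFun (gramMatrix_mulVec hε h (y j)) i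

/-- The coordinate map of a module over `ε Λ ε` with a dual basis into the `ε`-part of the
projective `Λ`-module defined by the matrix of the dual basis. -/
def toFixedVectors (h : IsDualBasis y ψ) :
    Q →ₗ[hε.Cornerᵐᵒᵖ] cornerPart ε (fixedVectors (gramMatrix hε y ψ)) where
  toFun q := ⟨⟨fun i => (ψ i q).1, gramMatrix_mulVec hε h q⟩,
    Subtype.ext (funext fun i => corner_mul hε (ψ i q))⟩
  map_add' p q := Subtype.ext (Subtype.ext (funext fun i =>
    congrArg (cornerVal hε) (map_add (ψ i) p q)))
  map_smul' b q := Subtype.ext (Subtype.ext (funext fun i =>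
    congrArg (cornerVal hε) (map_smul (ψ i) b q)))

theorem toFixedVectors_apply (h : IsDualBasis y ψ) (q : Q) (i : ι) :
    (toFixedVectors hε h q).1.1 i = (ψ i q).1 :=
  rfl

theorem toFixedVectors_injective (h : IsDualBasis y ψ) :
    Function.Injective (toFixedVectors hε h) := by
  rw [injective_iff_map_eq_zero]
  intro q hq
  rw [← h q]
  refine Finset.sum_eq_zero fun i _ => ?_
  have hi : ψ i q = 0 := Subtype.ext (by rw [← toFixedVectors_apply hε h, hq]; rfl)
  rw [hi]
  exact zero_smul hε.Cornerᵐᵒᵖ (y i)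

theorem toFixedVectors_surjective (h : IsDualBasis y ψ) :
    Function.Surjective (toFixedVectors hε h) := by
  intro x
  have hfix (i : ι) : ∑ j, (ψ i (y j)).1 * x.1.1 j = x.1.1 i := congrFun x.1.2 i
  have hright (j : ι) : x.1.1 j * ε = x.1.1 j :=
    congrFun (congrArg Subtype.val (op_smul_cornerPart x)) j
  have hleft (j : ι) : ε * x.1.1 j = x.1.1 j := by
    rw [← hfix j, Finset.mul_sum]
    exact Finset.sum_congr rfl fun l _ => by rw [← mul_assoc, mul_corner]
  let b (j : ι) : hε.Corner := cornerMk hε (x.1.1 j) (hleft j) (hright j)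
  refine ⟨∑ j, op (b j) • y j, Subtype.ext (Subtype.ext (funext fun i => ?_))⟩
  have hsum : ∑ j, ψ i (op (b j) • y j) = ∑ j, ψ i (y j) * b j :=
    Finset.sum_congr rfl fun j _ => map_smul _ _ _
  rw [toFixedVectors_apply, map_sum, ← hfix i, hsum]
  exact map_sum (cornerVal hε) _ _

theorem exists_cornerPart_equiv (Q : ProjCat hε.Corner) : ∃ P : ProjCat Λ,
    IsGeneratedBy ε P.obj ∧ Nonempty (Q.obj ≃ₗ[hε.Cornerᵐᵒᵖ] cornerPart ε P.obj) := by
  obtain ⟨m, y, ψ, h⟩ := exists_isDualBasis (Λ := hε.Corner) Q.obj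
  have hA := isIdempotentElem_gramMatrix hε h
  have hbasis := isDualBasis_fixedVectorsCol hA
  exact ⟨⟨ModuleCat.of Λᵐᵒᵖ (fixedVectors (gramMatrix hε y ψ)), hbasis.finite, hbasis.projective⟩,
    isGeneratedBy_fixedVectors hA fun i j => corner_mul hε (ψ i (y j)),
    ⟨.ofBijective (toFixedVectors hε h)
      ⟨toFixedVectors_injective hε h, toFixedVectors_surjective hε h⟩⟩⟩

end CornerProjective

/-! ### 2-term objects over the corner -/

section Corner

variable {Λ : Type v} [Ring Λ] {ε : Λ}

/-- The `ε`-part of a product is the product of the `ε`-parts. -/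
def cornerPartPi (hε : IsIdempotentElem ε) {ι : Type*} (A : ι → Type*)
    [∀ i, AddCommGroup (A i)] [∀ i, Module Λᵐᵒᵖ (A i)] :
    cornerPart ε (∀ i, A i) ≃ₗ[hε.Cornerᵐᵒᵖ] ∀ i, cornerPart ε (A i) where
  toFun x i := ⟨x.1 i, congrFun (op_smul_cornerPart x) i⟩
  invFun x := ⟨fun i => (x i).1, funext fun i => op_smul_cornerPart (x i)⟩
  map_add' _ _ := rfl
  map_smul' _ _ := rfl
  left_inv _ := rfl
  right_inv _ := rfl

theorem IsGeneratedBy.hom_eq_zero {M S : Type*} [AddCommGroup M]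
    [Module Λᵐᵒᵖ M] [AddCommGroup S] [Module Λᵐᵒᵖ S] (h : IsGeneratedBy ε M)
    (hS : ∀ s : S, op ε • s = 0) (f : M →ₗ[Λᵐᵒᵖ] S) : f = 0 := by
  refine LinearMap.ext_on h fun m hm => ?_
  rw [← mem_cornerPart.1 hm, map_smul, hS, LinearMap.zero_apply]

theorem isGeneratedBy_of_forall_simple_hom_eq_zero (hε : IsIdempotentElem ε) {M : Type v}
    [AddCommGroup M] [Module Λᵐᵒᵖ M] [Module.Finite Λᵐᵒᵖ M]
    (h : ∀ (S : Type v) [AddCommGroup S] [Module Λᵐᵒᵖ S] [IsSimpleModule Λᵐᵒᵖ S],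
      (∀ s : S, op ε • s = 0) → ∀ f : M →ₗ[Λᵐᵒᵖ] S, f = 0) : IsGeneratedBy ε M := by
  by_contra hne
  obtain ⟨N, hN, hle⟩ := (eq_top_or_exists_le_coatom
    (Submodule.span Λᵐᵒᵖ (cornerPart ε M : Set M))).resolve_left hne
  have : IsSimpleModule Λᵐᵒᵖ (M ⧸ N) := isSimpleModule_iff_isCoatom.2 hN
  have hS (s : M ⧸ N) : op ε • s = 0 := by
    obtain ⟨m, rfl⟩ := N.mkQ_surjective s
    rw [← map_smul, ← LinearMap.mem_ker, Submodule.ker_mkQ]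
    exact hle (Submodule.subset_span (op_smul_mem_cornerPart hε m))
  apply hN.1
  rw [← Submodule.ker_mkQ N, h (M ⧸ N) hS N.mkQ, LinearMap.ker_zero]

/-- The `ε`-part of a projective module generated by it. -/
abbrev ProjCat.corner (hε : IsIdempotentElem ε) (P : ProjCat Λ) (h : IsGeneratedBy ε P.obj) :
    ProjCat hε.Corner where
  obj := ModuleCat.of hε.Cornerᵐᵒᵖ (cornerPart ε P.obj)
  property := h.finite_projective hε

namespace TwoTerm

/-- The 2-term objects whose terms are generated by their `ε`-parts, that is, belong to
`add (ε Λ)`. -/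
structure IsGenerated (ε : Λ) (X : TwoTerm Λ) : Prop where
  gen₁ : IsGeneratedBy ε X.P₁.obj
  gen₀ : IsGeneratedBy ε X.P₀.obj

/-- The `ε`-part of a 2-term object. -/
abbrev corner (hε : IsIdempotentElem ε) (X : TwoTerm Λ) (h : X.IsGenerated ε) :
    TwoTerm hε.Corner where
  P₁ := X.P₁.corner hε h.gen₁
  P₀ := X.P₀.corner hε h.gen₀
  d := cornerHom hε X.d

variable (hε : IsIdempotentElem ε) {X Y : TwoTerm Λ} (hX : X.IsGenerated ε)
  (hY : Y.IsGenerated ε)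

/-- The `ε`-part of a commutative square. -/
abbrev Map.corner (a : Map X Y) : Map (X.corner hε hX) (Y.corner hε hY) where
  f₁ := cornerHom hε a.f₁
  f₀ := cornerHom hε a.f₀
  comm := by rw [← cornerHom_comp, a.comm, cornerHom_comp]

theorem Map.corner_surjective (b : Map (X.corner hε hX) (Y.corner hε hY)) :
    ∃ a : Map X Y, a.corner hε hX hY = b := by
  obtain ⟨b₁, b₀, hb⟩ := b
  obtain ⟨a₁, rfl⟩ := (IsGeneratedBy.cornerHom_bijective hε (N := Y.P₁.obj) hX.gen₁).2 b₁
  obtain ⟨a₀, rfl⟩ := (IsGeneratedBy.cornerHom_bijective hε (N := Y.P₀.obj) hX.gen₀).2 b₀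
  exact ⟨⟨a₁, a₀, hX.gen₁.hom_ext hε hb⟩, rfl⟩

theorem Map.homotopic_corner_iff {a b : Map X Y} :
    (a.corner hε hX hY).Homotopic (b.corner hε hX hY) ↔ a.Homotopic b := by
  constructor
  · rintro ⟨h, h₁, h₀⟩
    obtain ⟨h, rfl⟩ := (IsGeneratedBy.cornerHom_bijective hε (N := Y.P₁.obj) hX.gen₀).2 h
    exact ⟨h, hX.gen₁.hom_ext hε h₁, hX.gen₀.hom_ext hε h₀⟩
  · rintro ⟨h, h₁, h₀⟩
    exact ⟨cornerHom hε h, congrArg (cornerHom hε) h₁, congrArg (cornerHom hε) h₀⟩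

theorem isIsomorphic_corner_iff :
    (X.corner hε hX).IsIsomorphic (Y.corner hε hY) ↔ X.IsIsomorphic Y := by
  rw [isIsomorphic_iff, isIsomorphic_iff]
  constructor
  · rintro ⟨a, b, h, h'⟩
    obtain ⟨a, rfl⟩ := Map.corner_surjective hε hX hY a
    obtain ⟨b, rfl⟩ := Map.corner_surjective hε hY hX b
    exact ⟨a, b, (Map.homotopic_corner_iff hε hX hX (a := b.comp a) (b := Map.id X)).1 h,
      (Map.homotopic_corner_iff hε hY hY (a := a.comp b) (b := Map.id Y)).1 h'⟩
  · rintro ⟨a, b, h, h'⟩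
    exact ⟨a.corner hε hX hY, b.corner hε hY hX,
      (Map.homotopic_corner_iff hε hX hX (a := b.comp a) (b := Map.id X)).2 h,
      (Map.homotopic_corner_iff hε hY hY (a := a.comp b) (b := Map.id Y)).2 h'⟩

theorem extVanishes_corner_iff :
    ExtVanishes (X.corner hε hX) (Y.corner hε hY) ↔ ExtVanishes X Y := by
  constructor
  · intro H f
    obtain ⟨h₁, h₀, h⟩ := H (cornerHom hε f)
    obtain ⟨h₁, rfl⟩ := (IsGeneratedBy.cornerHom_bijective hε (N := Y.P₁.obj) hX.gen₁).2 h₁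
    obtain ⟨h₀, rfl⟩ := (IsGeneratedBy.cornerHom_bijective hε (N := Y.P₀.obj) hX.gen₀).2 h₀
    exact ⟨h₁, h₀, hX.gen₁.hom_ext hε h⟩
  · intro H f
    obtain ⟨f, rfl⟩ := (IsGeneratedBy.cornerHom_bijective hε (N := Y.P₀.obj) hX.gen₁).2 f
    obtain ⟨h₁, h₀, h⟩ := H f
    exact ⟨cornerHom hε h₁, cornerHom hε h₀, congrArg (cornerHom hε) h⟩

theorem isZero_corner_iff : IsZero (X.corner hε hX).toK ↔ IsZero X.toK := by
  rw [isZero_toK_iff, isZero_toK_iff]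
  constructor
  · intro h
    let E := LinearEquiv.ofBijective _ h
    obtain ⟨u, hu⟩ :=
      (IsGeneratedBy.cornerHom_bijective hε (N := X.P₁.obj) hX.gen₀).2 E.symm.toLinearMap
    have h₁ : u ∘ₗ X.d = LinearMap.id := by
      refine hX.gen₁.hom_ext hε ?_
      rw [cornerHom_comp, hu]
      exact LinearMap.ext fun x => E.symm_apply_apply x
    have h₀ : X.d ∘ₗ u = LinearMap.id := by
      refine hX.gen₀.hom_ext hε ?_
      rw [cornerHom_comp, hu]
      exact LinearMap.ext fun x => E.apply_symm_apply x
    exact Function.bijective_iff_has_inverse.2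
      ⟨u, LinearMap.congr_fun h₁, LinearMap.congr_fun h₀⟩
  · rintro ⟨hi, hs⟩
    refine ⟨fun x y hxy => Subtype.ext (hi (congrArg Subtype.val hxy)), fun y => ?_⟩
    obtain ⟨x, hx⟩ := hs y.1
    refine ⟨⟨op ε • x, op_smul_mem_cornerPart hε x⟩, Subtype.ext ?_⟩
    change X.d (op ε • x) = y.1
    rw [map_smul, hx, op_smul_cornerPart]

theorem IsGenerated.sum {m : ℕ} {X : Fin m → TwoTerm Λ} (h : ∀ i, (X i).IsGenerated ε) :
    (TwoTerm.sum X).IsGenerated ε :=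
  ⟨IsGeneratedBy.pi fun i => (h i).gen₁, IsGeneratedBy.pi fun i => (h i).gen₀⟩

theorem isIsomorphic_corner_sum {m : ℕ} {X : Fin m → TwoTerm Λ}
    (h : ∀ i, (X i).IsGenerated ε) : ((TwoTerm.sum X).corner hε (.sum h)).IsIsomorphic
      (TwoTerm.sum fun i => (X i).corner hε (h i)) :=
  .of_equiv (X := (TwoTerm.sum X).corner hε (.sum h))
    (Y := TwoTerm.sum fun i => (X i).corner hε (h i))
    (cornerPartPi hε fun i => (X i).P₁.obj) (cornerPartPi hε fun i => (X i).P₀.obj) fun _ => rfl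

theorem exists_corner_isIsomorphic (Z : TwoTerm hε.Corner) :
    ∃ (X : TwoTerm Λ) (hX : X.IsGenerated ε), (X.corner hε hX).IsIsomorphic Z := by
  obtain ⟨P₁, h₁, ⟨E₁⟩⟩ := exists_cornerPart_equiv hε Z.P₁
  obtain ⟨P₀, h₀, ⟨E₀⟩⟩ := exists_cornerPart_equiv hε Z.P₀
  obtain ⟨d, hd⟩ := (IsGeneratedBy.cornerHom_bijective hε (N := P₀.obj) h₁).2
    (E₀.toLinearMap ∘ₗ Z.d ∘ₗ E₁.symm.toLinearMap)
  refine ⟨⟨P₁, P₀, d⟩, ⟨h₁, h₀⟩, .symm (.of_equiv E₁ E₀ fun x => ?_)⟩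
  change cornerHom hε d (E₁ x) = E₀ (Z.d x)
  rw [hd, LinearMap.comp_apply, LinearMap.comp_apply, LinearEquiv.coe_coe, LinearEquiv.coe_coe,
    E₁.symm_apply_apply]

/-- The 2-term object `X` has no maps to `S` and to `S[1]` in the derived category, for all simple
modules `S` with `S ε = 0`. This is invariant under isomorphism and, unlike `IsGenerated`, can be
read off the `g`-vector of a rigid object. -/
def IsSupported (ε : Λ) (X : TwoTerm Λ) : Prop :=
  ∀ (S : Type v) [AddCommGroup S] [Module Λᵐᵒᵖ S] [IsSimpleModule Λᵐᵒᵖ S],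
    (∀ s : S, op ε • s = 0) →
      Function.Bijective fun h : X.P₀.obj →ₗ[Λᵐᵒᵖ] S => h ∘ₗ X.d

theorem IsSupported.of_isRetract (h : X.IsSupported ε) (hYX : Y.IsRetract X) :
    Y.IsSupported ε := by
  obtain ⟨a, b, s, hs₁, hs₀⟩ := hYX
  replace hs₁ : b.f₁ ∘ₗ a.f₁ = LinearMap.id + s ∘ₗ Y.d := hs₁
  replace hs₀ : b.f₀ ∘ₗ a.f₀ = LinearMap.id + Y.d ∘ₗ s := hs₀
  intro S _ _ _ hS
  obtain ⟨hinj, hsurj⟩ := h S hS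
  refine ⟨fun φ φ' hφ => ?_, fun ψ => ?_⟩
  · replace hφ : φ ∘ₗ Y.d = φ' ∘ₗ Y.d := hφ
    have hb : φ ∘ₗ b.f₀ = φ' ∘ₗ b.f₀ := by
      apply hinj
      simp only [LinearMap.comp_assoc, ← b.comm]
      rw [← LinearMap.comp_assoc, hφ, LinearMap.comp_assoc]
    have hba := congrArg (· ∘ₗ a.f₀) hb
    simp only [LinearMap.comp_assoc, hs₀, LinearMap.comp_add, LinearMap.comp_id] at hba
    rw [← LinearMap.comp_assoc, ← LinearMap.comp_assoc, hφ] at hba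
    exact add_right_cancel hba
  · obtain ⟨φ, hφ⟩ := hsurj (ψ ∘ₗ b.f₁)
    replace hφ : φ ∘ₗ X.d = ψ ∘ₗ b.f₁ := hφ
    refine ⟨φ ∘ₗ a.f₀ - ψ ∘ₗ s, ?_⟩
    change (φ ∘ₗ a.f₀ - ψ ∘ₗ s) ∘ₗ Y.d = ψ
    rw [LinearMap.sub_comp, LinearMap.comp_assoc, ← a.comm, ← LinearMap.comp_assoc, hφ,
      LinearMap.comp_assoc, hs₁, LinearMap.comp_add, LinearMap.comp_id, LinearMap.comp_assoc,
      add_sub_cancel_right]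

theorem IsGenerated.isSupported (h : X.IsGenerated ε) : X.IsSupported ε := by
  intro S _ _ _ hS
  refine ⟨fun f g _ => ?_, fun f => ⟨0, ?_⟩⟩
  · rw [h.gen₀.hom_eq_zero hS f, h.gen₀.hom_eq_zero hS g]
  · rw [h.gen₁.hom_eq_zero hS f]
    exact LinearMap.zero_comp _

theorem comp_d_eq_zero_of_isSuperfluous (hX : IsSuperfluous (LinearMap.range X.d)) {S : Type*}
    [AddCommGroup S] [Module Λᵐᵒᵖ S] [IsSimpleModule Λᵐᵒᵖ S] (f : X.P₀.obj →ₗ[Λᵐᵒᵖ] S) :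
    f ∘ₗ X.d = 0 := by
  rw [← LinearMap.range_eq_bot, LinearMap.range_comp]
  refine (eq_bot_or_eq_top _).resolve_right fun htop => ?_
  exact bot_ne_top (hX.map f ⊥ (by rw [htop, top_sup_eq]))

theorem IsSupported.isGenerated_of_isSuperfluous (h : X.IsSupported ε) (hε : IsIdempotentElem ε)
    (hX : IsSuperfluous (LinearMap.range X.d)) : X.IsGenerated ε where
  gen₁ := isGeneratedBy_of_forall_simple_hom_eq_zero hε fun S _ _ _ hS f => by
    obtain ⟨g, rfl⟩ := (h S hS).2 f
    exact comp_d_eq_zero_of_isSuperfluous hX g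
  gen₀ := isGeneratedBy_of_forall_simple_hom_eq_zero hε fun S _ _ _ hS f => (h S hS).1 <|
    (comp_d_eq_zero_of_isSuperfluous hX f).trans (LinearMap.zero_comp _).symm

theorem IsSupported.exists_isGenerated [IsArtinianRing Λᵐᵒᵖ] (h : X.IsSupported ε)
    (hε : IsIdempotentElem ε) : ∃ Y : TwoTerm Λ, Y.IsGenerated ε ∧ X.IsIsomorphic Y := by
  obtain ⟨V, Y, π, hY, hXY⟩ := TauPair.exists_corresponds_of_twoTerm X
  refine ⟨_, (h.of_isRetract hXY.symm.isRetract).isGenerated_of_isSuperfluous hε ?_, hXY⟩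
  refine hY.superfluous₀.mono ?_
  rintro _ ⟨x, rfl⟩
  exact hY.apply_d x.1

/-- The 2-term object `Z` over the corner corresponds to the 2-term object `X`: it is isomorphic
to the `ε`-part of an object isomorphic to `X` which is generated by its `ε`-part. -/
def CornerCorresponds (X : TwoTerm Λ) (Z : TwoTerm hε.Corner) : Prop :=
  ∃ (Y : TwoTerm Λ) (hY : Y.IsGenerated ε), X.IsIsomorphic Y ∧ (Y.corner hε hY).IsIsomorphic Z

theorem exists_cornerCorresponds (Z : TwoTerm hε.Corner) :
    ∃ X : TwoTerm Λ, X.CornerCorresponds hε Z := by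
  obtain ⟨X, hX, h⟩ := exists_corner_isIsomorphic hε Z
  exact ⟨X, X, hX, .refl _, h⟩

theorem IsSupported.exists_cornerCorresponds [IsArtinianRing Λᵐᵒᵖ] (h : X.IsSupported ε)
    (hε : IsIdempotentElem ε) : ∃ Z : TwoTerm hε.Corner, X.CornerCorresponds hε Z := by
  obtain ⟨Y, hY, hXY⟩ := h.exists_isGenerated hε
  exact ⟨_, Y, hY, hXY, .refl _⟩

namespace CornerCorresponds

variable {hε} {X' : TwoTerm Λ} {Z Z' : TwoTerm hε.Corner}

theorem isIsomorphic_iff (h : X.CornerCorresponds hε Z) (h' : X'.CornerCorresponds hε Z') :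
    X.IsIsomorphic X' ↔ Z.IsIsomorphic Z' := by
  obtain ⟨Y, hY, hXY, hYZ⟩ := h
  obtain ⟨Y', hY', hXY', hYZ'⟩ := h'
  have hcorner := isIsomorphic_corner_iff hε hY hY'
  exact ⟨fun hX => (hYZ.symm.trans (hcorner.2 ((hXY.symm.trans hX).trans hXY'))).trans hYZ',
    fun hZ => (hXY.trans (hcorner.1 ((hYZ.trans hZ).trans hYZ'.symm))).trans hXY'.symm⟩

theorem of_isIsomorphic (h : X.CornerCorresponds hε Z) (hX : X.IsIsomorphic X')
    (hZ : Z.IsIsomorphic Z') : X'.CornerCorresponds hε Z' := by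
  obtain ⟨Y, hY, hXY, hYZ⟩ := h
  exact ⟨Y, hY, hX.symm.trans hXY, hYZ.trans hZ⟩

theorem extVanishes_iff (h : X.CornerCorresponds hε Z) (h' : X'.CornerCorresponds hε Z') :
    ExtVanishes X X' ↔ ExtVanishes Z Z' := by
  obtain ⟨Y, hY, hXY, hYZ⟩ := h
  obtain ⟨Y', hY', hXY', hYZ'⟩ := h'
  rw [extVanishes_congr hXY hXY', ← extVanishes_congr hYZ hYZ', extVanishes_corner_iff]

theorem isRigid_iff (h : X.CornerCorresponds hε Z) : X.IsRigid ↔ Z.IsRigid := by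
  rw [isRigid_iff_extVanishes, isRigid_iff_extVanishes, h.extVanishes_iff h]

theorem isZero_iff (h : X.CornerCorresponds hε Z) : IsZero X.toK ↔ IsZero Z.toK := by
  obtain ⟨Y, hY, hXY, hYZ⟩ := h
  rw [hXY.isZero_iff, ← hYZ.isZero_iff, isZero_corner_iff]

theorem isSupported (h : X.CornerCorresponds hε Z) : X.IsSupported ε := by
  obtain ⟨Y, hY, hXY, -⟩ := h
  exact hY.isSupported.of_isRetract hXY.isRetract

theorem sum {m : ℕ} {X : Fin m → TwoTerm Λ} {Z : Fin m → TwoTerm hε.Corner}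
    (h : ∀ i, (X i).CornerCorresponds hε (Z i)) :
    (TwoTerm.sum X).CornerCorresponds hε (TwoTerm.sum Z) := by
  choose Y hY hXY hYZ using h
  exact ⟨TwoTerm.sum Y, .sum hY, .sum hXY, (isIsomorphic_corner_sum hε hY).trans (.sum hYZ)⟩

theorem sum_pair (h : X.CornerCorresponds hε Z) (h' : X'.CornerCorresponds hε Z') :
    (TwoTerm.sum ![X, X']).CornerCorresponds hε (TwoTerm.sum ![Z, Z']) :=
  CornerCorresponds.sum (Fin.forall_fin_two.2 ⟨h, h'⟩)

theorem isIndecomposable_iff [IsArtinianRing Λᵐᵒᵖ] (h : X.CornerCorresponds hε Z) :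
    X.IsIndecomposable ↔ Z.IsIndecomposable := by
  unfold IsIndecomposable
  rw [h.isZero_iff]
  refine and_congr_right fun _ => ⟨fun hX Z₁ Z₂ hZ => ?_, fun hZ X₁ X₂ hX => ?_⟩
  · obtain ⟨X₁, h₁⟩ := exists_cornerCorresponds hε Z₁
    obtain ⟨X₂, h₂⟩ := exists_cornerCorresponds hε Z₂
    rw [← h₁.isZero_iff, ← h₂.isZero_iff]
    exact hX _ _ ((h.isIsomorphic_iff (h₁.sum_pair h₂)).2 hZ)
  · have hs : (TwoTerm.sum ![X₁, X₂]).IsSupported ε :=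
      h.isSupported.of_isRetract hX.symm.isRetract
    have hX₁ : X₁.IsSupported ε := hs.of_isRetract (isRetract_sum ![X₁, X₂] 0)
    have hX₂ : X₂.IsSupported ε := hs.of_isRetract (isRetract_sum ![X₁, X₂] 1)
    obtain ⟨Z₁, h₁⟩ := hX₁.exists_cornerCorresponds hε
    obtain ⟨Z₂, h₂⟩ := hX₂.exists_cornerCorresponds hε
    rw [h₁.isZero_iff, h₂.isZero_iff]
    exact hZ _ _ ((h.isIsomorphic_iff (h₁.sum_pair h₂)).1 hX)

end CornerCorresponds

end TwoTerm

theorem exists_siltingVertex_corner_equiv [IsArtinianRing Λᵐᵒᵖ] (hε : IsIdempotentElem ε) :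
    ∃ φ : SiltingVertex hε.Corner ≃ {x : SiltingVertex Λ | x.rep.IsSupported ε},
      ∀ z : SiltingVertex hε.Corner, (φ z).1.rep.CornerCorresponds hε z.rep := by
  refine exists_equiv_of_biUnique_of_biTotal
    (R := fun (z : SiltingVertex hε.Corner) (x : {x : SiltingVertex Λ | x.rep.IsSupported ε}) =>
      x.1.rep.CornerCorresponds hε z.rep)
    ⟨fun z z' x hz hz' => SiltingVertex.ext ((hz.isIsomorphic_iff hz').1 (.refl _)),
      fun z x x' hx hx' => Subtype.ext
        (SiltingVertex.ext ((hx.isIsomorphic_iff hx').2 (.refl _)))⟩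
    ⟨fun z => ?_, fun x => ?_⟩
  · obtain ⟨X, hX⟩ := TwoTerm.exists_cornerCorresponds hε z.rep
    let x : SiltingVertex Λ := .mk X (hX.isIndecomposable_iff.2 z.isIndecomposable_rep)
      (hX.isRigid_iff.2 z.isRigid_rep)
    have hx : x.rep.CornerCorresponds hε z.rep :=
      hX.of_isIsomorphic (SiltingVertex.rep_mk _ _).symm (.refl _)
    exact ⟨⟨x, hx.isSupported⟩, hx⟩
  · obtain ⟨Z, hZ⟩ := TwoTerm.IsSupported.exists_cornerCorresponds x.2 hε
    exact ⟨.mk Z (hZ.isIndecomposable_iff.1 x.1.isIndecomposable_rep)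
      (hZ.isRigid_iff.1 x.1.isRigid_rep),
      hZ.of_isIsomorphic (.refl _) (SiltingVertex.rep_mk _ _).symm⟩

theorem siltingComplex_corner_isomorphic [IsArtinianRing Λᵐᵒᵖ] (hε : IsIdempotentElem ε) :
    (siltingComplex hε.Corner).Isomorphic
      ((siltingComplex Λ).induced {x | x.rep.IsSupported ε}) := by
  obtain ⟨φ, hφ⟩ := exists_siltingVertex_corner_equiv hε
  exact ⟨φ, (isFlagComplexOf_siltingComplex hε.Corner).mem_faces_iff_map_mem_faces
    ((isFlagComplexOf_siltingComplex Λ).induced _) φ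
    fun z z' => ((hφ z).extVanishes_iff (hφ z')).symm⟩

end Corner

/-! ### Multiplicities of indecomposable projective modules -/

section Indecomposable

variable {R : Type*} [Ring R] {A B : Type*} [AddCommGroup A] [Module R A] [AddCommGroup B]
  [Module R B]

theorem isSuperfluous_of_ne_top_of_indecomposable [IsNoetherian R A] [IsArtinian R A]
    [Module.Projective R A] (hA : ∀ N L : Submodule R A, IsCompl N L → N = ⊥ ∨ L = ⊥)
    {N : Submodule R A} (hN : N ≠ ⊤) : IsSuperfluous N := by
  intro L hL
  have hsurj : Function.Surjective (N.subtype.coprod L.subtype) := by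
    rw [← LinearMap.range_eq_top, LinearMap.range_coprod, Submodule.range_subtype,
      Submodule.range_subtype, hL]
  obtain ⟨s, hs⟩ := Module.projective_lifting_property _ LinearMap.id hsurj
  let f : Module.End R A := N.subtype ∘ₗ LinearMap.fst R N L ∘ₗ s
  let g : Module.End R A := L.subtype ∘ₗ LinearMap.snd R N L ∘ₗ s
  have hfg : f + g = 1 := hs
  -- By Fitting's lemma, `f` is bijective or nilpotent; in the latter case `g = 1 - f` is bijective.
  obtain ⟨n, hn, hn0⟩ := (f.eventually_isCompl_ker_pow_range_pow.and
    (Filter.eventually_ne_atTop 0)).exists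
  rcases hA _ _ hn with hker | hrange
  · have htop : LinearMap.range (f ^ n) = ⊤ := by
      rw [← hn.sup_eq_top, hker, bot_sup_eq]
    refine absurd (eq_top_iff.2 (htop.ge.trans ?_)) hN
    rintro _ ⟨x, rfl⟩
    rw [← mul_pow_sub_one hn0]
    exact (s _).1.2
  · have hnil : IsNilpotent f := ⟨n, LinearMap.range_eq_bot.1 hrange⟩
    have hunit : IsUnit g := by
      rw [← sub_eq_iff_eq_add'.2 hfg.symm]
      exact hnil.isUnit_one_sub
    refine eq_top_iff.2 fun x _ => ?_
    obtain ⟨y, rfl⟩ := ((Module.End.isUnit_iff g).1 hunit).2 x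
    exact (s y).2.2

theorem isCompl_ker_range_of_comp_eq_id {h : A →ₗ[R] B} {t : B →ₗ[R] A}
    (ht : h ∘ₗ t = LinearMap.id) : IsCompl (LinearMap.ker h) (LinearMap.range t) := by
  have hproj : LinearMap.IsProj (LinearMap.range t) (t ∘ₗ h) := ⟨fun x => ⟨h x, rfl⟩, by
    rintro _ ⟨y, rfl⟩
    exact congrArg t (LinearMap.congr_fun ht y)⟩
  rw [← LinearMap.ker_comp_of_ker_eq_bot h (LinearMap.ker_eq_bot_of_inverse ht)]
  exact hproj.isCompl.symm

theorem injective_of_surjective_of_indecomposable [Module.Projective R B] [Nontrivial B]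
    (hA : ∀ N L : Submodule R A, IsCompl N L → N = ⊥ ∨ L = ⊥) {h : A →ₗ[R] B}
    (hh : Function.Surjective h) : Function.Injective h := by
  obtain ⟨t, ht⟩ := Module.projective_lifting_property h LinearMap.id hh
  refine LinearMap.ker_eq_bot.1 ((hA _ _ (isCompl_ker_range_of_comp_eq_id ht)).resolve_right
    fun hrange => ?_)
  obtain ⟨x, hx⟩ := exists_ne (0 : B)
  refine hx ?_
  rw [← LinearMap.id_apply (R := R) x, ← ht, LinearMap.range_eq_bot.1 hrange, LinearMap.comp_zero,
    LinearMap.zero_apply]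

theorem nonempty_equiv_ker_prod [Module.Projective R B] {h : A →ₗ[R] B}
    (hh : Function.Surjective h) : Nonempty (A ≃ₗ[R] LinearMap.ker h × B) := by
  obtain ⟨t, ht⟩ := Module.projective_lifting_property h LinearMap.id hh
  exact ⟨(lequivProdOfRightSplitExact (LinearMap.ker h).subtype_injective
    (Submodule.range_subtype _) ht).symm⟩

theorem projective_of_equiv_prod [Module.Projective R A] {K : Type*} [AddCommGroup K] [Module R K]
    (E : A ≃ₗ[R] K × B) : Module.Projective R K :=
  have := Module.Projective.of_equiv E
  .of_split (LinearMap.inl R K B) (LinearMap.fst R K B) (LinearMap.fst_comp_inl R K B)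

end Indecomposable

section RightIdeal

variable {Λ : Type v} [Ring Λ] {e : Λ}

theorem mem_rightIdeal_iff (he : IsIdempotentElem e) {x : Λ} : x ∈ rightIdeal e ↔ e * x = x := by
  rw [Submodule.mem_span_singleton]
  constructor
  · rintro ⟨a, rfl⟩
    exact (mul_assoc e e a.unop).symm.trans (congrArg (· * a.unop) he)
  · exact fun h => ⟨op x, h⟩

/-- The generator `e` of `e Λ`. -/
def rightIdealGen (e : Λ) : rightIdeal e := ⟨e, Submodule.mem_span_singleton_self e⟩

theorem op_smul_rightIdealGen (he : IsIdempotentElem e) (x : rightIdeal e) :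
    op x.1 • rightIdealGen e = x :=
  Subtype.ext ((mem_rightIdeal_iff he).1 x.2)

theorem isDualBasis_rightIdealGen (he : IsIdempotentElem e) :
    IsDualBasis (fun _ : Unit => rightIdealGen e) fun _ => (rightIdeal e).subtype := fun x =>
  (Fintype.sum_unique _).trans (op_smul_rightIdealGen he x)

theorem isGeneratedBy_rightIdeal {ε : Λ} (he : IsIdempotentElem e) (h : e * ε = e) :
    IsGeneratedBy ε (rightIdeal e) := by
  refine eq_top_iff.2 fun x _ => ?_
  rw [← op_smul_rightIdealGen he x]
  exact Submodule.smul_mem _ _ (Submodule.subset_span (Subtype.ext h))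

/-- The map `e Λ ⟶ M`, `x ↦ m x`, attached to `m : M`. -/
def rightIdealHom (e : Λ) {M : Type*} [AddCommGroup M] [Module Λᵐᵒᵖ M] (m : M) :
    rightIdeal e →ₗ[Λᵐᵒᵖ] M :=
  rankOne m (rightIdeal e).subtype

theorem rightIdealHom_gen {M : Type*} [AddCommGroup M] [Module Λᵐᵒᵖ M] (m : M) :
    rightIdealHom e m (rightIdealGen e) = op e • m := rfl

theorem op_smul_eq_of_add_eq_rightIdealGen (he : IsIdempotentElem e)
    {N L : Submodule Λᵐᵒᵖ (rightIdeal e)} (hNL : Disjoint N L) {a b : rightIdeal e} (ha : a ∈ N)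
    (hb : b ∈ L) (hab : a + b = rightIdealGen e) {x : rightIdeal e} (hx : x ∈ N) :
    op x.1 • a = x ∧ op x.1 • b = 0 := by
  have hsum : op x.1 • a + op x.1 • b = x := by
    rw [← smul_add, hab, op_smul_rightIdealGen he]
  have hbN : op x.1 • b ∈ N := by
    rw [← sub_eq_of_eq_add' hsum.symm]
    exact N.sub_mem hx (N.smul_mem _ ha)
  have hb0 : op x.1 • b = 0 := Submodule.disjoint_def.1 hNL _ hbN (L.smul_mem _ hb)
  exact ⟨by rwa [hb0, add_zero] at hsum, hb0⟩

namespace IsPrimitiveIdempotent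

theorem eq_bot_or (he : IsPrimitiveIdempotent e) (N L : Submodule Λᵐᵒᵖ (rightIdeal e))
    (h : IsCompl N L) : N = ⊥ ∨ L = ⊥ := by
  obtain ⟨a, ha, b, hb, hab⟩ := Submodule.mem_sup.1 (h.sup_eq_top ▸ Submodule.mem_top :
    rightIdealGen e ∈ N ⊔ L)
  have hN {x} (hx : x ∈ N) := op_smul_eq_of_add_eq_rightIdealGen he.idem h.disjoint ha hb hab hx
  have hL {x} (hx : x ∈ L) := op_smul_eq_of_add_eq_rightIdealGen he.idem h.disjoint.symm hb ha
    ((add_comm b a).trans hab) hx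
  have hzero : a.1 = 0 ∨ b.1 = 0 := he.eq_zero_or a.1 b.1 (congrArg Subtype.val (hN ha).1)
    (congrArg Subtype.val (hL hb).1) (congrArg Subtype.val (hL hb).2)
    (congrArg Subtype.val (hN ha).2) (congrArg Subtype.val hab)
  refine hzero.imp (fun ha0 => (Submodule.eq_bot_iff N).2 fun x hx => ?_)
    fun hb0 => (Submodule.eq_bot_iff L).2 fun x hx => ?_
  · rw [← (hN hx).1, show a = 0 from Subtype.ext ha0, smul_zero]
  · rw [← (hL hx).1, show b = 0 from Subtype.ext hb0, smul_zero]

theorem isSuperfluous [IsArtinianRing Λᵐᵒᵖ] (he : IsPrimitiveIdempotent e)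
    {N : Submodule Λᵐᵒᵖ (rightIdeal e)} (hN : N ≠ ⊤) : IsSuperfluous N :=
  have := (isDualBasis_rightIdealGen he.idem).finite
  have := (isDualBasis_rightIdealGen he.idem).projective
  isSuperfluous_of_ne_top_of_indecomposable he.eq_bot_or hN

theorem nontrivial (he : IsPrimitiveIdempotent e) : Nontrivial (rightIdeal e) :=
  ⟨rightIdealGen e, 0, fun h => he.ne_zero (congrArg Subtype.val h)⟩

theorem exists_surjective [IsArtinianRing Λᵐᵒᵖ] (he : IsPrimitiveIdempotent e) {P S : Type*}
    [AddCommGroup P] [Module Λᵐᵒᵖ P] [Module.Projective Λᵐᵒᵖ P] [AddCommGroup S] [Module Λᵐᵒᵖ S]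
    [IsSimpleModule Λᵐᵒᵖ S] {f : P →ₗ[Λᵐᵒᵖ] S} (hf : Function.Surjective f) {s : S}
    (hs : op e • s ≠ 0) : ∃ h : P →ₗ[Λᵐᵒᵖ] rightIdeal e, Function.Surjective h := by
  have hne : rightIdealHom e s ≠ 0 := fun h0 =>
    hs (by rw [← rightIdealHom_gen, h0, LinearMap.zero_apply])
  obtain ⟨h, hh⟩ := Module.projective_lifting_property _ f (LinearMap.surjective_of_ne_zero hne)
  have hker : IsSuperfluous (LinearMap.ker (rightIdealHom e s)) :=
    he.isSuperfluous fun h => hne (LinearMap.ker_eq_top.1 h)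
  refine ⟨h, hker.surjective_of_forall_sub_mem fun x => ?_⟩
  obtain ⟨p, hp⟩ := hf (rightIdealHom e s x)
  exact ⟨p, by rw [LinearMap.mem_ker, map_sub, sub_eq_zero, ← hp, ← hh, LinearMap.comp_apply]⟩

end IsPrimitiveIdempotent

theorem exists_op_smul_ne_zero {ι : Type*} [Fintype ι] {e : ι → Λ} (he : ∑ i, e i = 1)
    (M : Type*) [AddCommGroup M] [Module Λᵐᵒᵖ M] [Nontrivial M] :
    ∃ (i : ι) (m : M), op (e i) • m ≠ 0 := by
  by_contra! h
  obtain ⟨m, hm⟩ := exists_ne (0 : M)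
  refine hm ?_
  rw [← one_smul Λᵐᵒᵖ m, ← op_one, ← he, Finset.op_sum, Finset.sum_smul]
  exact Finset.sum_eq_zero fun i _ => h i m

end RightIdeal

section Multiplicities

variable {Λ : Type v} [Ring Λ] {n : ℕ} {e : Fin n → Λ}

namespace HasMultiplicities

theorem prod {P Q : ProjCat Λ} {a b : Fin n → ℕ} (hP : HasMultiplicities e P a)
    (hQ : HasMultiplicities e Q b) : HasMultiplicities e (P.prod Q) fun i => a i + b i := by
  obtain ⟨f⟩ := hP
  obtain ⟨g⟩ := hQ
  exact ⟨(f.prodCongr g).trans <| (piProdEquiv Λᵐᵒᵖ _ _).symm.trans <|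
    LinearEquiv.piCongrRight fun i => (LinearEquiv.sumArrowLequivProdArrow _ _ Λᵐᵒᵖ _).symm.trans
      (LinearEquiv.funCongrLeft Λᵐᵒᵖ _ finSumFinEquiv.symm)⟩

theorem congr {P Q : ProjCat Λ} {a : Fin n → ℕ} (h : HasMultiplicities e P a)
    (f : Q.obj ≃ₗ[Λᵐᵒᵖ] P.obj) : HasMultiplicities e Q a :=
  h.map f.trans

theorem of_subsingleton {P : ProjCat Λ} [Subsingleton P.obj] : HasMultiplicities e P 0 :=
  have (i : Fin n) : IsEmpty (Fin ((0 : Fin n → ℕ) i)) := Fin.isEmpty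
  ⟨0⟩

end HasMultiplicities

namespace IsBasicSystem

/-- `e i Λ` as an object of `proj Λ`. -/
def proj (he : IsBasicSystem e) (i : Fin n) : ProjCat Λ :=
  have hi := isDualBasis_rightIdealGen (he.primitive i).idem
  ⟨ModuleCat.of Λᵐᵒᵖ (rightIdeal (e i)), hi.finite, hi.projective⟩

theorem hasMultiplicities_proj (he : IsBasicSystem e) (i : Fin n) :
    HasMultiplicities e (he.proj i) (Pi.single i 1) := by
  have hlt : 0 < (Pi.single i 1 : Fin n → ℕ) i := by rw [Pi.single_eq_same]; exact one_pos
  let incl : rightIdeal (e i) →ₗ[Λᵐᵒᵖ]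
      ∀ j, Fin ((Pi.single i 1 : Fin n → ℕ) j) → rightIdeal (e j) :=
    LinearMap.pi fun j => LinearMap.pi fun _ =>
      LinearMap.proj j ∘ₗ LinearMap.single Λᵐᵒᵖ (fun j => rightIdeal (e j)) i
  refine ⟨LinearEquiv.ofLinearMap incl (LinearMap.proj ⟨0, hlt⟩ ∘ₗ LinearMap.proj i)
    (LinearMap.ext fun y => funext fun j => funext fun l => ?_)
    (LinearMap.ext fun x => Pi.single_eq_same (M := fun j => rightIdeal (e j)) i x)⟩
  obtain rfl | hj := eq_or_ne j i
  · have : Subsingleton (Fin ((Pi.single j 1 : Fin n → ℕ) j)) := by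
      rw [Pi.single_eq_same]
      infer_instance
    exact (Pi.single_eq_same j _).trans (congrArg (y j) (Subsingleton.elim _ l))
  · exact (Fin.cast (Pi.single_eq_of_ne hj 1) l).elim0

variable [IsArtinianRing Λᵐᵒᵖ]

theorem exists_isCoatom_forall_op_smul_eq_zero (he : IsBasicSystem e) (i : Fin n) :
    ∃ N : Submodule Λᵐᵒᵖ (rightIdeal (e i)), IsCoatom N ∧
      ∀ j, j ≠ i → ∀ s : rightIdeal (e i) ⧸ N, op (e j) • s = 0 := by
  have := (he.primitive i).nontrivial
  have := (isDualBasis_rightIdealGen (he.primitive i).idem).finite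
  have := (isDualBasis_rightIdealGen (he.primitive i).idem).projective
  obtain ⟨N, hN⟩ := IsCoatomic.exists_coatom (Submodule Λᵐᵒᵖ (rightIdeal (e i)))
  refine ⟨N, hN, fun j hj s => ?_⟩
  by_contra hs
  have : IsSimpleModule Λᵐᵒᵖ (rightIdeal (e i) ⧸ N) := isSimpleModule_iff_isCoatom.2 hN
  obtain ⟨h, hsurj⟩ := (he.primitive j).exists_surjective N.mkQ_surjective hs
  have := (he.primitive j).nontrivial
  have := (isDualBasis_rightIdealGen (he.primitive j).idem).projective
  have hinj := injective_of_surjective_of_indecomposable (he.primitive i).eq_bot_or hsurj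
  exact hj (he.basic i j ⟨LinearEquiv.ofBijective h ⟨hinj, hsurj⟩⟩).symm

theorem exists_surjective_rightIdeal (he : IsBasicSystem e) (P : Type*) [AddCommGroup P]
    [Module Λᵐᵒᵖ P] [Module.Finite Λᵐᵒᵖ P] [Module.Projective Λᵐᵒᵖ P] [Nontrivial P] :
    ∃ (i : Fin n) (h : P →ₗ[Λᵐᵒᵖ] rightIdeal (e i)), Function.Surjective h := by
  obtain ⟨N, hN⟩ := IsCoatomic.exists_coatom (Submodule Λᵐᵒᵖ P)
  have : IsSimpleModule Λᵐᵒᵖ (P ⧸ N) := isSimpleModule_iff_isCoatom.2 hN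
  have := IsSimpleModule.nontrivial Λᵐᵒᵖ (P ⧸ N)
  obtain ⟨i, s, hs⟩ := exists_op_smul_ne_zero he.complete.complete (P ⧸ N)
  exact ⟨i, (he.primitive i).exists_surjective N.mkQ_surjective hs⟩

theorem exists_equiv_prod_proj (he : IsBasicSystem e) (P : ProjCat Λ) [Nontrivial P.obj] :
    ∃ (i : Fin n) (K : ProjCat Λ), Module.length Λᵐᵒᵖ K.obj < Module.length Λᵐᵒᵖ P.obj ∧
      Nonempty (P.obj ≃ₗ[Λᵐᵒᵖ] (K.prod (he.proj i)).obj) := by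
  obtain ⟨i, h, hsurj⟩ := he.exists_surjective_rightIdeal P.obj
  have := (isDualBasis_rightIdealGen (he.primitive i).idem).projective
  obtain ⟨E⟩ := nonempty_equiv_ker_prod hsurj
  have hker : LinearMap.ker h ≠ ⊤ := fun htop => by
    obtain ⟨x, hx⟩ := hsurj (rightIdealGen (e i))
    rw [LinearMap.ker_eq_top.1 htop, LinearMap.zero_apply] at hx
    exact (he.primitive i).ne_zero (congrArg Subtype.val hx).symm
  exact ⟨i, ⟨ModuleCat.of Λᵐᵒᵖ (LinearMap.ker h), Module.IsNoetherian.finite Λᵐᵒᵖ _,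
    projective_of_equiv_prod E⟩, Submodule.length_lt hker, ⟨E⟩⟩

theorem exists_hasMultiplicities (he : IsBasicSystem e) (P : ProjCat Λ) :
    ∃ a, HasMultiplicities e P a := by
  induction hl : Module.length Λᵐᵒᵖ P.obj using WellFoundedLT.induction generalizing P with
  | ind l ih =>
    rcases subsingleton_or_nontrivial P.obj with hP | hP
    · exact ⟨0, .of_subsingleton⟩
    · obtain ⟨i, K, hK, ⟨E⟩⟩ := he.exists_equiv_prod_proj P
      obtain ⟨a, ha⟩ := ih _ (hl ▸ hK) K rfl
      exact ⟨_, (ha.prod (he.hasMultiplicities_proj i)).congr E⟩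

end IsBasicSystem

end Multiplicities

/-! ### g-vectors -/

section Hom

variable {k : Type u} [Field k] {Λ : Type v} [Ring Λ] [Algebra k Λ] {S : Type*} [AddCommGroup S]
  [Module Λᵐᵒᵖ S] [Module k S] [IsScalarTower k Λᵐᵒᵖ S]

variable (k Λ S) in
theorem finite_of_finite_op [Module.Finite k Λ] [Module.Finite Λᵐᵒᵖ S] : Module.Finite k S :=
  have : Module.Finite k Λᵐᵒᵖ := .equiv (opLinearEquiv k : Λ ≃ₗ[k] Λᵐᵒᵖ)
  .trans Λᵐᵒᵖ S

theorem finite_hom [Module.Finite k S] (P : Type*) [AddCommGroup P] [Module Λᵐᵒᵖ P]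
    [Module.Finite Λᵐᵒᵖ P] : Module.Finite k (P →ₗ[Λᵐᵒᵖ] S) := by
  obtain ⟨m, π, hπ⟩ := Module.Finite.exists_fin' Λᵐᵒᵖ P
  let evalGenerators : (P →ₗ[Λᵐᵒᵖ] S) →ₗ[k] (Fin m → S) :=
    { toFun := fun f i => f (π (Pi.single i 1))
      map_add' := fun _ _ => rfl
      map_smul' := fun _ _ => rfl }
  refine Module.Finite.of_injective evalGenerators fun f g hfg => (LinearMap.cancel_right hπ).1 ?_
  exact LinearMap.pi_ext' fun i => LinearMap.ext_ring (congrFun hfg i)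

theorem IsGeneratedBy.finrank_hom_eq_zero {ε : Λ} {M : Type*} [AddCommGroup M] [Module Λᵐᵒᵖ M]
    (h : IsGeneratedBy ε M) (hS : ∀ s : S, op ε • s = 0) :
    Module.finrank k (M →ₗ[Λᵐᵒᵖ] S) = 0 :=
  have : Subsingleton (M →ₗ[Λᵐᵒᵖ] S) :=
    ⟨fun f g => (h.hom_eq_zero hS f).trans (h.hom_eq_zero hS g).symm⟩
  Module.finrank_zero_of_subsingleton

variable (k) in
theorem HasMultiplicities.finrank_hom [Module.Finite k S] {n : ℕ} {e : Fin n → Λ} {P : ProjCat Λ}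
    {a : Fin n → ℕ} (h : HasMultiplicities e P a) :
    Module.finrank k (P.obj →ₗ[Λᵐᵒᵖ] S) =
      ∑ i, a i * Module.finrank k (rightIdeal (e i) →ₗ[Λᵐᵒᵖ] S) := by
  obtain ⟨f⟩ := h
  have (i : Fin n) : Module.Finite k (rightIdeal (e i) →ₗ[Λᵐᵒᵖ] S) := finite_hom _
  let E : (∀ i, Fin (a i) → (rightIdeal (e i) →ₗ[Λᵐᵒᵖ] S)) ≃ₗ[k]
      ((∀ i, Fin (a i) → rightIdeal (e i)) →ₗ[Λᵐᵒᵖ] S) :=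
    (LinearEquiv.piCongrRight fun i => LinearMap.lsum Λᵐᵒᵖ (fun _ : Fin (a i) =>
      rightIdeal (e i)) k).trans (LinearMap.lsum Λᵐᵒᵖ (fun i => Fin (a i) → rightIdeal (e i)) k)
  rw [((f.congrLeft S k).trans E.symm).finrank_eq, Module.finrank_pi_fintype]
  simp only [Module.finrank_pi_fintype, Finset.sum_const, Finset.card_univ, Fintype.card_fin,
    smul_eq_mul]

end Hom

section GVector

open TwoTerm

variable {Λ : Type v} [Ring Λ]

theorem TwoTerm.IsRigid.injective_or_surjective_comp_d {X : TwoTerm Λ} (hX : X.IsRigid)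
    (S : Type*) [AddCommGroup S] [Module Λᵐᵒᵖ S] [IsSimpleModule Λᵐᵒᵖ S] :
    Function.Injective (fun h : X.P₀.obj →ₗ[Λᵐᵒᵖ] S => h ∘ₗ X.d) ∨
      Function.Surjective (fun h : X.P₀.obj →ₗ[Λᵐᵒᵖ] S => h ∘ₗ X.d) := by
  by_cases hker : ∀ φ : X.P₀.obj →ₗ[Λᵐᵒᵖ] S, φ ∘ₗ X.d = 0 → φ = 0
  · refine .inl fun φ φ' h => sub_eq_zero.1 (hker _ ?_)
    rw [LinearMap.sub_comp, sub_eq_zero]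
    exact h
  · push Not at hker
    obtain ⟨φ, hφd, hφ⟩ := hker
    refine .inr fun ψ => ?_
    -- Rigidity, applied to a lift `f` of `ψ` along `φ`, factors `ψ` through the differential.
    obtain ⟨f, hf⟩ := Module.projective_lifting_property φ ψ (LinearMap.surjective_of_ne_zero hφ)
    obtain ⟨h₁, h₀, h⟩ := isRigid_iff_extVanishes.1 hX f
    have hzero : φ ∘ₗ X.d ∘ₗ h₁ = 0 := by rw [← LinearMap.comp_assoc, hφd, LinearMap.zero_comp]
    refine ⟨φ ∘ₗ h₀, (LinearMap.comp_assoc _ _ _).trans ?_⟩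
    rw [← hf, h, LinearMap.comp_add, hzero, zero_add]

variable {n : ℕ} {e : Fin n → Λ} {J : Finset (Fin n)} {X : TwoTerm Λ} {g : Fin n → ℤ}

theorem TwoTerm.HasGVector.finrank_hom_eq {k : Type*} [Field k] [Algebra k Λ]
    (he : OrthogonalIdempotents e) (hg : X.HasGVector e g)
    (hJ : ∀ i, i ∉ J → g i = 0) {S : Type*} [AddCommGroup S] [Module Λᵐᵒᵖ S] [Module k S]
    [IsScalarTower k Λᵐᵒᵖ S] [Module.Finite k S] (hS : ∀ s : S, op (∑ j ∈ J, e j) • s = 0) :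
    Module.finrank k (X.P₀.obj →ₗ[Λᵐᵒᵖ] S) = Module.finrank k (X.P₁.obj →ₗ[Λᵐᵒᵖ] S) := by
  obtain ⟨a, b, ha, hb, hab⟩ := hg
  rw [ha.finrank_hom k, hb.finrank_hom k]
  refine Finset.sum_congr rfl fun i _ => ?_
  by_cases hi : i ∈ J
  · rw [(isGeneratedBy_rightIdeal (he.idem i) (he.mul_sum_of_mem hi)).finrank_hom_eq_zero hS,
      mul_zero, mul_zero]
  · have hab0 : (a i : ℤ) - b i = 0 := by rw [← hab, hJ i hi]
    rw [show a i = b i by omega]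

theorem TwoTerm.HasGVector.isSupported (k : Type u) [Field k] [Algebra k Λ] [Module.Finite k Λ]
    (he : OrthogonalIdempotents e) (hX : X.IsRigid) (hg : X.HasGVector e g)
    (hJ : ∀ i, i ∉ J → g i = 0) : X.IsSupported (∑ j ∈ J, e j) := by
  intro S _ _ _ hS
  let _ : Module k S := Module.compHom S (algebraMap k Λᵐᵒᵖ)
  have : IsScalarTower k Λᵐᵒᵖ S := IsScalarTower.of_algebraMap_smul fun _ _ => rfl
  have := finite_of_finite_op k Λ S
  have := finite_hom (k := k) (Λ := Λ) (S := S) X.P₀.obj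
  have := finite_hom (k := k) (Λ := Λ) (S := S) X.P₁.obj
  have hiff := LinearMap.injective_iff_surjective_of_finrank_eq_finrank
    (f := LinearMap.lcomp k S X.d) (hg.finrank_hom_eq he hJ hS)
  exact (hX.injective_or_surjective_comp_d S).elim (fun h => ⟨h, hiff.1 h⟩) fun h => ⟨hiff.2 h, h⟩

theorem IsBasicSystem.exists_finrank_hom_eq_mul (k : Type u) [Field k] [Algebra k Λ]
    [Module.Finite k Λ] (he : IsBasicSystem e) (i : Fin n) :
    ∃ (N : Submodule Λᵐᵒᵖ (rightIdeal (e i))) (c : ℕ), IsCoatom N ∧ c ≠ 0 ∧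
      (∀ j, j ≠ i → ∀ s : rightIdeal (e i) ⧸ N, op (e j) • s = 0) ∧
      ∀ (P : ProjCat Λ) (a : Fin n → ℕ), HasMultiplicities e P a →
        Module.finrank k (P.obj →ₗ[Λᵐᵒᵖ] rightIdeal (e i) ⧸ N) = a i * c := by
  have := isArtinianRing_op (Λ := Λ) k
  have := (isDualBasis_rightIdealGen (he.primitive i).idem).finite
  obtain ⟨N, hN, h⟩ := he.exists_isCoatom_forall_op_smul_eq_zero i
  have := finite_of_finite_op k Λ (rightIdeal (e i) ⧸ N)
  have := finite_hom (k := k) (Λ := Λ) (S := rightIdeal (e i) ⧸ N) (rightIdeal (e i))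
  have : Nontrivial (rightIdeal (e i) →ₗ[Λᵐᵒᵖ] rightIdeal (e i) ⧸ N) :=
    ⟨N.mkQ, 0, fun h0 => hN.1 (by rw [← Submodule.ker_mkQ N, h0, LinearMap.ker_zero])⟩
  refine ⟨N, Module.finrank k (rightIdeal (e i) →ₗ[Λᵐᵒᵖ] rightIdeal (e i) ⧸ N), hN,
    Module.finrank_pos.ne', h, fun P a ha => ?_⟩
  rw [ha.finrank_hom k]
  refine Finset.sum_eq_single_of_mem i (Finset.mem_univ i) fun j _ hj => ?_
  have hj' := (he.primitive j).idem
  rw [(isGeneratedBy_rightIdeal hj' hj').finrank_hom_eq_zero (h j hj), mul_zero]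

theorem op_sum_smul_eq_zero {S : Type*} [AddCommGroup S] [Module Λᵐᵒᵖ S] {i : Fin n} (hi : i ∉ J)
    (h : ∀ j, j ≠ i → ∀ s : S, op (e j) • s = 0) (s : S) : op (∑ j ∈ J, e j) • s = 0 := by
  rw [Finset.op_sum, Finset.sum_smul]
  exact Finset.sum_eq_zero fun j hj => h j (ne_of_mem_of_not_mem hj hi) s

theorem TwoTerm.IsSupported.gVector_eq_zero (k : Type u) [Field k] [Algebra k Λ] [Module.Finite k Λ]
    (he : IsBasicSystem e) (hX : X.IsSupported (∑ j ∈ J, e j)) (hg : X.HasGVector e g)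
    {i : Fin n} (hi : i ∉ J) : g i = 0 := by
  obtain ⟨N, c, hN, hc, hS, hrank⟩ := he.exists_finrank_hom_eq_mul k i
  have : IsSimpleModule Λᵐᵒᵖ (rightIdeal (e i) ⧸ N) := isSimpleModule_iff_isCoatom.2 hN
  obtain ⟨a, b, ha, hb, hab⟩ := hg
  have h := (LinearEquiv.ofBijective (LinearMap.lcomp k _ X.d)
    (hX _ (op_sum_smul_eq_zero hi hS))).finrank_eq
  rw [hrank _ _ ha, hrank _ _ hb] at h
  rw [hab, Nat.eq_of_mul_eq_mul_right (Nat.pos_of_ne_zero hc) h, sub_self]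

theorem TwoTerm.isSupported_iff_exists_gVector (k : Type u) [Field k] [Algebra k Λ]
    [Module.Finite k Λ] (he : IsBasicSystem e) (hX : X.IsRigid) :
    X.IsSupported (∑ j ∈ J, e j) ↔
      ∃ g : Fin n → ℤ, X.HasGVector e g ∧ ∀ i, i ∉ J → g i = 0 := by
  have := isArtinianRing_op (Λ := Λ) k
  constructor
  · intro h
    obtain ⟨a, ha⟩ := he.exists_hasMultiplicities X.P₀
    obtain ⟨b, hb⟩ := he.exists_hasMultiplicities X.P₁
    have hg : X.HasGVector e fun i => (a i : ℤ) - b i := ⟨a, b, ha, hb, fun _ => rfl⟩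
    exact ⟨_, hg, fun i => h.gVector_eq_zero k he hg⟩
  · rintro ⟨g, hg, hJ⟩
    exact hg.isSupported k he.complete.toOrthogonalIdempotents hX hJ

theorem isGeneratedBy_sum_iff_exists_hasMultiplicities (k : Type u) [Field k] [Algebra k Λ]
    [Module.Finite k Λ] (he : IsBasicSystem e) (P : ProjCat Λ) :
    IsGeneratedBy (∑ j ∈ J, e j) P.obj ↔
      ∃ a : Fin n → ℕ, HasMultiplicities e P a ∧ ∀ i, i ∉ J → a i = 0 := by
  have := isArtinianRing_op (Λ := Λ) k
  constructor
  · intro h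
    obtain ⟨a, ha⟩ := he.exists_hasMultiplicities P
    refine ⟨a, ha, fun i hi => ?_⟩
    obtain ⟨N, c, -, hc, hS, hrank⟩ := he.exists_finrank_hom_eq_mul k i
    have hzero := h.finrank_hom_eq_zero (k := k) (op_sum_smul_eq_zero hi hS)
    rw [hrank P a ha] at hzero
    exact (Nat.mul_eq_zero.1 hzero).resolve_right hc
  · rintro ⟨a, ⟨f⟩, ha⟩
    refine IsGeneratedBy.map (M := ∀ i, Fin (a i) → rightIdeal (e i))
      (.pi fun i => .pi fun l => ?_) f.symm.surjective
    by_cases hi : i ∈ J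
    · exact isGeneratedBy_rightIdeal (he.primitive i).idem
        (he.complete.toOrthogonalIdempotents.mul_sum_of_mem hi)
    · exact (Fin.cast (ha i hi) l).elim0

theorem TwoTerm.isSupportedOn_iff_isGenerated (k : Type u) [Field k] [Algebra k Λ]
    [Module.Finite k Λ] (he : IsBasicSystem e) :
    X.IsSupportedOn e J ↔ X.IsGenerated (∑ j ∈ J, e j) := by
  unfold TwoTerm.IsSupportedOn
  rw [← isGeneratedBy_sum_iff_exists_hasMultiplicities k he,
    ← isGeneratedBy_sum_iff_exists_hasMultiplicities k he]
  exact ⟨fun h => ⟨h.2, h.1⟩, fun h => ⟨h.2, h.1⟩⟩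

theorem siltingVerticesOn_eq (k : Type u) [Field k] [Algebra k Λ] [Module.Finite k Λ]
    (he : IsBasicSystem e) : siltingVerticesOn e J = {x | x.rep.IsSupported (∑ j ∈ J, e j)} :=
  Set.ext fun x => (isSupported_iff_exists_gVector k he x.isRigid_rep).symm

theorem siltingVerticesSupportedOn_eq (k : Type u) [Field k] [Algebra k Λ] [Module.Finite k Λ]
    (he : IsBasicSystem e) :
    siltingVerticesSupportedOn e J = {x | x.rep.IsSupported (∑ j ∈ J, e j)} := by
  have := isArtinianRing_op (Λ := Λ) k
  ext x
  constructor
  · rintro ⟨Y, hY, hxY⟩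
    exact ((isSupportedOn_iff_isGenerated k he).1 hY).isSupported.of_isRetract hxY.isRetract
  · intro h
    obtain ⟨Y, hY, hxY⟩ :=
      h.exists_isGenerated he.complete.toOrthogonalIdempotents.isIdempotentElem_sum
    exact ⟨Y, (isSupportedOn_iff_isGenerated k he).2 hY, hxY⟩

theorem TauPair.Corresponds.exists_gVector_iff {k : Type u} [Field k] [Algebra k Λ]
    [Module.Finite k Λ] (he : IsBasicSystem e) {V : TauPair Λ} (h : V.Corresponds X)
    (hV : V.IsRigid k) :
    (∃ g : Fin n → ℤ, V.HasGVector e g ∧ ∀ i, i ∉ J → g i = 0) ↔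
      X.IsSupported (∑ j ∈ J, e j) := by
  have := isArtinianRing_op (Λ := Λ) k
  constructor
  · rintro ⟨g, ⟨Y, π, hY, a, b, c, ha, hb, hc, hg⟩, hJ⟩
    have h' : V.Corresponds (Y.addShift V.P) := ⟨Y, π, hY, .refl _⟩
    have hg' : (Y.addShift V.P).HasGVector e g :=
      ⟨a, _, ha, hb.prod hc, fun i => by rw [hg]; push_cast; ring⟩
    have hsupp := hg'.isSupported k he.complete.toOrthogonalIdempotents ((h'.isRigid_iff k).1 hV) hJ
    exact hsupp.of_isRetract (h.twoTerm_isIsomorphic h' ⟨⟨.refl _ _⟩, ⟨.refl _ _⟩⟩).isRetract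
  · intro hX
    obtain ⟨Y, π, hY, hXY⟩ := h
    obtain ⟨a, ha⟩ := he.exists_hasMultiplicities Y.P₀
    obtain ⟨b, hb⟩ := he.exists_hasMultiplicities Y.P₁
    obtain ⟨c, hc⟩ := he.exists_hasMultiplicities V.P
    have hg : (Y.addShift V.P).HasGVector e fun i => (a i : ℤ) - b i - c i :=
      ⟨a, _, ha, hb.prod hc, fun i => by push_cast; ring⟩
    exact ⟨_, ⟨Y, π, hY, a, b, c, ha, hb, hc, fun _ => rfl⟩,
      fun i => (hX.of_isRetract hXY.symm.isRetract).gVector_eq_zero k he hg⟩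

end GVector

end SiltingCorner

theorem theorem1p1 (k : Type u) [Field k] (Λ : Type v) [Ring Λ] [Algebra k Λ]
    [Module.Finite k Λ] {n : ℕ} (e : Fin n → Λ) (he : SiltingCorner.IsBasicSystem e)
    (J : Finset (Fin n)) (hJ : J.Nonempty) :
    -- the support `τ`-tilting complexes and their dual graphs
    ((SiltingCorner.tauTiltingComplex
        (SiltingCorner.CornerAlgebra he.complete.toOrthogonalIdempotents J) k).Isomorphic
      ((SiltingCorner.tauTiltingComplex Λ k).induced (SiltingCorner.tauVerticesOn e J k)) ∧
    Nonempty ((SiltingCorner.tauTiltingComplex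
        (SiltingCorner.CornerAlgebra he.complete.toOrthogonalIdempotents J) k).dualGraph ≃g
      ((SiltingCorner.tauTiltingComplex Λ k).induced
        (SiltingCorner.tauVerticesOn e J k)).dualGraph)) ∧
    -- the 2-term silting complexes and their dual graphs
    ((SiltingCorner.siltingComplex
        (SiltingCorner.CornerAlgebra he.complete.toOrthogonalIdempotents J)).Isomorphic
      ((SiltingCorner.siltingComplex Λ).induced (SiltingCorner.siltingVerticesOn e J)) ∧
    Nonempty ((SiltingCorner.siltingComplex
        (SiltingCorner.CornerAlgebra he.complete.toOrthogonalIdempotents J)).dualGraph ≃g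
      ((SiltingCorner.siltingComplex Λ).induced
        (SiltingCorner.siltingVerticesOn e J)).dualGraph)) ∧
    -- the two descriptions of the vertices of the induced 2-term silting complex agree
    SiltingCorner.siltingVerticesOn e J = SiltingCorner.siltingVerticesSupportedOn e J := by
  open SiltingCorner in
  have := isArtinianRing_op (Λ := Λ) k
  have hs : (siltingComplex (CornerAlgebra he.complete.toOrthogonalIdempotents J)).Isomorphic
      ((siltingComplex Λ).induced (siltingVerticesOn e J)) := by
    rw [siltingVerticesOn_eq k he]
    exact siltingComplex_corner_isomorphic _
  have ht : (tauTiltingComplex (CornerAlgebra he.complete.toOrthogonalIdempotents J) k).Isomorphic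
      ((tauTiltingComplex Λ k).induced (tauVerticesOn e J k)) := by
    obtain ⟨φ, -, hφ⟩ := exists_tauVertex_equiv_mem_faces_iff
      (CornerAlgebra he.complete.toOrthogonalIdempotents J) k
    obtain ⟨ψ, hψ, hψ'⟩ := exists_tauVertex_equiv_mem_faces_iff Λ k
    refine isomorphic_trans (isomorphic_trans ⟨φ, hφ⟩ hs)
      (isomorphic_symm (isomorphic_induced ψ hψ' fun x => ?_))
    rw [siltingVerticesOn_eq k he]
    exact (hψ x).exists_gVector_iff he x.isRigid_rep
  exact ⟨⟨ht, nonempty_dualGraph_iso ht⟩, ⟨hs, nonempty_dualGraph_iso hs⟩,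
    (siltingVerticesOn_eq k he).trans (siltingVerticesSupportedOn_eq k he).symm⟩
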